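/- Let $d\ge 1$, let $\langle x,y\rangle_L=x_1y_1+\dots+x_dy_d-x_{d+1}y_{d+1}$ on $\mathbb R^{d,1}$, and let $\mathbb H^d=\{q:\langle q,q\rangle_L=-1,\ q_{d+1}>0\}$ be hyperbolic space with the metric induced by $\langle\cdot,\cdot\rangle_L$ and distance $\theta(q,Z)=\operatorname{arcosh}(-\langle q,Z\rangle_L)$. Let $e\in\mathbb R^d$ be a unit vector, $0<a<1$, and let $Z_1,Z_2,O\in\mathbb H^d$ be the points whose central projections to $\mathbb R^d\times\{1\}$ are $ae$, $-ae$, $0$. Let $m_1>0$ and $m_2,f\in\mathbb R$. The tangent bundle $T\mathbb H^d$ carries the Poisson bracket $\{\cdot,\cdot\}$ transported from $T^*\mathbb H^d$ by the Legendre transformation. Let $$E_{Kep}(q,v)=\tfrac12\langle v,v\rangle_L-m_1\coth\theta(q,Z_1)$$ be the energy of the hyperbolic Kepler problem $\nabla_{\dot q}\dot q=-\operatorname{grad}\bigl(-m_1\coth\theta(q,Z_1)\bigr)$. Let $\mathcal R\subset T\mathbb H^d$ be the set of points through which the Kepler orbit is non-singular, defined for all times and closed (periodic), and does not pass through $Z_2$.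 Let $V_2$ be either of the perturbing potentials $$-m_2\coth\theta(q,Z_2)\quad\text{(two-center problem)},\qquad -m_2\coth\theta(q,Z_2)+f\tanh^2\theta(q,O)\quad\text{(Lagrange problem)},$$ and define the Hamiltonian of the partially-averaged system on $\mathcal R$ by $$E_a=E_{Kep}+\frac1T\int_0^T V_2(q(t))\,dt,$$ where $t\mapsto q(t)$ is the closed Kepler orbit through the given point and $T>0$ is a period of it. Let $D=C^2-2hA_1$, where the right-hand side is computed in the chart of central projection, as follows. Equip $\mathbb R^d$ with the scalar product $\langle x,y\rangle_a=x\cdot y+\bigl(\tfrac1{1-a^2}-1\bigr)(x\cdot e)(y\cdot e)$ and norm $|\cdot|_a$. For $(q,v)\in T\mathbb H^d$ write $q=(q_s,q_t)$, $v=(v_s,v_t)$ with $q_s,v_s\in\mathbb R^d$ and $q_t,v_t\in\mathbb R$, and put $y=q_s/q_t-ae$, $w=q_tv_s-v_tq_s$ (position relative to the first center, and velocity in the time $\tau$ with $d\tau=dt/q_t^2$), and $\mu=m_1/\sqrt{1-a^2}$. Then $$C^2=|y|_a^2|w|_a^2-\langle y,w\rangle_a^2,\qquad h=\frac a{\sqrt{1-a^2}},\qquad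 A_1=\Bigl\langle |w|_a^2\,y-\langle y,w\rangle_a\,w-\mu\frac{y}{|y|_a},\ -\sqrt{1-a^2}\,e\Bigr\rangle_a,$$ i.e. $C$ is the angular momentum about the first center, $h$ is half of the distance between the two centers, and $A_1$ is the component of the Laplace-Runge-Lenz vector in the direction from the first center to the second. Then, for the two-center problem as well as for the Lagrange problem, $E_a$ and $D$ are differentiable at every point of $\mathcal R$, and $D$ is a first integral of the partially-averaged system: $\{E_a,D\}=0$ on $\mathcal R$. -/

import Mathlib

noncomputable section

namespace HypKepler

/-- Euclidean space `ℝ^d`. -/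
abbrev Eu (d : ℕ) : Type := EuclideanSpace ℝ (Fin d)

/-- The vector space underlying `ℝ^{d,1}`: spatial part and time coordinate. -/
abbrev Mink (d : ℕ) : Type := Eu d × ℝ

/-- The Lorentz form `x₁y₁ + ⋯ + x_d y_d - x_{d+1} y_{d+1}` of `ℝ^{d,1}`. -/
def mink {d : ℕ} (x y : Mink d) : ℝ := inner ℝ x.1 y.1 - x.2 * y.2

/-- Hyperbolic space `ℍ^d`: the upper sheet of the unit pseudosphere. -/
def Hyp (d : ℕ) : Set (Mink d) := {q | mink q q = -1 ∧ 0 < q.2}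

/-- The tangent bundle `Tℍ^d`, as pairs (position, velocity) in `ℝ^{d,1}`. -/
def THyp (d : ℕ) : Set (Mink d × Mink d) := {z | z.1 ∈ Hyp d ∧ mink z.1 z.2 = 0}

/-- Hyperbolic distance (for `q, z` on `ℍ^d`). -/
def hdist {d : ℕ} (q z : Mink d) : ℝ := Real.arcosh (-mink q z)

/-- Hyperbolic cotangent. -/
def coth (θ : ℝ) : ℝ := Real.cosh θ / Real.sinh θ

/-- Hyperbolic Kepler potential of a center `Z` of mass `m`. -/
def keplerPot {d : ℕ} (m : ℝ) (Z q : Mink d) : ℝ := -(m * coth (hdist q Z))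

/-- Hyperbolic Hooke potential with center `Z` and factor `f`. -/
def hookePot {d : ℕ} (f : ℝ) (Z q : Mink d) : ℝ := f * Real.tanh (hdist q Z) ^ 2

/-- The point of `ℍ^d` whose central projection to `ℝ^d × {1}` is `x`, where `‖x‖ < 1`. -/
def lift {d : ℕ} (x : Eu d) : Mink d :=
  ((√(1 - ‖x‖ ^ 2))⁻¹ • x, (√(1 - ‖x‖ ^ 2))⁻¹)

/-! ### Kepler motion -/

/-- `q`, with velocity `v`, is a non-singular motion, defined for all times, in the hyperbolic
Kepler problem with center `Z` of mass `m`, i.e. a solution of `∇_{q'} q' = -grad V`.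
The covariant acceleration is the tangential part of `q'' = A`; the equation is tested against
all tangent vectors `w` at `q t`. -/
structure IsKeplerMotion {d : ℕ} (m : ℝ) (Z : Mink d) (q v : ℝ → Mink d) : Prop where
  mem_hyp : ∀ t, q t ∈ Hyp d
  ne_center : ∀ t, q t ≠ Z
  hasDerivAt_pos : ∀ t, HasDerivAt q (v t) t
  newton : ∀ t, ∃ A : Mink d, HasDerivAt v A t ∧
    ∀ w : Mink d, mink (q t) w = 0 → mink A w = -fderiv ℝ (keplerPot m Z) (q t) w

/-- `q`, with velocity `v`, is a closed non-singular Kepler orbit with period `T` that starts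
at the point `z` of the tangent bundle. -/
structure IsClosedOrbit {d : ℕ} (m : ℝ) (Z : Mink d) (z : Mink d × Mink d)
    (q v : ℝ → Mink d) (T : ℝ) : Prop where
  motion : IsKeplerMotion m Z q v
  start : (q 0, v 0) = z
  period_pos : 0 < T
  periodic : Function.Periodic q T

/-- The averaging region: the points of `Tℍ^d` whose Kepler orbit with respect to `Z` is
closed and does not pass through the other center `Z'`. -/
def region {d : ℕ} (m : ℝ) (Z Z' : Mink d) : Set (Mink d × Mink d) :=
  {z | z ∈ THyp d ∧ ∃ (q v : ℝ → Mink d) (T : ℝ),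
    IsClosedOrbit m Z z q v T ∧ ∀ t, q t ≠ Z'}

open Classical in
/-- The average of `V` over the closed Kepler orbit through `z`, parametrized proportionally to
time by the circle. (The orbit is unique, and every period gives the same average; the value is
`0` where there is no closed orbit.) -/
def orbitMean {d : ℕ} (m : ℝ) (Z : Mink d) (V : Mink d → ℝ) (z : Mink d × Mink d) : ℝ :=
  if h : ∃ o : (ℝ → Mink d) × (ℝ → Mink d) × ℝ, IsClosedOrbit m Z z o.1 o.2.1 o.2.2 then
    (h.choose.2.2)⁻¹ * ∫ t in (0 : ℝ)..h.choose.2.2, V (h.choose.1 t)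
  else 0

/-- The energy of the hyperbolic Kepler problem. -/
def keplerEnergy {d : ℕ} (m : ℝ) (Z : Mink d) (z : Mink d × Mink d) : ℝ :=
  mink z.2 z.2 / 2 + keplerPot m Z z.1

/-- The Hamiltonian of the partially-averaged system for the perturbing potential `V`. -/
def averagedEnergy {d : ℕ} (m : ℝ) (Z : Mink d) (V : Mink d → ℝ) (z : Mink d × Mink d) : ℝ :=
  keplerEnergy m Z z + orbitMean m Z V z

/-! ### The Poisson bracket of `Tℍ^d`

`ℍ^d` carries the global coordinates `s ∈ ℝ^d`, `q = (s, √(1 + |s|²))`; with the conjugate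
momenta `p` they are canonical coordinates of `T^*ℍ^d`, and the Legendre transformation
identifies `T^*ℍ^d` with `Tℍ^d`. -/

/-- The point of `Tℍ^d` with canonical coordinates `(s, p)`. -/
def ofCanonical {d : ℕ} (c : Eu d × Eu d) : Mink d × Mink d :=
  ((c.1, √(1 + ‖c.1‖ ^ 2)),
   (c.2 + inner ℝ c.1 c.2 • c.1, √(1 + ‖c.1‖ ^ 2) * inner ℝ c.1 c.2))

/-- The canonical coordinates `(s, p)` of a point of `Tℍ^d`. -/
def toCanonical {d : ℕ} (z : Mink d × Mink d) : Eu d × Eu d :=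
  (z.1.1, z.2.1 - (z.2.2 / z.1.2) • z.1.1)

/-- The canonical Poisson bracket on `ℝ^d × ℝ^d`. -/
def canonicalBracket {d : ℕ} (F G : Eu d × Eu d → ℝ) (c : Eu d × Eu d) : ℝ :=
  ∑ i : Fin d,
    (fderiv ℝ F c (EuclideanSpace.single i 1, 0) * fderiv ℝ G c (0, EuclideanSpace.single i 1)
      - fderiv ℝ F c (0, EuclideanSpace.single i 1) * fderiv ℝ G c (EuclideanSpace.single i 1, 0))

/-- The Poisson bracket on `Tℍ^d`, transported from `T^*ℍ^d`. -/
def poisson {d : ℕ} (F G : Mink d × Mink d → ℝ) (z : Mink d × Mink d) : ℝ :=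
  canonicalBracket (F ∘ ofCanonical) (G ∘ ofCanonical) (toCanonical z)

/-- Differentiability of a function on `Tℍ^d` at a point. -/
def DiffAtTHyp {d : ℕ} (F : Mink d × Mink d → ℝ) (z : Mink d × Mink d) : Prop :=
  DifferentiableAt ℝ (F ∘ ofCanonical) (toCanonical z)

theorem ofCanonical_mem {d : ℕ} (c : Eu d × Eu d) : ofCanonical c ∈ THyp d := by
  have h : (0 : ℝ) < 1 + ‖c.1‖ ^ 2 := by positivity
  have h2 := Real.mul_self_sqrt h.le
  refine ⟨⟨?_, Real.sqrt_pos.2 h⟩, ?_⟩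
  · simp only [mink, ofCanonical, real_inner_self_eq_norm_sq]
    linarith
  · simp only [mink, ofCanonical, inner_add_right, inner_smul_right, real_inner_self_eq_norm_sq]
    linear_combination (-(inner ℝ c.1 c.2 : ℝ)) * h2

theorem toCanonical_ofCanonical {d : ℕ} (c : Eu d × Eu d) :
    toCanonical (ofCanonical c) = c := by
  have h : √(1 + ‖c.1‖ ^ 2) ≠ 0 := (Real.sqrt_pos.2 (by positivity)).ne'
  ext1
  · rfl
  · simp [toCanonical, ofCanonical, mul_div_cancel_left₀ _ h]

theorem ofCanonical_toCanonical {d : ℕ} {z : Mink d × Mink d} (hz : z ∈ THyp d) :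
    ofCanonical (toCanonical z) = z := by
  obtain ⟨⟨s, t⟩, ⟨u, r⟩⟩ := z
  obtain ⟨⟨h1, h2⟩, h3⟩ := hz
  simp only [mink, real_inner_self_eq_norm_sq] at h1 h2 h3
  have ht : √(1 + ‖s‖ ^ 2) = t := by
    rw [show 1 + ‖s‖ ^ 2 = t ^ 2 by linarith, Real.sqrt_sq h2.le]
  have hi : (inner ℝ s (u - (r / t) • s) : ℝ) = r / t := by
    rw [inner_sub_right, inner_smul_right, real_inner_self_eq_norm_sq,
      show ‖s‖ ^ 2 = t * t - 1 by linarith, show (inner ℝ s u : ℝ) = t * r by linarith]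
    field_simp
    ring
  simp only [ofCanonical, toCanonical, ht, hi, sub_add_cancel, mul_div_cancel₀ _ h2.ne']

/-- The coordinates `p` are the momenta conjugate to `s`: `p` pairs with `w` as the velocity
pairs, in the Lorentz form, with the tangent vector `∂q/∂s (w)` of `q = (s, √(1 + |s|²))`. -/
theorem inner_toCanonical_snd {d : ℕ} {z : Mink d × Mink d} (w : Eu d) :
    inner ℝ (toCanonical z).2 w = mink z.2 (w, inner ℝ z.1.1 w / z.1.2) := by
  simp only [toCanonical, mink, inner_sub_left, real_inner_smul_left]
  ring

/-! ### The function `D` -/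

/-- Position in the chart `ℝ^d` given by central projection to `ℝ^d × {1}`. -/
def chartPos {d : ℕ} (z : Mink d × Mink d) : Eu d := (z.1.2)⁻¹ • z.1.1

/-- Velocity in the chart, in the Euclidean time `τ` of the projective correspondence
(`dτ = dt / q_{d+1}²`). -/
def chartVel {d : ℕ} (z : Mink d × Mink d) : Eu d := z.1.2 • z.2.1 - z.2.2 • z.1.1

/-- The scalar product of the norm `‖·‖_a` on `ℝ^d`, whose square is the Euclidean one with the
squared component along the unit vector `e` divided by `1 - a²`. -/
def affInner {d : ℕ} (a : ℝ) (e x y : Eu d) : ℝ :=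
  inner ℝ x y + ((1 - a ^ 2)⁻¹ - 1) * (inner ℝ x e * inner ℝ y e)

/-- The squared angular momentum `C²` of position `y` and velocity `w`, with respect to the norm
`‖·‖_a`. -/
def angMomSq {d : ℕ} (a : ℝ) (e y w : Eu d) : ℝ :=
  affInner a e y y * affInner a e w w - affInner a e y w ^ 2

/-- The Laplace-Runge-Lenz vector `|w|² y - ⟨y, w⟩ w - μ y / |y|` of the Kepler problem of mass
`μ` in the norm `‖·‖_a`, with `y` the position relative to the center and `w` the velocity. -/
def lrl {d : ℕ} (μ a : ℝ) (e y w : Eu d) : Eu d :=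
  affInner a e w w • y - affInner a e y w • w - (μ / √(affInner a e y y)) • y

/-- `D = C² - 2 h A₁` as a function on `Tℍ^d`, the centers being the lifts of `± a e`. In the
chart, `C` and `A₁` belong to the Kepler center `a e` of mass `m / √(1 - a²)` (projectively
corresponding to the hyperbolic Kepler problem of mass `m`), `A₁` is the component of the
Laplace-Runge-Lenz vector along the unit vector `-√(1 - a²) e` from `a e` towards `-a e`, and
`h = a / √(1 - a²)` is half of the distance of the centers, all in the norm `‖·‖_a`. -/
def D {d : ℕ} (m a : ℝ) (e : Eu d) (z : Mink d × Mink d) : ℝ :=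
  angMomSq a e (chartPos z - a • e) (chartVel z)
    - 2 * (a / √(1 - a ^ 2)) *
      affInner a e (lrl (m / √(1 - a ^ 2)) a e (chartPos z - a • e) (chartVel z))
        (-√(1 - a ^ 2) • e)

/-! ### The two-center and Lagrange problems -/

/-- In the two-center problem with centers the lifts of `± a e`, the perturbation of the Kepler
problem of the first center: the Kepler potential of mass `m₂` of the second center. -/
def twoCenterPert {d : ℕ} (m₂ a : ℝ) (e : Eu d) (q : Mink d) : ℝ :=
  keplerPot m₂ (lift (-a • e)) q

/-- In the Lagrange problem, there is in addition a Hooke potential of factor `f` centered at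
the midpoint of the two Kepler centers. -/
def lagrangePert {d : ℕ} (m₂ f a : ℝ) (e : Eu d) (q : Mink d) : ℝ :=
  keplerPot m₂ (lift (-a • e)) q + hookePot f (lift 0) q

end HypKepler

end

noncomputable section

/-! Central projection, together with the time change `dτ = dt / q_t²`, turns the hyperbolic Kepler
problem into a Euclidean one for the norm `|·|_a`. An affine normalization (`nPos`, `nVel`) makes
this norm the standard one and puts the first center at `0` and the second at `2 h e`, where `h =
halfDist a`. Closed orbits become Kepler ellipses `Y(u)` in the eccentric anomaly `u`. With `P = 1 -
|x|²` and mean motion `ω`, one has `dt = dτ / P` and `dτ = |Y| du / ω`, so the time average of `V`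
is `∫ (|Y| / P) V du` divided by `∫ (|Y| / P) du`, both over `[0, 2π]`.

The bracket `{E_a, D}` is the derivative of `E_a` along the Hamiltonian field `X` of `D`. The
decisive fact (`conic_variation`) is that `X` preserves `ω` and displaces the point `Y(u)` of an
ellipse by `ω K_Y Y' - κ Y'`, where `κ` does not depend on `u` and the linear operator `K_y`
(`orbitShift`) depends on the position alone. Hence, if `dΨ_y ∘ K_y = dS_y` for some function `S`
(`IsShiftPair`), the derivative of `Ψ(Y(u))` along `X` is the total derivative `d/du (ω S(Y) - κ
Ψ(Y))`, and its integral over the closed ellipse vanishes (`orbitIntegral_variation`). Such an `S`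
exists for `|y|`, for `|y| / P`, and for `|y| / P` times the potential of the second center. The
Hooke potential is a multiple of `1 - P`, so these three functions span all integrands that occur.

The Kepler energy is a linear combination of `ω²`, `D` and the squared angular momentum of the
components orthogonal to `e` (`keplerEnergy_eq_chartEnergy`), each of which is invariant under `X`.

The remaining work identifies motions with ellipses. A closed motion is an ellipse traversed a whole
number of times (`rotate_eq`, `exists_anomaly_period`); conversely every ellipse that avoids the
first center and stays in the chart is a closed motion (`exists_isClosedOrbit`). The ellipses that
in addition avoid the second center form an open set of initial values (`IsAdmissible.eventually`),
so the quotient formula for the average holds in a neighbourhood and `E_a` can be differentiated. -/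

namespace HypKepler

/-! ### Kepler ellipses in the eccentric anomaly. -/

section Conic
variable {E : Type*} [NormedAddCommGroup E] [InnerProductSpace ℝ E]

/-- The major semi-axis of the ellipse with a focus at `0` through `y`, with velocity `η` with
respect to the eccentric anomaly. -/
def conicAxis (y η : E) : ℝ := (‖y‖ ^ 2 + ‖η‖ ^ 2) / (2 * ‖y‖)

/-- The center of that ellipse. -/
def conicCtr (y η : E) : E :=
  (1 - conicAxis y η / ‖y‖) • y + (inner ℝ y η / ‖y‖ ^ 2) • η

/-- That ellipse, parametrized by the eccentric anomaly (counted from `y`). -/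
def conic (y η : E) (u : ℝ) : E :=
  Real.cos u • y + Real.sin u • η + (1 - Real.cos u) • conicCtr y η

/-- The derivative of `conic`. -/
def conicVel (y η : E) (u : ℝ) : E :=
  Real.cos u • η + Real.sin u • (conicCtr y η - y)

/-- The distance of the points of the ellipse from the focus (up to sign). -/
def conicRad (y η : E) (u : ℝ) : ℝ :=
  Real.cos u * ‖y‖ + Real.sin u * (inner ℝ y η / ‖y‖) + (1 - Real.cos u) * conicAxis y η

/-- The derivative of `conicRad`. -/
def conicRadVel (y η : E) (u : ℝ) : ℝ :=
  Real.cos u * (inner ℝ y η / ‖y‖) + Real.sin u * (conicAxis y η - ‖y‖)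

/-- The infinitesimal rotation of the bivector `x ∧ y`. -/
def wedge (x y v : E) : E := (inner ℝ y v : ℝ) • x - (inner ℝ x v : ℝ) • y

/-- The component orthogonal to the unit vector `e`. -/
def perp (e y : E) : E := y - (inner ℝ y e : ℝ) • e

variable {y η : E}

theorem conic_zero : conic y η 0 = y := by simp [conic]
theorem conicVel_zero : conicVel y η 0 = η := by simp [conicVel]
theorem conicRad_zero : conicRad y η 0 = ‖y‖ := by simp [conicRad]

theorem conic_periodic (y η : E) : Function.Periodic (conic y η) (2 * Real.pi) := fun u => by
  simp [conic]

theorem conicRad_periodic (y η : E) : Function.Periodic (conicRad y η) (2 * Real.pi) := fun u => by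
  simp [conicRad]

theorem hasDerivAt_conic (y η : E) (u : ℝ) : HasDerivAt (conic y η) (conicVel y η u) u := by
  have h := (((Real.hasDerivAt_cos u).smul_const y).add ((Real.hasDerivAt_sin u).smul_const η)).add
    (((Real.hasDerivAt_cos u).const_sub 1).smul_const (conicCtr y η))
  refine h.congr_deriv ?_
  simp only [conicVel]; module

theorem hasDerivAt_conicVel (y η : E) (u : ℝ) :
    HasDerivAt (conicVel y η) (conicCtr y η - conic y η u) u := by
  have h := ((Real.hasDerivAt_cos u).smul_const η).add
    ((Real.hasDerivAt_sin u).smul_const (conicCtr y η - y))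
  refine h.congr_deriv ?_
  simp only [conic]; module

theorem hasDerivAt_conicRad (y η : E) (u : ℝ) :
    HasDerivAt (conicRad y η) (conicRadVel y η u) u := by
  have h := (((Real.hasDerivAt_cos u).mul_const ‖y‖).add
    ((Real.hasDerivAt_sin u).mul_const (inner ℝ y η / ‖y‖))).add
    (((Real.hasDerivAt_cos u).const_sub 1).mul_const (conicAxis y η))
  refine h.congr_deriv ?_
  simp only [conicRadVel]; ring

theorem continuous_conic (y η : E) : Continuous (conic y η) :=
  continuous_iff_continuousAt.2 fun u => (hasDerivAt_conic y η u).continuousAt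

theorem continuous_conicRad (y η : E) : Continuous (conicRad y η) :=
  continuous_iff_continuousAt.2 fun u => (hasDerivAt_conicRad y η u).continuousAt

theorem conic_eq_combination (y η : E) (u : ℝ) : conic y η u =
    (1 - (1 - Real.cos u) * (conicAxis y η / ‖y‖)) • y +
      (Real.sin u + (1 - Real.cos u) * (inner ℝ y η / ‖y‖ ^ 2)) • η := by
  simp only [conic, conicCtr]; module

theorem conicVel_eq_combination (y η : E) (u : ℝ) : conicVel y η u =
    (-(Real.sin u * (conicAxis y η / ‖y‖))) • y +
      (Real.cos u + Real.sin u * (inner ℝ y η / ‖y‖ ^ 2)) • η := by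
  simp only [conicVel, conicCtr]; module

theorem norm_sq_eq_conicAxis {E : Type*} [NormedAddCommGroup E] {y : E} (hy : y ≠ 0) (η : E) :
    ‖η‖ ^ 2 = 2 * conicAxis y η * ‖y‖ - ‖y‖ ^ 2 := by
  have := norm_ne_zero_iff.2 hy
  rw [conicAxis]; field_simp; ring

theorem norm_sq_combination (x y : E) (α β : ℝ) :
    ‖α • x + β • y‖ ^ 2 = α ^ 2 * ‖x‖ ^ 2 + 2 * α * β * inner ℝ x y + β ^ 2 * ‖y‖ ^ 2 := by
  simp only [← real_inner_self_eq_norm_sq, inner_add_left, inner_add_right, real_inner_smul_left,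
    real_inner_smul_right, real_inner_comm x y]
  ring

/-- The focus property: the semi-axis and the center are chosen so that the distance from `0` is
affine in `cos u` and `sin u`. Only squares are compared, since `conicRad` may change sign on a
degenerate ellipse through the focus. -/
theorem norm_conic_sq (hy : y ≠ 0) (η : E) (u : ℝ) :
    ‖conic y η u‖ ^ 2 = conicRad y η u ^ 2 := by
  have := norm_ne_zero_iff.2 hy
  rw [conic_eq_combination, norm_sq_combination, norm_sq_eq_conicAxis hy η, conicRad]
  field_simp
  have h := Real.sin_sq_add_cos_sq u
  set c := Real.cos u
  set s := Real.sin u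
  set R := ‖y‖
  set p : ℝ := inner ℝ y η
  set ρ := conicAxis y η
  have hs : s ^ 2 = 1 - c ^ 2 := by linarith
  ring_nf
  simp only [hs]
  ring_nf

theorem inner_conic_conicVel (hy : y ≠ 0) (η : E) (u : ℝ) :
    inner ℝ (conic y η u) (conicVel y η u) = conicRad y η u * conicRadVel y η u := by
  have h1 : HasDerivAt (fun u => ‖conic y η u‖ ^ 2) _ u := (hasDerivAt_conic y η u).norm_sq
  have h2 := ((hasDerivAt_conicRad y η u).pow 2).congr_of_eventuallyEq
    (Filter.Eventually.of_forall (norm_conic_sq hy η) : (fun u => ‖conic y η u‖ ^ 2) =ᶠ[_] _)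
  have := h1.unique h2
  norm_num at this
  linarith

theorem wedge_combination (x y v : E) (α β γ δ : ℝ) :
    wedge (α • x + β • y) (γ • x + δ • y) v = (α * δ - β * γ) • wedge x y v := by
  simp only [wedge, inner_add_left, real_inner_smul_left]
  module

theorem perp_combination (e x y : E) (α β : ℝ) :
    perp e (α • x + β • y) = α • perp e x + β • perp e y := by
  simp only [perp, inner_add_left, real_inner_smul_left]
  module

/-- The determinant of position and velocity in the frame `(y, η)`: the area law in the eccentric
anomaly. Every bivector built linearly from `Y ∧ Y'` therefore scales by `R / |y|` along the orbit.
-/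
theorem conic_det (hy : y ≠ 0) (η : E) (u : ℝ) :
    (1 - (1 - Real.cos u) * (conicAxis y η / ‖y‖)) *
      (Real.cos u + Real.sin u * (inner ℝ y η / ‖y‖ ^ 2)) -
      (Real.sin u + (1 - Real.cos u) * (inner ℝ y η / ‖y‖ ^ 2)) *
      (-(Real.sin u * (conicAxis y η / ‖y‖))) = conicRad y η u / ‖y‖ := by
  have := norm_ne_zero_iff.2 hy
  rw [conicRad]
  field_simp
  linear_combination (conicAxis y η * ‖y‖ ^ 2) * Real.sin_sq_add_cos_sq u

theorem wedge_conic (hy : y ≠ 0) (η : E) (u : ℝ) (v : E) :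
    wedge (conic y η u) (conicVel y η u) v = (conicRad y η u / ‖y‖) • wedge y η v := by
  rw [conic_eq_combination, conicVel_eq_combination, wedge_combination, conic_det hy]

theorem wedge_perp_conic (hy : y ≠ 0) (η e : E) (u : ℝ) (v : E) :
    wedge (perp e (conic y η u)) (perp e (conicVel y η u)) v =
      (conicRad y η u / ‖y‖) • wedge (perp e y) (perp e η) v := by
  rw [conic_eq_combination, conicVel_eq_combination, perp_combination, perp_combination,
    wedge_combination, conic_det hy]

/-- `conicRad` is continuous, positive at `u = 0`, and its square is `‖Y‖²`, so it cannot vanish or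
change sign on an orbit that avoids the focus. -/
theorem conicRad_pos (hy : y ≠ 0) (h : ∀ u, conic y η u ≠ 0) (u : ℝ) : 0 < conicRad y η u := by
  have h0 : ∀ u, conicRad y η u ≠ 0 := fun u hu => h u <| by
    have := norm_conic_sq hy η u
    rw [hu] at this
    simpa using this
  by_contra! hu
  obtain ⟨v, -, hv⟩ := intermediate_value_uIcc (continuous_conicRad y η).continuousOn
    (show (0 : ℝ) ∈ Set.uIcc (conicRad y η u) (conicRad y η 0) from
      Set.mem_uIcc.2 (Or.inl ⟨hu, by rw [conicRad_zero]; positivity⟩))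
  exact h0 v hv

theorem norm_conic (hy : y ≠ 0) (h : ∀ u, conic y η u ≠ 0) (u : ℝ) :
    ‖conic y η u‖ = conicRad y η u := by
  rw [← abs_of_pos (conicRad_pos hy h u), ← abs_norm]
  exact (sq_eq_sq_iff_abs_eq_abs _ _).1 (norm_conic_sq hy η u)

/-- The Kepler equation along the ellipse. -/
theorem conic_newton (hy : y ≠ 0) (η : E) (u : ℝ) :
    conicRad y η u • (conicCtr y η - conic y η u) - conicRadVel y η u • conicVel y η u =
      -(conicAxis y η) • conic y η u := by
  have := norm_ne_zero_iff.2 hy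
  have h := Real.sin_sq_add_cos_sq u
  rw [conic_eq_combination, conicVel_eq_combination, conicCtr, conicRad, conicRadVel]
  match_scalars
  · field_simp
    linear_combination (‖y‖ * conicAxis y η ^ 2 - ‖y‖ ^ 2 * conicAxis y η) * h
  · field_simp
    linear_combination (-(‖y‖ * conicAxis y η * inner ℝ y η)) * h

end Conic

/-! ### The Hamiltonian field of `D` and its action on the orbital elements. -/

section Field
variable {E : Type*} [NormedAddCommGroup E] [InnerProductSpace ℝ E]

/-- The function `D` in the normalized chart: the second center is `2 h e`. -/
def chartD (μ h : ℝ) (e y w : E) : ℝ :=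
  ‖y‖ ^ 2 * ‖w‖ ^ 2 - inner ℝ y w ^ 2 -
    2 * h * (‖w‖ ^ 2 * inner ℝ y e - inner ℝ y w * inner ℝ w e - μ * inner ℝ y e / ‖y‖)

/-- The gradient of `chartD` with respect to the position. -/
def gradPos (μ h : ℝ) (e y w : E) : E :=
  (2 * ‖w‖ ^ 2 - 2 * h * μ * inner ℝ y e / ‖y‖ ^ 3) • y
    + (2 * h * inner ℝ w e - 2 * inner ℝ y w) • w
    + (2 * h * (μ / ‖y‖ - ‖w‖ ^ 2)) • e

/-- The gradient of `chartD` with respect to the velocity. -/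
def gradVel (h : ℝ) (e y w : E) : E :=
  (2 * ‖y‖ ^ 2 - 4 * h * inner ℝ y e) • w + (2 * h * inner ℝ w e - 2 * inner ℝ y w) • y
    + (2 * h * inner ℝ y w) • e

/-- The position component of the vector field with Hamiltonian function `chartD`. -/
def fieldPos (h : ℝ) (e y w : E) : E :=
  gradVel h e y w + (h ^ 2 * inner ℝ (gradVel h e y w) e) • e
    - (inner ℝ (y - h • e) (gradVel h e y w) : ℝ) • (y - h • e)

/-- The velocity component of the vector field with Hamiltonian function `chartD`. -/
def fieldVel (μ h : ℝ) (e y w : E) : E :=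
  -gradPos μ h e y w - (h ^ 2 * inner ℝ (gradPos μ h e y w) e) • e
    + (inner ℝ (y - h • e) (gradPos μ h e y w) - inner ℝ (gradVel h e y w) w : ℝ) • (y - h • e)
    + (inner ℝ (y - h • e) (gradVel h e y w) : ℝ) • w

/-- The square of the mean motion. -/
def sqFreq (μ : ℝ) (y w : E) : ℝ := 2 * μ / ‖y‖ - ‖w‖ ^ 2

/-- The infinitesimal rotation that moves the orbits along the field of `chartD`. -/
def rotPart (h : ℝ) (e y w v : E) : E :=
  (-2 : ℝ) • wedge y w v + (2 * h ^ 2) • wedge (perp e y) (perp e w) v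

variable {e y w : E}

/-- Expansion in `w`, `y`, `e`. With `fieldVel_eq` it reduces the invariance statements below to
identities between the scalar products of these vectors. -/
theorem fieldPos_eq (he : ‖e‖ = 1) (h : ℝ) (y w : E) : fieldPos h e y w =
    (2 * ‖y‖ ^ 2 - 4 * h * inner ℝ y e) • w
      + (2 * h * inner ℝ w e - 2 * inner ℝ y w
          + 2 * h ^ 2 * (inner ℝ y w - inner ℝ y e * inner ℝ w e)) • y
      + (2 * h * inner ℝ y w
          + 2 * h ^ 2 * (‖y‖ ^ 2 * inner ℝ w e - inner ℝ y e * inner ℝ y w)) • e := by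
  have he' : (inner ℝ e e : ℝ) = 1 := by rw [real_inner_self_eq_norm_sq, he]; norm_num
  simp only [fieldPos, gradVel, inner_add_left, inner_add_right, inner_sub_left,
    real_inner_smul_left, real_inner_smul_right, he', real_inner_comm y e,
    real_inner_comm w e, real_inner_self_eq_norm_sq]
  match_scalars <;> ring

theorem fieldVel_eq (he : ‖e‖ = 1) (hy : y ≠ 0) (μ h : ℝ) (w : E) : fieldVel μ h e y w =
    (2 * inner ℝ y w - 2 * h * inner ℝ w e
        + 2 * h ^ 2 * (inner ℝ y e * inner ℝ w e - inner ℝ y w)) • w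
      + (-2 * ‖w‖ ^ 2 + 2 * h * μ * inner ℝ y e / ‖y‖ ^ 3
        + 2 * h ^ 2 * (‖w‖ ^ 2 - μ / ‖y‖ - inner ℝ w e ^ 2 + μ * inner ℝ y e ^ 2 / ‖y‖ ^ 3)) • y
      + (2 * h * (‖w‖ ^ 2 - μ / ‖y‖)
        + 2 * h ^ 2 * (inner ℝ w e * inner ℝ y w - ‖w‖ ^ 2 * inner ℝ y e)) • e := by
  have he' : (inner ℝ e e : ℝ) = 1 := by rw [real_inner_self_eq_norm_sq, he]; norm_num
  have := norm_ne_zero_iff.2 hy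
  simp only [fieldVel, gradVel, gradPos, inner_add_left, inner_add_right, inner_sub_left,
    real_inner_smul_left, real_inner_smul_right, he', real_inner_comm y e,
    real_inner_comm w e, real_inner_self_eq_norm_sq]
  match_scalars <;> field_simp <;> ring

theorem inner_fieldPos (he : ‖e‖ = 1) (h : ℝ) (y w : E) : inner ℝ y (fieldPos h e y w) =
    2 * h * (1 + h * inner ℝ y e) * (‖y‖ ^ 2 * inner ℝ w e - inner ℝ y e * inner ℝ y w)
      + 2 * h ^ 2 * ‖y‖ ^ 2 * (inner ℝ y w - inner ℝ y e * inner ℝ w e) := by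
  simp only [fieldPos_eq he, inner_add_right, real_inner_smul_right, real_inner_self_eq_norm_sq]
  ring

/-- The field of `chartD` preserves the mean motion. -/
theorem sqFreq_variation (he : ‖e‖ = 1) (hy : y ≠ 0) (μ h : ℝ) (w : E) :
    μ * inner ℝ y (fieldPos h e y w) / ‖y‖ ^ 3 + inner ℝ w (fieldVel μ h e y w) = 0 := by
  have := norm_ne_zero_iff.2 hy
  rw [inner_fieldPos he]
  simp only [fieldVel_eq he hy, inner_add_right, real_inner_smul_right, real_inner_self_eq_norm_sq,
    real_inner_comm y w]
  field_simp
  ring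

/-- The derivative of the squared momentum about the axis. -/
theorem angMomPerp_variation (he : ‖e‖ = 1) (hy : y ≠ 0) (μ h : ℝ) (w : E) :
    inner ℝ (perp e y) (perp e (fieldPos h e y w)) * ‖perp e w‖ ^ 2
      + ‖perp e y‖ ^ 2 * inner ℝ (perp e w) (perp e (fieldVel μ h e y w))
      - inner ℝ (perp e y) (perp e w) * (inner ℝ (perp e (fieldPos h e y w)) (perp e w)
        + inner ℝ (perp e y) (perp e (fieldVel μ h e y w))) = 0 := by
  have he' : (inner ℝ e e : ℝ) = 1 := by rw [real_inner_self_eq_norm_sq, he]; norm_num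
  have hp : perp e e = 0 := by simp [perp, he]
  have := norm_ne_zero_iff.2 hy
  rw [fieldPos_eq he, fieldVel_eq he hy]
  simp only [← real_inner_self_eq_norm_sq]
  have hl (c : ℝ) (x x' : E) : perp e (c • x + x') = c • perp e x + perp e x' := by
    simp only [perp, inner_add_left, real_inner_smul_left]; module
  have hl' (c : ℝ) (x : E) : perp e (c • x) = c • perp e x := by
    simp only [perp, real_inner_smul_left]; module
  simp only [add_assoc, hl, hl', hp, smul_zero, add_zero, inner_add_left, inner_add_right,
    real_inner_smul_left, real_inner_smul_right]
  simp only [perp, inner_sub_left, inner_sub_right,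
    real_inner_smul_left, real_inner_smul_right, he', real_inner_comm y e, real_inner_comm w e,
    real_inner_comm y w, real_inner_self_eq_norm_sq]
  field_simp
  ring

/-- The local time shift between the field of `chartD` and `rotPart`. -/
def timeShift (h : ℝ) (e y : E) : ℝ :=
  2 * h * inner ℝ y e + 2 * h ^ 2 * (inner ℝ y e ^ 2 - ‖y‖ ^ 2)

/-- This and the next two lemmas split the variations of `y`, of `η = (‖y‖ / ω) w` and of the center
into the same three effects: the rotation `rotPart`, displacements along `e` and along `wedge y w
e`, and a shift of the anomaly proportional to `timeShift`. -/
theorem fieldPos_eq_rotPart (he : ‖e‖ = 1) (h : ℝ) (w : E) :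
    fieldPos h e y w = rotPart h e y w y + (2 * h * inner ℝ y w) • e + (2 * h) • wedge y w e
      - timeShift h e y • w := by
  have he' : (inner ℝ e e : ℝ) = 1 := by rw [real_inner_self_eq_norm_sq, he]; norm_num
  simp only [fieldPos_eq he, rotPart, timeShift, wedge, perp, inner_sub_left, real_inner_smul_left,
    real_inner_comm y e, real_inner_comm y w, real_inner_self_eq_norm_sq]
  match_scalars <;> ring

/-- The left side is the variation of `(‖y‖ / ω) w` with `ω` held fixed, as `sqFreq_variation`
permits. -/
theorem anomVel_variation (he : ‖e‖ = 1) (hy : y ≠ 0) (h : ℝ) (w : E) {ω : ℝ} (hω : ω ≠ 0)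
    {μ : ℝ} (hμ : ω ^ 2 = 2 * μ / ‖y‖ - ‖w‖ ^ 2) :
    (inner ℝ y (fieldPos h e y w) / (‖y‖ * ω)) • w + (‖y‖ / ω) • fieldVel μ h e y w =
      rotPart h e y w ((‖y‖ / ω) • w) + (2 * h * ω * (μ / ω ^ 2 - ‖y‖)) • e
        - (ω * timeShift h e y / ‖y‖) • (conicCtr y ((‖y‖ / ω) • w) - y) := by
  have he' : (inner ℝ e e : ℝ) = 1 := by rw [real_inner_self_eq_norm_sq, he]; norm_num
  have hr := norm_ne_zero_iff.2 hy
  have hμ' : μ = ‖y‖ * (ω ^ 2 + ‖w‖ ^ 2) / 2 := by rw [hμ]; field_simp; ring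
  rw [inner_fieldPos he, fieldVel_eq he hy]
  simp only [rotPart, timeShift, wedge, perp, inner_sub_left, real_inner_smul_left,
    real_inner_smul_right, conicCtr, conicAxis, norm_smul, Real.norm_eq_abs, mul_pow, sq_abs,
    real_inner_comm w e, real_inner_self_eq_norm_sq, hμ']
  match_scalars <;> field_simp <;> ring

/-- The left side is the variation, with `ω` held fixed, of the formula for the center in
`conicCtr_anomVel`. No `timeShift` term appears, because the center does not depend on the starting
point chosen on the orbit. -/
theorem ctr_variation (he : ‖e‖ = 1) (hy : y ≠ 0) (h : ℝ) (w : E) {ω : ℝ} (hω : ω ≠ 0)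
    {μ : ℝ} (hμ : ω ^ 2 = 2 * μ / ‖y‖ - ‖w‖ ^ 2) :
    -(ω ^ 2)⁻¹ • ((2 * inner ℝ w (fieldVel μ h e y w)
          + μ * inner ℝ y (fieldPos h e y w) / ‖y‖ ^ 3) • y
        + (‖w‖ ^ 2 - μ / ‖y‖) • fieldPos h e y w
        - (inner ℝ w (fieldPos h e y w) + inner ℝ y (fieldVel μ h e y w) : ℝ) • w
        - (inner ℝ y w : ℝ) • fieldVel μ h e y w) =
      rotPart h e y w (conicCtr y ((‖y‖ / ω) • w)) + (2 * h) • wedge y w e := by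
  have he' : (inner ℝ e e : ℝ) = 1 := by rw [real_inner_self_eq_norm_sq, he]; norm_num
  have hr := norm_ne_zero_iff.2 hy
  have hμ' : μ = ‖y‖ * (ω ^ 2 + ‖w‖ ^ 2) / 2 := by rw [hμ]; field_simp; ring
  rw [inner_fieldPos he, fieldVel_eq he hy, fieldPos_eq he]
  simp only [rotPart, wedge, perp, inner_sub_left, inner_add_right, real_inner_smul_left,
    real_inner_smul_right, conicCtr, conicAxis, norm_smul, Real.norm_eq_abs, mul_pow, sq_abs,
    real_inner_comm y e, real_inner_comm w e, real_inner_comm y w, real_inner_self_eq_norm_sq, hμ']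
  match_scalars <;> field_simp <;> ring

end Field

/-! ### Displacement of a whole ellipse along the field of `D`. -/

section Variation
variable {E : Type*} [NormedAddCommGroup E] [InnerProductSpace ℝ E]

/-- The derivative of the Kepler orbit with respect to the eccentric anomaly, initially. -/
def anomVel (μ : ℝ) (z : E × E) : E := (‖z.1‖ / √(sqFreq μ z.1 z.2)) • z.2

/-- The position on the Kepler orbit with initial data `z`, at eccentric anomaly `u`. -/
def orbit (μ : ℝ) (z : E × E) (u : ℝ) : E := conic z.1 (anomVel μ z) u

/-- The derivative of `orbit` with respect to the eccentric anomaly. -/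
def orbitVel (μ : ℝ) (z : E × E) (u : ℝ) : E := conicVel z.1 (anomVel μ z) u

/-- The operator that takes the velocity on an orbit to the displacement of the orbit by the
field of `chartD`, up to a constant shift of the anomaly. -/
def orbitShift (h : ℝ) (e y v : E) : E :=
  (2 * ‖y‖) • v - (2 * inner ℝ y v / ‖y‖) • y
    + (2 * h / ‖y‖) • ((inner ℝ v e : ℝ) • y + (inner ℝ y v : ℝ) • e - (inner ℝ y e : ℝ) • v)
    + (2 * h ^ 2 / ‖y‖) • ((inner ℝ y v - inner ℝ y e * inner ℝ v e) • y
      + (‖y‖ ^ 2 * inner ℝ v e - inner ℝ y e * inner ℝ y v) • e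
      + (inner ℝ y e ^ 2 - ‖y‖ ^ 2) • v)

variable {e y w : E}

theorem conicAxis_anomVel {μ : ℝ} {z : E × E} (hy : z.1 ≠ 0) (hs : 0 < sqFreq μ z.1 z.2) :
    conicAxis z.1 (anomVel μ z) = μ / sqFreq μ z.1 z.2 := by
  have := norm_ne_zero_iff.2 hy
  rw [conicAxis, anomVel, norm_smul, Real.norm_eq_abs, mul_pow, sq_abs, div_pow, Real.sq_sqrt hs.le]
  have : ‖z.2‖ ^ 2 = 2 * μ / ‖z.1‖ - sqFreq μ z.1 z.2 := by rw [sqFreq]; ring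
  rw [this]
  field_simp
  ring

/-- The center is `-1 / ω²` times the Laplace vector. This form contains no square root and exhibits
the center as a constant of motion. -/
theorem conicCtr_anomVel {μ : ℝ} {z : E × E} (hy : z.1 ≠ 0) (hs : 0 < sqFreq μ z.1 z.2) :
    conicCtr z.1 (anomVel μ z) = -(sqFreq μ z.1 z.2)⁻¹ •
      ((‖z.2‖ ^ 2 - μ / ‖z.1‖) • z.1 - (inner ℝ z.1 z.2 : ℝ) • z.2) := by
  have hr := norm_ne_zero_iff.2 hy
  have hq := (Real.sqrt_pos.2 hs).ne'
  rw [conicCtr, conicAxis_anomVel hy hs, anomVel, real_inner_smul_right]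
  match_scalars
  · have : ‖z.2‖ ^ 2 = 2 * μ / ‖z.1‖ - sqFreq μ z.1 z.2 := by rw [sqFreq]; ring
    rw [this]
    field_simp
    ring
  · field_simp
    rw [Real.sq_sqrt hs.le, mul_comm]

theorem rotPart_linear (h : ℝ) (e y w v v' v'' : E) (α β γ : ℝ) :
    rotPart h e y w (α • v + β • v' + γ • v'') =
      α • rotPart h e y w v + β • rotPart h e y w v' + γ • rotPart h e y w v'' := by
  simp only [rotPart, wedge, inner_add_right, real_inner_smul_right]
  module

theorem wedge_smul_right (c : ℝ) (x y v : E) : wedge x (c • y) v = c • wedge x y v := by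
  simp only [wedge, real_inner_smul_left]
  module

theorem perp_smul (c : ℝ) (e y : E) : perp e (c • y) = c • perp e y := by
  simp only [perp, real_inner_smul_left]
  module

/-- By the area law the rotation defined by the initial data can be written with the data at any
other anomaly `u`. This makes the displacement at `u` depend only on `Y(u)` and `Y'(u)`. -/
theorem rotPart_conic (hy : y ≠ 0) {ω : ℝ} (hω : ω ≠ 0) (h : ℝ) (w v : E)
    (hc : ∀ u, conic y ((‖y‖ / ω) • w) u ≠ 0) (u : ℝ) :
    rotPart h e y w v + (2 * h) • wedge y w e =
      (ω / ‖conic y ((‖y‖ / ω) • w) u‖) •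
        (rotPart h e (conic y ((‖y‖ / ω) • w) u) (conicVel y ((‖y‖ / ω) • w) u) v
          + (2 * h) • wedge (conic y ((‖y‖ / ω) • w) u) (conicVel y ((‖y‖ / ω) • w) u) e) := by
  have hr := norm_ne_zero_iff.2 hy
  have hR := (conicRad_pos hy hc u).ne'
  rw [norm_conic hy hc, rotPart, rotPart, wedge_conic hy, wedge_conic hy, wedge_perp_conic hy,
    wedge_smul_right, wedge_smul_right, perp_smul, wedge_smul_right]
  match_scalars <;> field_simp

/-- The three variations are combined with the coefficients `cos u`, `sin u`, `1 - cos u` of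
`conic`. The rotations add up to the rotation of `Y(u)`, the terms along `e` to `2 h ω R'(u) e`, and
the anomaly shifts to a constant multiple of `Y'(u)`. Since `R' = ⟨Y, Y'⟩ / ‖Y‖`, everything but the
shift is an operator at `Y(u)` applied to `Y'(u)`. -/
theorem conic_variation (he : ‖e‖ = 1) (hy : y ≠ 0) (h : ℝ) (w : E) {ω : ℝ} (hω : ω ≠ 0)
    {μ : ℝ} (hμ : ω ^ 2 = 2 * μ / ‖y‖ - ‖w‖ ^ 2)
    (hc : ∀ u, conic y ((‖y‖ / ω) • w) u ≠ 0) (u : ℝ) :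
    Real.cos u • fieldPos h e y w
      + Real.sin u • ((inner ℝ y (fieldPos h e y w) / (‖y‖ * ω)) • w
        + (‖y‖ / ω) • fieldVel μ h e y w)
      + (1 - Real.cos u) • -(ω ^ 2)⁻¹ • ((2 * inner ℝ w (fieldVel μ h e y w)
          + μ * inner ℝ y (fieldPos h e y w) / ‖y‖ ^ 3) • y
        + (‖w‖ ^ 2 - μ / ‖y‖) • fieldPos h e y w
        - (inner ℝ w (fieldPos h e y w) + inner ℝ y (fieldVel μ h e y w) : ℝ) • w
        - (inner ℝ y w : ℝ) • fieldVel μ h e y w) =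
      ω • orbitShift h e (conic y ((‖y‖ / ω) • w) u) (conicVel y ((‖y‖ / ω) • w) u)
        - (ω * timeShift h e y / ‖y‖) • conicVel y ((‖y‖ / ω) • w) u := by
  have hr := norm_ne_zero_iff.2 hy
  have hR := (conicRad_pos hy hc u).ne'
  rw [ctr_variation he hy h w hω hμ, anomVel_variation he hy h w hω hμ, fieldPos_eq_rotPart he]
  have hax : μ / ω ^ 2 = conicAxis y ((‖y‖ / ω) • w) := by
    have : ‖w‖ ^ 2 = 2 * μ / ‖y‖ - ω ^ 2 := by rw [hμ]; ring
    rw [conicAxis, norm_smul, Real.norm_eq_abs, mul_pow, sq_abs, this]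
    field_simp
    ring
  have hyw : inner ℝ y w = ω * (inner ℝ y ((‖y‖ / ω) • w) / ‖y‖) := by
    rw [real_inner_smul_right]; field_simp
  have hw : timeShift h e y • w = (ω * timeShift h e y / ‖y‖) • ((‖y‖ / ω) • w) := by
    rw [smul_smul]; congr 1; field_simp
  rw [hax, hyw, hw]
  have key := rotPart_linear h e y w y ((‖y‖ / ω) • w) (conicCtr y ((‖y‖ / ω) • w))
    (Real.cos u) (Real.sin u) (1 - Real.cos u)
  have h3 := rotPart_conic (e := e) hy hω h w (conic y ((‖y‖ / ω) • w) u) hc u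
  have hv : inner ℝ (conic y ((‖y‖ / ω) • w) u) (conicVel y ((‖y‖ / ω) • w) u) =
    conicRad y ((‖y‖ / ω) • w) u * conicRadVel y ((‖y‖ / ω) • w) u := inner_conic_conicVel hy _ u
  have h4 : ω • orbitShift h e (conic y ((‖y‖ / ω) • w) u) (conicVel y ((‖y‖ / ω) • w) u) =
      (rotPart h e y w (conic y ((‖y‖ / ω) • w) u) + (2 * h) • wedge y w e)
        + (2 * h * ω * conicRadVel y ((‖y‖ / ω) • w) u) • e := by
    have h5 : conicRadVel y ((‖y‖ / ω) • w) u =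
        inner ℝ (conic y ((‖y‖ / ω) • w) u) (conicVel y ((‖y‖ / ω) • w) u)
          / ‖conic y ((‖y‖ / ω) • w) u‖ := by
      rw [hv, norm_conic hy hc]; field_simp
    have hR' : ‖conic y ((‖y‖ / ω) • w) u‖ ≠ 0 := norm_ne_zero_iff.2 (hc u)
    rw [h3, h5]
    generalize conic y ((‖y‖ / ω) • w) u = Y at *
    generalize conicVel y ((‖y‖ / ω) • w) u = V at *
    have he' : (inner ℝ e e : ℝ) = 1 := by rw [real_inner_self_eq_norm_sq, he]; norm_num
    simp only [orbitShift, rotPart, wedge, perp, inner_sub_left, real_inner_smul_left,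
      real_inner_comm Y e, real_inner_comm Y V, real_inner_self_eq_norm_sq]
    match_scalars <;> field_simp <;> ring
  rw [h4]
  conv_rhs => rw [show conic y ((‖y‖ / ω) • w) u = Real.cos u • y + Real.sin u • ((‖y‖ / ω) • w) +
    (1 - Real.cos u) • conicCtr y ((‖y‖ / ω) • w) from rfl, key]
  rw [conicRadVel, conicVel]
  module

end Variation

/-- Differentiation under the integral sign, for functions that are continuously differentiable
near the domain of integration. -/
theorem hasFDerivAt_intervalIntegral_of_contDiffAt {G : Type*} [NormedAddCommGroup G]
    [NormedSpace ℝ G] {f : G × ℝ → ℝ} {z₀ : G} {a b : ℝ} (hab : a ≤ b)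
    (hf : ∀ u ∈ Set.Icc a b, ContDiffAt ℝ 1 f (z₀, u)) :
    IntervalIntegrable (fun u => (fderiv ℝ f (z₀, u)).comp (.inl ℝ G ℝ)) MeasureTheory.volume a b ∧
    HasFDerivAt (fun z => ∫ u in a..b, f (z, u))
      (∫ u in a..b, (fderiv ℝ f (z₀, u)).comp (.inl ℝ G ℝ)) z₀ := by
  have hfd : ∀ u ∈ Set.Icc a b, ContinuousAt (fderiv ℝ f) (z₀, u) := fun u hu =>
    ((hf u hu).fderiv_right (m := 0) (by norm_num)).continuousAt
  have hpair : ∀ u : ℝ, ContinuousAt (fun u : ℝ => (z₀, u)) u := fun u => by fun_prop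
  have hcont : ContinuousOn (fun u => (fderiv ℝ f (z₀, u)).comp (.inl ℝ G ℝ)) (Set.Icc a b) :=
    fun u hu => (((hfd u hu).comp (f := fun u : ℝ => (z₀, u)) (hpair u)).clm_comp
      continuousAt_const).continuousWithinAt
  have hnorm : ContinuousOn (fun u => ‖fderiv ℝ f (z₀, u)‖) (Set.Icc a b) :=
    fun u hu => ((hfd u hu).comp (f := fun u : ℝ => (z₀, u)) (hpair u)).norm.continuousWithinAt
  obtain ⟨M, hM⟩ := (isCompact_Icc.image_of_continuousOn hnorm).bddAbove
  have hM' : ∀ u ∈ Set.Icc a b, ‖fderiv ℝ f (z₀, u)‖ ≤ M := fun u hu =>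
    hM (Set.mem_image_of_mem _ hu)
  -- Compactness of `[a, b]` yields one neighbourhood of `z₀` that serves all `u`, with the constant
  -- `M + 1` as dominating function.
  have hev : ∀ᶠ z in nhds z₀, ∀ u ∈ Set.Icc a b,
      ContDiffAt ℝ 1 f (z, u) ∧ ‖fderiv ℝ f (z, u)‖ ≤ M + 1 := by
    refine isCompact_Icc.eventually_forall_of_forall_eventually fun u hu => ?_
    refine ((hf u hu).eventually (by norm_num)).and ?_
    filter_upwards [(hfd u hu).norm.eventually_lt_const
      (show ‖fderiv ℝ f (z₀, u)‖ < M + 1 by linarith [hM' u hu])] with p hp using hp.le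
  have hint : IntervalIntegrable (fun u => (fderiv ℝ f (z₀, u)).comp (.inl ℝ G ℝ))
      MeasureTheory.volume a b := by
    apply ContinuousOn.intervalIntegrable
    rwa [Set.uIcc_of_le hab]
  refine ⟨hint, ?_⟩
  have hc : ∀ z, (∀ u ∈ Set.Icc a b, ContDiffAt ℝ 1 f (z, u)) →
      IntervalIntegrable (fun u => f (z, u)) MeasureTheory.volume a b := fun z hz => by
    apply ContinuousOn.intervalIntegrable
    rw [Set.uIcc_of_le hab]
    exact fun u hu => ((hz u hu).continuousAt.comp (f := fun u : ℝ => (z, u))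
      (by fun_prop)).continuousWithinAt
  have hsub : ∀ u ∈ Set.uIoc a b, u ∈ Set.Icc a b := fun u hu => by
    rw [Set.uIoc_of_le hab] at hu
    exact Set.Ioc_subset_Icc_self hu
  refine (intervalIntegral.hasFDerivAt_integral_of_dominated_of_fderiv_le
    (s := {z | ∀ u ∈ Set.Icc a b, ContDiffAt ℝ 1 f (z, u) ∧ ‖fderiv ℝ f (z, u)‖ ≤ M + 1})
    (F := fun z u => f (z, u)) (F' := fun z u => (fderiv ℝ f (z, u)).comp (.inl ℝ G ℝ))
    (bound := fun _ => M + 1) hev ?_ (hc z₀ hf) ?_ ?_ intervalIntegrable_const ?_)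
  · filter_upwards [hev] with z hz
    exact (hc z fun u hu => (hz u hu).1).def'.aestronglyMeasurable
  · exact hint.def'.aestronglyMeasurable
  · refine Filter.Eventually.of_forall fun u hu z hz => ?_
    refine (ContinuousLinearMap.opNorm_comp_le _ _).trans ?_
    have h1 := ContinuousLinearMap.norm_inl_le_one ℝ G ℝ
    have h2 := (hz u (hsub u hu)).2
    nlinarith [norm_nonneg (fderiv ℝ f (z, u))]
  · refine Filter.Eventually.of_forall fun u hu z hz => ?_
    have h1 := ((hz u (hsub u hu)).1.differentiableAt (by norm_num)).hasFDerivAt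
    exact h1.comp z (hasFDerivAt_prodMk_left z u)

/-! ### Smooth dependence of the ellipse on its initial data. -/

section Variation
variable {E : Type*} [NormedAddCommGroup E] [InnerProductSpace ℝ E]

theorem hasDerivAt_norm_comp {y : ℝ → E} {y' : E} {ε : ℝ} (hy : HasDerivAt y y' ε)
    (h0 : y ε ≠ 0) : HasDerivAt (fun ε => ‖y ε‖) (inner ℝ (y ε) y' / ‖y ε‖) ε := by
  have h := (hy.norm_sq).sqrt (by positivity)
  simp only [Real.sqrt_sq (norm_nonneg _)] at h
  refine h.congr_deriv ?_
  field_simp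

theorem hasDerivAt_sqFreq (μ : ℝ) {y w : ℝ → E} {y' w' : E} {ε : ℝ} (hy : HasDerivAt y y' ε)
    (hw : HasDerivAt w w' ε) (h0 : y ε ≠ 0) :
    HasDerivAt (fun ε => sqFreq μ (y ε) (w ε))
      (-2 * (μ * inner ℝ (y ε) y' / ‖y ε‖ ^ 3 + inner ℝ (w ε) w')) ε := by
  have hr := norm_ne_zero_iff.2 h0
  have h := ((hasDerivAt_const ε (2 * μ)).div (hasDerivAt_norm_comp hy h0) hr).sub hw.norm_sq
  refine h.congr_deriv ?_
  field_simp
  ring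

theorem contDiffAt_sqFreq (μ : ℝ) {z : E × E} (hy : z.1 ≠ 0) :
    ContDiffAt ℝ 1 (fun z : E × E => sqFreq μ z.1 z.2) z := by
  have h1 : ContDiffAt ℝ 1 (fun z : E × E => ‖z.1‖) z := contDiffAt_fst.norm ℝ hy
  have h2 : ContDiffAt ℝ 1 (fun z : E × E => ‖z.2‖ ^ 2) z := contDiffAt_snd.norm_sq ℝ
  exact (contDiffAt_const.div h1 (norm_ne_zero_iff.2 hy)).sub h2

theorem contDiffAt_anomVel (μ : ℝ) {z : E × E} (hy : z.1 ≠ 0) (hs : 0 < sqFreq μ z.1 z.2) :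
    ContDiffAt ℝ 1 (fun z : E × E => anomVel μ z) z := by
  have h1 : ContDiffAt ℝ 1 (fun z : E × E => ‖z.1‖) z := contDiffAt_fst.norm ℝ hy
  exact (h1.div ((contDiffAt_sqFreq μ hy).sqrt hs.ne') (Real.sqrt_pos.2 hs).ne').smul contDiffAt_snd

theorem contDiffAt_conicCtr {z : E × E} (hy : z.1 ≠ 0) :
    ContDiffAt ℝ 1 (fun z : E × E => conicCtr z.1 z.2) z := by
  have hr := norm_ne_zero_iff.2 hy
  have h1 : ContDiffAt ℝ 1 (fun z : E × E => ‖z.1‖) z := contDiffAt_fst.norm ℝ hy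
  have h2 : ContDiffAt ℝ 1 (fun z : E × E => ‖z.2‖ ^ 2) z := contDiffAt_snd.norm_sq ℝ
  have h3 : ContDiffAt ℝ 1 (fun z : E × E => inner ℝ z.1 z.2) z := contDiffAt_fst.inner ℝ contDiffAt_snd
  have h4 : ContDiffAt ℝ 1 (fun z : E × E => conicAxis z.1 z.2) z :=
    ((h1.pow 2).add h2).div (contDiffAt_const.mul h1) (by simpa using hy)
  exact ((contDiffAt_const.sub (h4.div h1 hr)).smul contDiffAt_fst).add
    ((h3.div (h1.pow 2) (pow_ne_zero 2 hr)).smul contDiffAt_snd)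

theorem contDiffAt_orbit (μ : ℝ) {z : E × E} (hy : z.1 ≠ 0) (hs : 0 < sqFreq μ z.1 z.2) (u : ℝ) :
    ContDiffAt ℝ 1 (fun p : (E × E) × ℝ => orbit μ p.1 p.2) (z, u) := by
  have hη : ContDiffAt ℝ 1 (fun p : (E × E) × ℝ => anomVel μ p.1) (z, u) :=
    (contDiffAt_anomVel μ hy hs).comp (f := Prod.fst) (z, u) contDiffAt_fst
  have hy' : ContDiffAt ℝ 1 (fun p : (E × E) × ℝ => p.1.1) (z, u) := by fun_prop
  have hk : ContDiffAt ℝ 1 (fun p : (E × E) × ℝ => conicCtr p.1.1 (anomVel μ p.1)) (z, u) :=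
    (contDiffAt_conicCtr (z := (z.1, anomVel μ z)) hy).comp
      (f := fun p : (E × E) × ℝ => (p.1.1, anomVel μ p.1)) (z, u) (hy'.prodMk hη)
  have hc : ContDiffAt ℝ 1 (fun p : (E × E) × ℝ => Real.cos p.2) (z, u) :=
    (Real.contDiff_cos.comp contDiff_snd).contDiffAt
  have hs : ContDiffAt ℝ 1 (fun p : (E × E) × ℝ => Real.sin p.2) (z, u) :=
    (Real.contDiff_sin.comp contDiff_snd).contDiffAt
  exact ((hc.smul hy').add (hs.smul hη)).add ((contDiffAt_const.sub hc).smul hk)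

/-- The displacement of the orbit when its initial data move along the field of `chartD`. -/
theorem hasDerivAt_orbit {e : E} (he : ‖e‖ = 1) (μ h : ℝ) {z : E × E}
    (hs : 0 < sqFreq μ z.1 z.2) (hc : ∀ u, orbit μ z u ≠ 0) (u : ℝ) :
    HasDerivAt (fun ε : ℝ => orbit μ (z + ε • (fieldPos h e z.1 z.2, fieldVel μ h e z.1 z.2)) u)
      (√(sqFreq μ z.1 z.2) • orbitShift h e (orbit μ z u) (orbitVel μ z u)
        - (√(sqFreq μ z.1 z.2) * timeShift h e z.1 / ‖z.1‖) • orbitVel μ z u) 0 := by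
  have hy : z.1 ≠ 0 := by simpa [orbit, conic_zero] using hc 0
  have hr := norm_ne_zero_iff.2 hy
  have hq := (Real.sqrt_pos.2 hs).ne'
  set ω := √(sqFreq μ z.1 z.2) with hω
  have hω2 : ω ^ 2 = sqFreq μ z.1 z.2 := Real.sq_sqrt hs.le
  set δy := fieldPos h e z.1 z.2 with hδy
  set δw := fieldVel μ h e z.1 z.2 with hδw
  set y : ℝ → E := fun ε => z.1 + ε • δy with hyd
  set w : ℝ → E := fun ε => z.2 + ε • δw with hwd
  have y0 : y 0 = z.1 := by simp [y]
  have w0 : w 0 = z.2 := by simp [w]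
  have dy : HasDerivAt y δy 0 := by
    simpa [y] using ((hasDerivAt_id (0 : ℝ)).smul_const δy).const_add z.1
  have dw : HasDerivAt w δw 0 := by
    simpa [w] using ((hasDerivAt_id (0 : ℝ)).smul_const δw).const_add z.2
  have df := hasDerivAt_sqFreq μ dy dw (by rwa [y0])
  -- The mean motion is stationary along the field, so the derivatives of its root and of its
  -- inverse drop out.
  rw [y0, w0, sqFreq_variation he hy, mul_zero] at df
  have dq := df.sqrt (by simpa [y0, w0] using hs.ne')
  simp only [zero_div] at dq
  have dr := hasDerivAt_norm_comp dy (by rwa [y0])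
  have dη := (dr.fun_div dq (by simpa [y0, w0] using hq)).fun_smul dw
  have dk := (df.fun_inv (by simpa [y0, w0] using hs.ne')).fun_neg.fun_smul
    ((((dw.norm_sq).fun_sub ((hasDerivAt_const 0 μ).fun_div dr (by rwa [y0]))).fun_smul dy).fun_sub
      ((dy.inner ℝ dw).fun_smul dw))
  -- The Laplace-vector formula for the center needs a nonzero position and a positive `sqFreq`,
  -- which persist for small `ε`.
  have hev : ∀ᶠ ε in nhds (0 : ℝ), y ε ≠ 0 ∧ 0 < sqFreq μ (y ε) (w ε) := by
    refine (dy.continuousAt.eventually_ne (by rwa [y0])).and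
      (df.continuousAt.eventually_const_lt (by simpa [y0, w0] using hs))
  have dk' : HasDerivAt (fun ε => conicCtr (y ε) (anomVel μ (y ε, w ε))) _ 0 :=
    dk.congr_of_eventuallyEq (hev.mono fun ε hε =>
      conicCtr_anomVel (z := (y ε, w ε)) hε.1 hε.2)
  have dd := ((dy.const_smul (Real.cos u)).fun_add (dη.const_smul (Real.sin u))).fun_add
    (dk'.const_smul (1 - Real.cos u))
  refine (dd.congr_deriv ?_)
  have hvar := conic_variation he hy h z.2 hq (μ := μ) hω2 (by simpa [orbit, anomVel] using hc) u
  change _ = ω • orbitShift h e (conic z.1 ((‖z.1‖ / ω) • z.2) u)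
    (conicVel z.1 ((‖z.1‖ / ω) • z.2) u) - (ω * timeShift h e z.1 / ‖z.1‖) •
      conicVel z.1 ((‖z.1‖ / ω) • z.2) u
  rw [← hvar]
  have hsq : √(ω ^ 2) = ω := Real.sqrt_sq (Real.sqrt_nonneg _)
  simp only [y0, w0, ← hω2, hsq, ← hδy, ← hδw, real_inner_comm z.2 δy]
  match_scalars <;> field_simp <;> ring

end Variation

/-! ### Integrands whose orbit integrals are invariant. -/

section Pairs
variable {E : Type*} [NormedAddCommGroup E] [InnerProductSpace ℝ E]

/-- `S` is, up to the shift of the anomaly, a primitive along the orbits of the derivative of `Ψ`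
along the field of `chartD`. -/
structure IsShiftPair (h : ℝ) (e : E) (Ψ S : E → ℝ) (y : E) : Prop where
  contDiffAt_left : ContDiffAt ℝ 1 Ψ y
  contDiffAt_right : ContDiffAt ℝ 1 S y
  fderiv_eq : ∀ v, fderiv ℝ Ψ y (orbitShift h e y v) = fderiv ℝ S y v

/-- The integral of `Ψ` over the Kepler orbit through `z`, parametrized by the eccentric
anomaly. -/
def orbitIntegral (μ : ℝ) (Ψ : E → ℝ) (z : E × E) : ℝ :=
  ∫ u in (0 : ℝ)..2 * Real.pi, Ψ (orbit μ z u)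

/-- Once differentiability is known, all Fréchet derivatives are computed along lines by
one-variable calculus. -/
theorem fderiv_eq_of_hasDerivAt_line {F : Type*} [NormedAddCommGroup F] [NormedSpace ℝ F]
    {f : F → ℝ} {x v : F} {d : ℝ} (hf : DifferentiableAt ℝ f x)
    (h : HasDerivAt (fun ε : ℝ => f (x + ε • v)) d 0) : fderiv ℝ f x v = d := by
  rw [← hf.lineDeriv_eq_fderiv]
  exact h.deriv

theorem hasFDerivAt_comp_prodMk_left {G : Type*} [NormedAddCommGroup G] [NormedSpace ℝ G]
    {f : G × ℝ → ℝ} {z : G} {u : ℝ} (hf : DifferentiableAt ℝ f (z, u)) :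
    HasFDerivAt (fun x => f (x, u)) ((fderiv ℝ f (z, u)).comp (.inl ℝ G ℝ)) z :=
  hf.hasFDerivAt.comp z (hasFDerivAt_prodMk_left z u)

theorem hasDerivAt_line {F : Type*} [NormedAddCommGroup F] [NormedSpace ℝ F] (y v : F) :
    HasDerivAt (fun ε : ℝ => y + ε • v) v 0 := by
  simpa using ((hasDerivAt_id (0 : ℝ)).smul_const v).const_add y

theorem hasDerivAt_comp_line {F : Type*} [NormedAddCommGroup F] [NormedSpace ℝ F]
    {f : F → ℝ} {x : F} (hf : DifferentiableAt ℝ f x) (v : F) :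
    HasDerivAt (fun ε : ℝ => f (x + ε • v)) (fderiv ℝ f x v) 0 := by
  have h : HasFDerivAt f (fderiv ℝ f x) (x + (0 : ℝ) • v) := by simpa using hf.hasFDerivAt
  exact h.comp_hasDerivAt (0 : ℝ) (hasDerivAt_line x v)

theorem fderiv_div_apply {F : Type*} [NormedAddCommGroup F] [NormedSpace ℝ F] {f g : F → ℝ}
    {x : F} (hf : DifferentiableAt ℝ f x) (hg : DifferentiableAt ℝ g x) (h0 : g x ≠ 0) (v : F) :
    fderiv ℝ (fun x => f x / g x) x v =
      (fderiv ℝ f x v * g x - f x * fderiv ℝ g x v) / g x ^ 2 := by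
  refine fderiv_eq_of_hasDerivAt_line (by simpa only [div_eq_mul_inv] using hf.fun_mul (hg.fun_inv h0)) ?_
  simpa using (hasDerivAt_comp_line hf v).fun_div
    (hasDerivAt_comp_line hg v) (by simpa using h0)

theorem fderiv_mul_apply {F : Type*} [NormedAddCommGroup F] [NormedSpace ℝ F] {f g : F → ℝ}
    {x : F} (hf : DifferentiableAt ℝ f x) (hg : DifferentiableAt ℝ g x) (v : F) :
    fderiv ℝ (fun x => f x * g x) x v = fderiv ℝ f x v * g x + f x * fderiv ℝ g x v := by
  refine fderiv_eq_of_hasDerivAt_line (hf.fun_mul hg) ?_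
  simpa using (hasDerivAt_comp_line hf v).fun_mul
    (hasDerivAt_comp_line hg v)

/-- Differentiation under the integral sign leaves the integral of a total `u`-derivative of a
`2π`-periodic function. -/
theorem orbitIntegral_variation {e : E} (he : ‖e‖ = 1) (μ h : ℝ) {z : E × E} {Ψ S : E → ℝ}
    (hs : 0 < sqFreq μ z.1 z.2) (hc : ∀ u, orbit μ z u ≠ 0)
    (hΨ : ∀ u, IsShiftPair h e Ψ S (orbit μ z u)) :
    DifferentiableAt ℝ (orbitIntegral μ Ψ) z ∧
      fderiv ℝ (orbitIntegral μ Ψ) z (fieldPos h e z.1 z.2, fieldVel μ h e z.1 z.2) = 0 := by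
  have hy : z.1 ≠ 0 := by simpa [orbit, conic_zero] using hc 0
  have hcd : ∀ u, ContDiffAt ℝ 1 (fun p : (E × E) × ℝ => Ψ (orbit μ p.1 p.2)) (z, u) := fun u =>
    (hΨ u).contDiffAt_left.comp (f := fun p : (E × E) × ℝ => orbit μ p.1 p.2) (z, u)
      (contDiffAt_orbit μ hy hs u)
  obtain ⟨hint, hder⟩ := hasFDerivAt_intervalIntegral_of_contDiffAt
    (f := fun p : (E × E) × ℝ => Ψ (orbit μ p.1 p.2)) Real.two_pi_pos.le fun u _ => hcd u
  refine ⟨hder.differentiableAt, ?_⟩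
  rw [show orbitIntegral μ Ψ = fun z => ∫ u in (0 : ℝ)..2 * Real.pi, Ψ (orbit μ z u) from rfl,
    hder.fderiv, ContinuousLinearMap.intervalIntegral_apply hint]
  set δ := (fieldPos h e z.1 z.2, fieldVel μ h e z.1 z.2) with hδ
  set ω := √(sqFreq μ z.1 z.2)
  set κ := ω * timeShift h e z.1 / ‖z.1‖
  have hΨd : ∀ u, HasFDerivAt Ψ (fderiv ℝ Ψ (orbit μ z u)) (orbit μ z u) := fun u =>
    ((hΨ u).contDiffAt_left.differentiableAt (by norm_num)).hasFDerivAt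
  have hSd : ∀ u, HasFDerivAt S (fderiv ℝ S (orbit μ z u)) (orbit μ z u) := fun u =>
    ((hΨ u).contDiffAt_right.differentiableAt (by norm_num)).hasFDerivAt
  -- The displacement of the orbit is `ω • orbitShift - κ • orbitVel`; the pair property turns its
  -- first part into the derivative of `S` along the orbit.
  have key : ∀ u, HasDerivAt (fun u => ω * S (orbit μ z u) - κ * Ψ (orbit μ z u))
      (((fderiv ℝ (fun p : (E × E) × ℝ => Ψ (orbit μ p.1 p.2)) (z, u)).comp
        (.inl ℝ (E × E) ℝ)) δ) u := by
    intro u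
    have ho : HasDerivAt (orbit μ z) (orbitVel μ z u) u := hasDerivAt_conic _ _ u
    have h1 := (((hSd u).comp_hasDerivAt u ho).const_mul ω).sub
      (((hΨd u).comp_hasDerivAt u ho).const_mul κ)
    refine h1.congr_deriv ?_
    have h2 := hasDerivAt_orbit he μ h hs hc u
    have h3 : HasFDerivAt (fun x => Ψ (orbit μ x u))
        ((fderiv ℝ (fun p : (E × E) × ℝ => Ψ (orbit μ p.1 p.2)) (z, u)).comp
        (.inl ℝ (E × E) ℝ)) z :=
      hasFDerivAt_comp_prodMk_left ((hcd u).differentiableAt (by norm_num))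
    rw [← h3.fderiv]
    symm
    apply fderiv_eq_of_hasDerivAt_line h3.differentiableAt
    have h4 : HasFDerivAt Ψ (fderiv ℝ Ψ (orbit μ z u)) (orbit μ (z + (0 : ℝ) • δ) u) := by
      simpa using hΨd u
    refine (h4.comp_hasDerivAt (0 : ℝ) h2).congr_deriv ?_
    rw [map_sub, map_smul, map_smul, (hΨ u).fderiv_eq, smul_eq_mul, smul_eq_mul]
  have hint' : IntervalIntegrable (fun u =>
      ((fderiv ℝ (fun p : (E × E) × ℝ => Ψ (orbit μ p.1 p.2)) (z, u)).comp
        (.inl ℝ (E × E) ℝ)) δ) MeasureTheory.volume 0 (2 * Real.pi) :=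
    ⟨hint.1.apply_continuousLinearMap δ, hint.2.apply_continuousLinearMap δ⟩
  rw [intervalIntegral.integral_eq_sub_of_hasDerivAt (fun u _ => key u) hint']
  have hp : orbit μ z (2 * Real.pi) = orbit μ z 0 := by
    have := conic_periodic z.1 (anomVel μ z) 0
    rwa [zero_add] at this
  rw [hp, sub_self]

/-- In the normalized chart, `1 + h ^ 2` times the conformal factor `1 - |x|²`. -/
def chartFactor (h : ℝ) (e y : E) : ℝ := (1 + h * inner ℝ y e) ^ 2 - (1 + h ^ 2) * ‖y‖ ^ 2

/-- In the normalized chart, a multiple of the hyperbolic Kepler potential of the second center. -/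
def secondPot (h : ℝ) (e y : E) : ℝ :=
  (1 + 2 * h ^ 2 - h * inner ℝ y e) / ‖y - (2 * h) • e‖

variable {e y : E}

/-- All integrands depend on `y` only through `‖y‖` and `⟨y, e⟩`, so this product and the one with
`e` are all that is needed of `orbitShift`. -/
theorem inner_orbitShift (hy : y ≠ 0) (h : ℝ) (v : E) :
    inner ℝ y (orbitShift h e y v) = 2 * h * ‖y‖ * inner ℝ v e := by
  have hr := norm_ne_zero_iff.2 hy
  simp only [orbitShift, inner_add_right, inner_sub_right, real_inner_smul_right,
    real_inner_self_eq_norm_sq]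
  field_simp
  ring

theorem inner_orbitShift_axis (hy : y ≠ 0) (h : ℝ) (he : ‖e‖ = 1) (v : E) :
    inner ℝ (orbitShift h e y v) e = (2 * ‖y‖ ^ 2 * inner ℝ v e - 2 * inner ℝ y v * inner ℝ y e
      + 2 * h * inner ℝ y v) / ‖y‖ := by
  have hr := norm_ne_zero_iff.2 hy
  simp only [orbitShift, inner_add_left, inner_sub_left, real_inner_smul_left,
    real_inner_self_eq_norm_sq, he]
  field_simp
  ring

theorem hasDerivAt_norm_line (hy : y ≠ 0) (v : E) :
    HasDerivAt (fun ε : ℝ => ‖y + ε • v‖) (inner ℝ y v / ‖y‖) 0 := by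
  simpa using hasDerivAt_norm_comp (hasDerivAt_line y v) (by simpa using hy)

theorem hasDerivAt_inner_line (y v e : E) :
    HasDerivAt (fun ε : ℝ => (inner ℝ (y + ε • v) e : ℝ)) (inner ℝ v e) 0 := by
  simpa using (hasDerivAt_line y v).inner ℝ (hasDerivAt_const (0 : ℝ) e)

theorem contDiffAt_chartFactor (h : ℝ) (e y : E) : ContDiffAt ℝ 1 (chartFactor h e) y := by
  have h1 : ContDiffAt ℝ 1 (fun y : E => inner ℝ y e) y := contDiffAt_id.inner ℝ contDiffAt_const
  have h2 : ContDiffAt ℝ 1 (fun y : E => ‖y‖ ^ 2) y := contDiffAt_id.norm_sq ℝ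
  exact ((contDiffAt_const.add (contDiffAt_const.mul h1)).pow 2).sub (contDiffAt_const.mul h2)

theorem contDiffAt_timeShift (h : ℝ) (e y : E) : ContDiffAt ℝ 1 (timeShift h e) y := by
  have h1 : ContDiffAt ℝ 1 (fun y : E => inner ℝ y e) y := contDiffAt_id.inner ℝ contDiffAt_const
  have h2 : ContDiffAt ℝ 1 (fun y : E => ‖y‖ ^ 2) y := contDiffAt_id.norm_sq ℝ
  exact (contDiffAt_const.mul h1).add (contDiffAt_const.mul ((h1.pow 2).sub h2))

theorem contDiffAt_secondPot (h : ℝ) (hy : y ≠ (2 * h) • e) :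
    ContDiffAt ℝ 1 (secondPot h e) y := by
  have h1 : ContDiffAt ℝ 1 (fun y : E => inner ℝ y e) y := contDiffAt_id.inner ℝ contDiffAt_const
  have h2 : ContDiffAt ℝ 1 (fun y : E => ‖y - (2 * h) • e‖) y :=
    (contDiffAt_id.sub contDiffAt_const).norm ℝ (sub_ne_zero.2 hy)
  exact (contDiffAt_const.sub (contDiffAt_const.mul h1)).div h2
    (norm_ne_zero_iff.2 (sub_ne_zero.2 hy))

theorem fderiv_chartFactor (h : ℝ) (e y v : E) : fderiv ℝ (chartFactor h e) y v =
    2 * h * (1 + h * inner ℝ y e) * inner ℝ v e - 2 * (1 + h ^ 2) * inner ℝ y v := by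
  refine fderiv_eq_of_hasDerivAt_line ((contDiffAt_chartFactor h e y).differentiableAt (by norm_num))
    ((((((hasDerivAt_inner_line y v e).const_mul h).const_add 1).pow 2).sub
      ((hasDerivAt_line y v).norm_sq.const_mul (1 + h ^ 2))).congr_deriv ?_)
  simp
  ring

theorem fderiv_timeShift (h : ℝ) (e y v : E) : fderiv ℝ (timeShift h e) y v =
    2 * h * inner ℝ v e + 4 * h ^ 2 * (inner ℝ y e * inner ℝ v e - inner ℝ y v) := by
  have h1 := hasDerivAt_inner_line y v e
  refine fderiv_eq_of_hasDerivAt_line ((contDiffAt_timeShift h e y).differentiableAt (by norm_num))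
    (((h1.const_mul (2 * h)).add (((h1.pow 2).sub
      (hasDerivAt_line y v).norm_sq).const_mul (2 * h ^ 2))).congr_deriv ?_)
  simp
  ring

theorem fderiv_norm_apply (hy : y ≠ 0) (v : E) :
    fderiv ℝ (fun y : E => ‖y‖) y v = inner ℝ y v / ‖y‖ :=
  fderiv_eq_of_hasDerivAt_line
    ((contDiffAt_id.norm ℝ hy : ContDiffAt ℝ 1 (fun y : E => ‖y‖) y).differentiableAt (by norm_num))
    (hasDerivAt_norm_line hy v)

theorem fderiv_secondPot (h : ℝ) (hy : y ≠ (2 * h) • e) (v : E) : fderiv ℝ (secondPot h e) y v =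
    -h * inner ℝ v e / ‖y - (2 * h) • e‖ - (1 + 2 * h ^ 2 - h * inner ℝ y e)
      * (inner ℝ y v - 2 * h * inner ℝ v e) / ‖y - (2 * h) • e‖ ^ 3 := by
  have hr : ‖y - (2 * h) • e‖ ≠ 0 := norm_ne_zero_iff.2 (sub_ne_zero.2 hy)
  have h2 : HasDerivAt (fun ε : ℝ => ‖y + ε • v - (2 * h) • e‖) _ 0 :=
    hasDerivAt_norm_comp ((hasDerivAt_line y v).sub_const ((2 * h) • e))
      (by simpa using sub_ne_zero.2 hy)
  refine fderiv_eq_of_hasDerivAt_line ((contDiffAt_secondPot h hy).differentiableAt (by norm_num))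
    (((((hasDerivAt_inner_line y v e).const_mul h).const_sub (1 + 2 * h ^ 2)).div h2
      (by simpa using hr)).congr_deriv ?_)
  simp only [zero_smul, add_zero, inner_sub_left, real_inner_smul_left, real_inner_comm v e]
  field_simp

theorem isShiftPair_norm (h : ℝ) (hy : y ≠ 0) :
    IsShiftPair h e (fun y => ‖y‖) (fun y => 2 * h * inner ℝ y e) y := by
  have h1 : ContDiffAt ℝ 1 (fun y : E => 2 * h * inner ℝ y e) y :=
    contDiffAt_const.mul (contDiffAt_id.inner ℝ contDiffAt_const)
  refine ⟨contDiffAt_id.norm ℝ hy, h1, fun v => ?_⟩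
  have hr := norm_ne_zero_iff.2 hy
  rw [fderiv_norm_apply hy, inner_orbitShift hy h, fderiv_eq_of_hasDerivAt_line
    (h1.differentiableAt (by norm_num)) ((hasDerivAt_inner_line y v e).const_mul (2 * h))]
  field_simp

/-- Up to a constant factor, `‖y‖ / chartFactor` is the weight that converts the eccentric anomaly
into hyperbolic time. Its companion has the same denominator, with `timeShift` as numerator. -/
theorem isShiftPair_weight (he : ‖e‖ = 1) (h : ℝ) (hy : y ≠ 0) (hN : chartFactor h e y ≠ 0) :
    IsShiftPair h e (fun y => ‖y‖ / chartFactor h e y)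
      (fun y => timeShift h e y / chartFactor h e y) y := by
  have c1 : ContDiffAt ℝ 1 (fun y : E => ‖y‖) y := contDiffAt_id.norm ℝ hy
  have c2 := contDiffAt_chartFactor h e y
  have c3 := contDiffAt_timeShift h e y
  refine ⟨c1.div c2 hN, c3.div c2 hN, fun v => ?_⟩
  have hr := norm_ne_zero_iff.2 hy
  have d1 := c1.differentiableAt (by norm_num : (1 : WithTop ℕ∞) ≠ 0)
  have d2 := c2.differentiableAt (by norm_num : (1 : WithTop ℕ∞) ≠ 0)
  have d3 := c3.differentiableAt (by norm_num : (1 : WithTop ℕ∞) ≠ 0)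
  rw [fderiv_div_apply d1 d2 hN, fderiv_div_apply d3 d2 hN]
  simp only [
    fderiv_norm_apply hy, fderiv_chartFactor, fderiv_timeShift, inner_orbitShift hy h,
    inner_orbitShift_axis hy h he]
  rw [timeShift, chartFactor] at *
  field_simp
  ring

theorem isShiftPair_secondPot (he : ‖e‖ = 1) (h : ℝ) (hy : y ≠ 0) (hN : chartFactor h e y ≠ 0)
    (hy2 : y ≠ (2 * h) • e) :
    IsShiftPair h e (fun y => ‖y‖ / chartFactor h e y * secondPot h e y)
      (fun y => timeShift h e y / chartFactor h e y * secondPot h e y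
        + 2 * h * (inner ℝ y e - 2 * h) / ‖y - (2 * h) • e‖) y := by
  have hp := isShiftPair_weight he h hy hN
  have c1 := contDiffAt_secondPot h hy2
  have c2 : ContDiffAt ℝ 1 (fun y : E => ‖y - (2 * h) • e‖) y :=
    (contDiffAt_id.sub contDiffAt_const).norm ℝ (sub_ne_zero.2 hy2)
  have hr2 : ‖y - (2 * h) • e‖ ≠ 0 := norm_ne_zero_iff.2 (sub_ne_zero.2 hy2)
  have c3 : ContDiffAt ℝ 1 (fun y : E => 2 * h * (inner ℝ y e - 2 * h) / ‖y - (2 * h) • e‖) y :=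
    (contDiffAt_const.mul ((contDiffAt_id.inner ℝ contDiffAt_const).sub contDiffAt_const)).div c2 hr2
  refine ⟨hp.1.mul c1, (hp.2.mul c1).add c3, fun v => ?_⟩
  have hr := norm_ne_zero_iff.2 hy
  have d0 := hp.1.differentiableAt (by norm_num)
  have d1 := hp.2.differentiableAt (by norm_num)
  have d2 := c1.differentiableAt (by norm_num : (1 : WithTop ℕ∞) ≠ 0)
  have d3 := c3.differentiableAt (by norm_num : (1 : WithTop ℕ∞) ≠ 0)
  rw [fderiv_mul_apply d0 d2, fderiv_fun_add (d1.fun_mul d2) d3, add_apply,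
    fderiv_mul_apply d1 d2]
  have h2 : HasDerivAt (fun ε : ℝ => ‖y + ε • v - (2 * h) • e‖) _ 0 :=
    hasDerivAt_norm_comp ((hasDerivAt_line y v).sub_const ((2 * h) • e))
      (by simpa using sub_ne_zero.2 hy2)
  have h4 := fderiv_eq_of_hasDerivAt_line d3
    ((((hasDerivAt_inner_line y v e).sub_const (2 * h)).const_mul (2 * h)).fun_div h2
      (by simpa using hr2))
  rw [h4, hp.3 v, fderiv_secondPot h hy2, fderiv_secondPot h hy2, inner_orbitShift hy h,
    inner_orbitShift_axis hy h he]
  simp only [zero_smul, add_zero, inner_sub_left, real_inner_smul_left, real_inner_comm v e]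
  have hq : ‖y - (2 * h) • e‖ ^ 2 = ‖y‖ ^ 2 - 4 * h * inner ℝ y e + 4 * h ^ 2 := by
    rw [norm_sub_sq_real, real_inner_smul_right, norm_smul, Real.norm_eq_abs, mul_pow, sq_abs, he]
    ring
  -- By the product rule and the pair property of the weight, the terms in which the weight is
  -- differentiated coincide on both sides and cancel. What is left holds modulo `hq`, which
  -- expresses the distance to the second center by `‖y‖` and `⟨y, e⟩`.
  rw [add_assoc]
  congr 1
  have hNe : chartFactor h e y = (1 + h * inner ℝ y e) ^ 2 - (1 + h ^ 2) * ‖y‖ ^ 2 := rfl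
  rw [timeShift]
  generalize ‖y - (2 * h) • e‖ = q at hq hr2
  field_simp
  rw [hNe]
  linear_combination (-h * (inner ℝ v e - inner ℝ y v * inner ℝ y e
    + h * (inner ℝ v e * inner ℝ y e + inner ℝ y v))) * hq

end Pairs

/-! ### The normalized central projection and the potentials in it. -/

section Chart
variable {d : ℕ}

/-- The linear map that scales the direction of the unit vector `e` by `c`. -/
def axisScale (c : ℝ) (e : Eu d) : Eu d →L[ℝ] Eu d :=
  ContinuousLinearMap.id ℝ (Eu d) + (c - 1) • (innerSL ℝ e).smulRight e

theorem axisScale_apply (c : ℝ) (e v : Eu d) :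
    axisScale c e v = v + ((c - 1) * inner ℝ v e) • e := by
  simp [axisScale, smul_smul, real_inner_comm]

theorem axisScale_self {e : Eu d} (he : ‖e‖ = 1) (c : ℝ) : axisScale c e e = c • e := by
  rw [axisScale_apply, real_inner_self_eq_norm_sq, he]
  module

theorem inner_axisScale_axis {e : Eu d} (he : ‖e‖ = 1) (c : ℝ) (v : Eu d) :
    inner ℝ (axisScale c e v) e = c * inner ℝ v e := by
  rw [axisScale_apply, inner_add_left, real_inner_smul_left, real_inner_self_eq_norm_sq, he]
  ring

theorem inner_axisScale_left (c : ℝ) (e v v' : Eu d) :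
    inner ℝ (axisScale c e v) v' = inner ℝ v (axisScale c e v') := by
  simp only [axisScale_apply, inner_add_left, inner_add_right, real_inner_smul_left,
    real_inner_smul_right, real_inner_comm v' e]
  ring

theorem inner_axisScale {e : Eu d} (he : ‖e‖ = 1) (c : ℝ) (v v' : Eu d) :
    inner ℝ (axisScale c e v) (axisScale c e v') =
      inner ℝ v v' + (c ^ 2 - 1) * (inner ℝ v e * inner ℝ v' e) := by
  simp only [axisScale_apply, inner_add_left, inner_add_right, real_inner_smul_left,
    real_inner_smul_right, real_inner_comm v' e, real_inner_self_eq_norm_sq, he]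
  ring

theorem norm_axisScale_sq {e : Eu d} (he : ‖e‖ = 1) (c : ℝ) (v : Eu d) :
    ‖axisScale c e v‖ ^ 2 = ‖v‖ ^ 2 + (c ^ 2 - 1) * inner ℝ v e ^ 2 := by
  rw [← real_inner_self_eq_norm_sq, inner_axisScale he, real_inner_self_eq_norm_sq]
  ring

theorem axisScale_axisScale {e : Eu d} (he : ‖e‖ = 1) (c c' : ℝ) (v : Eu d) :
    axisScale c e (axisScale c' e v) = axisScale (c * c') e v := by
  rw [axisScale_apply, inner_axisScale_axis he, axisScale_apply, axisScale_apply]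
  module

theorem axisScale_one (e v : Eu d) : axisScale 1 e v = v := by
  simp [axisScale_apply]

theorem affInner_eq {a : ℝ} (ha : a ^ 2 < 1) {e : Eu d} (he : ‖e‖ = 1) (x y : Eu d) :
    affInner a e x y = inner ℝ (axisScale (√(1 - a ^ 2))⁻¹ e x) (axisScale (√(1 - a ^ 2))⁻¹ e y) := by
  rw [inner_axisScale he, affInner, inv_pow, Real.sq_sqrt (by linarith)]

/-- The parameter of the normalized chart: minus half of the distance of the centers. -/
def halfDist (a : ℝ) : ℝ := -(a / √(1 - a ^ 2))

/-- The normalized position in the chart of central projection: the first center is the origin,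
the second one is `2 * halfDist a • e`, and the norm is Euclidean. -/
def nPos (a : ℝ) (e : Eu d) (q : Mink d) : Eu d :=
  axisScale (√(1 - a ^ 2))⁻¹ e (q.2⁻¹ • q.1) + halfDist a • e

/-- The normalized velocity in the chart of central projection. -/
def nVel (a : ℝ) (e : Eu d) (z : Mink d × Mink d) : Eu d :=
  axisScale (√(1 - a ^ 2))⁻¹ e (chartVel z)

/-- The point of `ℝ^{d,1}` with normalized position `y`. -/
def ofNPos (a : ℝ) (e y : Eu d) : Mink d :=
  lift (axisScale (√(1 - a ^ 2)) e (y - halfDist a • e))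

variable {a : ℝ} {e : Eu d}

theorem halfDist_sq (ha : a ^ 2 < 1) : (1 + halfDist a ^ 2) * (1 - a ^ 2) = 1 := by
  have hb : (0 : ℝ) < 1 - a ^ 2 := by linarith
  rw [halfDist, neg_sq, div_pow, Real.sq_sqrt hb.le]
  field_simp
  ring

theorem shrink_nPos (ha : a ^ 2 < 1) (he : ‖e‖ = 1) (q : Mink d) :
    axisScale (√(1 - a ^ 2)) e (nPos a e q - halfDist a • e) = q.2⁻¹ • q.1 := by
  have hb : √(1 - a ^ 2) ≠ 0 := (Real.sqrt_pos.2 (by linarith)).ne'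
  rw [nPos, add_sub_cancel_right, axisScale_axisScale he, mul_inv_cancel₀ hb, axisScale_one]

theorem shrink_nVel (ha : a ^ 2 < 1) (he : ‖e‖ = 1) (z : Mink d × Mink d) :
    axisScale (√(1 - a ^ 2)) e (nVel a e z) = chartVel z := by
  have hb : √(1 - a ^ 2) ≠ 0 := (Real.sqrt_pos.2 (by linarith)).ne'
  rw [nVel, axisScale_axisScale he, mul_inv_cancel₀ hb, axisScale_one]

/-- `|x|²` in the normalized chart. -/
theorem norm_shrink_sq (ha : a ^ 2 < 1) (he : ‖e‖ = 1) (y : Eu d) :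
    1 - ‖axisScale (√(1 - a ^ 2)) e (y - halfDist a • e)‖ ^ 2 =
      (1 - a ^ 2) * chartFactor (halfDist a) e y := by
  have hh := halfDist_sq ha
  rw [norm_axisScale_sq he, Real.sq_sqrt (by linarith), norm_sub_sq_real, real_inner_smul_right,
    norm_smul, mul_pow, Real.norm_eq_abs, sq_abs, he, inner_sub_left, real_inner_smul_left,
    real_inner_self_eq_norm_sq, he, chartFactor]
  linear_combination (‖y‖ ^ 2 - inner ℝ y e ^ 2 - 1) * hh

/-- On `ℍ^d` one has `|q_s|² = q_t² - 1`, so the conformal factor `1 - |x|²` equals `1 / q_t²`. -/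
theorem hyp_factor (ha : a ^ 2 < 1) (he : ‖e‖ = 1) {q : Mink d} (hq : q ∈ Hyp d) :
    q.2 ^ 2 * ((1 - a ^ 2) * chartFactor (halfDist a) e (nPos a e q)) = 1 := by
  obtain ⟨h1, h2⟩ := hq
  rw [mink, real_inner_self_eq_norm_sq] at h1
  rw [← norm_shrink_sq ha he, shrink_nPos ha he, norm_smul, mul_pow, norm_inv, Real.norm_eq_abs,
    inv_pow, sq_abs]
  field_simp
  linarith

theorem chartFactor_nPos_pos (ha : a ^ 2 < 1) (he : ‖e‖ = 1) {q : Mink d} (hq : q ∈ Hyp d) :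
    0 < chartFactor (halfDist a) e (nPos a e q) := by
  have h := hyp_factor ha he hq
  have hb : (0 : ℝ) < 1 - a ^ 2 := by linarith
  by_contra! hn
  have : q.2 ^ 2 * ((1 - a ^ 2) * chartFactor (halfDist a) e (nPos a e q)) ≤ 0 :=
    mul_nonpos_of_nonneg_of_nonpos (sq_nonneg _) (mul_nonpos_of_nonneg_of_nonpos hb.le hn)
  linarith

theorem coth_arcosh {X : ℝ} (hX : 1 ≤ X) : coth (Real.arcosh X) = X / √(X ^ 2 - 1) := by
  rw [coth, Real.cosh_arcosh hX, Real.sinh_arcosh hX]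

theorem neg_mink_lift_pos (he : ‖e‖ = 1) {c : ℝ} (hc : c ^ 2 < 1) {q : Mink d} (hq : q ∈ Hyp d) :
    0 < -mink q (lift (c • e)) := by
  obtain ⟨h1, h2⟩ := hq
  rw [mink, real_inner_self_eq_norm_sq] at h1
  have hb : 0 < √(1 - ‖c • e‖ ^ 2) := by
    rw [norm_smul, he, mul_one, Real.norm_eq_abs, sq_abs]
    exact Real.sqrt_pos.2 (by linarith)
  simp only [mink, lift, real_inner_smul_right]
  have h3 : c * inner ℝ q.1 e < q.2 := by
    have h4 : |inner ℝ q.1 e| ≤ ‖q.1‖ := by simpa [he] using abs_real_inner_le_norm q.1 e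
    have h5 : (inner ℝ q.1 e : ℝ) ^ 2 ≤ ‖q.1‖ ^ 2 := by rw [← sq_abs]; gcongr
    refine lt_of_pow_lt_pow_left₀ 2 h2.le ?_
    nlinarith [sq_nonneg (inner ℝ q.1 e : ℝ)]
  have : 0 < (√(1 - ‖c • e‖ ^ 2))⁻¹ * (q.2 - c * inner ℝ q.1 e) :=
    mul_pos (inv_pos.2 hb) (by linarith)
  linarith

theorem inner_pos_axis (ha : a ^ 2 < 1) (he : ‖e‖ = 1) {q : Mink d} (hq : q ∈ Hyp d) :
    inner ℝ q.1 e = q.2 * (√(1 - a ^ 2) * inner ℝ (nPos a e q) e + a) := by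
  have hb : √(1 - a ^ 2) ≠ 0 := (Real.sqrt_pos.2 (by linarith)).ne'
  have h1 : inner ℝ (q.2⁻¹ • q.1) e = √(1 - a ^ 2) * inner ℝ (nPos a e q) e + a := by
    rw [← shrink_nPos ha he, inner_axisScale_axis he, inner_sub_left, real_inner_smul_left,
      real_inner_self_eq_norm_sq, he, halfDist]
    field_simp
    ring
  rw [← h1, real_inner_smul_left, mul_inv_cancel_left₀ hq.2.ne']

theorem neg_mink_lift_first (ha : a ^ 2 < 1) (he : ‖e‖ = 1) {q : Mink d} (hq : q ∈ Hyp d) :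
    -mink q (lift (a • e)) =
      q.2 * √(1 - a ^ 2) * (1 + halfDist a * inner ℝ (nPos a e q) e) := by
  have hb : √(1 - a ^ 2) ≠ 0 := (Real.sqrt_pos.2 (by linarith)).ne'
  have hb2 : √(1 - a ^ 2) ^ 2 = 1 - a ^ 2 := Real.sq_sqrt (by linarith)
  have hn : ‖a • e‖ ^ 2 = a ^ 2 := by rw [norm_smul, he, mul_one, Real.norm_eq_abs, sq_abs]
  simp only [mink, lift, hn, real_inner_smul_right, inner_pos_axis ha he hq, halfDist]
  field_simp
  linear_combination -q.2 * hb2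

theorem neg_mink_lift_second (ha : a ^ 2 < 1) (he : ‖e‖ = 1) {q : Mink d} (hq : q ∈ Hyp d) :
    -mink q (lift (-a • e)) = q.2 * √(1 - a ^ 2) *
      (1 + 2 * halfDist a ^ 2 - halfDist a * inner ℝ (nPos a e q) e) := by
  have hb : √(1 - a ^ 2) ≠ 0 := (Real.sqrt_pos.2 (by linarith)).ne'
  have hb2 : √(1 - a ^ 2) ^ 2 = 1 - a ^ 2 := Real.sq_sqrt (by linarith)
  have hn : ‖-a • e‖ ^ 2 = a ^ 2 := by rw [norm_smul, he, mul_one, Real.norm_eq_abs, sq_abs, neg_sq]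
  simp only [mink, lift, hn, real_inner_smul_right, inner_pos_axis ha he hq, halfDist]
  field_simp
  rw [hb2]
  ring

/-- This is `sinh² θ = (q_t ‖y‖)²`, the reason for the norm `|·|_a`: it makes `‖y‖` proportional to
`sinh θ` with the factor `1 / q_t`, which then cancels in `coth θ`. -/
theorem neg_mink_sq_first (ha : a ^ 2 < 1) (he : ‖e‖ = 1) {q : Mink d} (hq : q ∈ Hyp d) :
    (-mink q (lift (a • e))) ^ 2 - 1 = (q.2 * ‖nPos a e q‖) ^ 2 := by
  rw [neg_mink_lift_first ha he hq, mul_pow, mul_pow, Real.sq_sqrt (by linarith)]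
  have h := hyp_factor ha he hq
  have hh := halfDist_sq ha
  rw [chartFactor] at h
  linear_combination h + q.2 ^ 2 * ‖nPos a e q‖ ^ 2 * hh

theorem norm_sub_axis_sq (he : ‖e‖ = 1) (h : ℝ) (y : Eu d) :
    ‖y - (2 * h) • e‖ ^ 2 = ‖y‖ ^ 2 - 4 * h * inner ℝ y e + 4 * h ^ 2 := by
  rw [norm_sub_sq_real, real_inner_smul_right, norm_smul, Real.norm_eq_abs, mul_pow, sq_abs, he]
  ring

theorem neg_mink_sq_second (ha : a ^ 2 < 1) (he : ‖e‖ = 1) {q : Mink d} (hq : q ∈ Hyp d) :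
    (-mink q (lift (-a • e))) ^ 2 - 1 =
      (q.2 * ‖nPos a e q - (2 * halfDist a) • e‖) ^ 2 := by
  rw [neg_mink_lift_second ha he hq, mul_pow, mul_pow, Real.sq_sqrt (by linarith), mul_pow,
    norm_sub_axis_sq he]
  have h := hyp_factor ha he hq
  have hh := halfDist_sq ha
  rw [chartFactor] at h
  linear_combination h + q.2 ^ 2 * (‖nPos a e q‖ ^ 2 - 4 * halfDist a * inner ℝ (nPos a e q) e
    + 4 * halfDist a ^ 2) * hh

theorem one_le_neg_mink (he : ‖e‖ = 1) {c : ℝ} (hc : c ^ 2 < 1) {q : Mink d} (hq : q ∈ Hyp d)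
    {x : ℝ} (h : (-mink q (lift (c • e))) ^ 2 - 1 = x ^ 2) : 1 ≤ -mink q (lift (c • e)) := by
  have h1 := neg_mink_lift_pos he hc hq
  refine le_of_sq_le_sq ?_ h1.le
  nlinarith [sq_nonneg x]

theorem keplerPot_first (ha : a ^ 2 < 1) (he : ‖e‖ = 1) (m : ℝ) {q : Mink d} (hq : q ∈ Hyp d) :
    keplerPot m (lift (a • e)) q =
      -(m * √(1 - a ^ 2) * (1 + halfDist a * inner ℝ (nPos a e q) e) / ‖nPos a e q‖) := by
  have h := neg_mink_sq_first ha he hq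
  have hq2 : 0 < q.2 := hq.2
  rw [keplerPot, hdist, coth_arcosh (one_le_neg_mink he ha hq h), h, Real.sqrt_sq (by positivity),
    neg_mink_lift_first ha he hq]
  field_simp

theorem keplerPot_second (ha : a ^ 2 < 1) (he : ‖e‖ = 1) (m : ℝ) {q : Mink d} (hq : q ∈ Hyp d) :
    keplerPot m (lift (-a • e)) q =
      -(m * √(1 - a ^ 2) * secondPot (halfDist a) e (nPos a e q)) := by
  have h := neg_mink_sq_second ha he hq
  have hq2 : 0 < q.2 := hq.2
  rw [keplerPot, hdist, coth_arcosh (one_le_neg_mink he (by rwa [neg_sq]) hq h), h,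
    Real.sqrt_sq (by positivity), neg_mink_lift_second ha he hq, secondPot]
  field_simp

/-- Here `cosh θ = q_t`, so `tanh² θ = 1 - 1 / q_t²` is one minus the conformal factor. -/
theorem hookePot_mid (ha : a ^ 2 < 1) (he : ‖e‖ = 1) (f : ℝ) {q : Mink d} (hq : q ∈ Hyp d) :
    hookePot f (lift 0) q = f * (1 - (1 - a ^ 2) * chartFactor (halfDist a) e (nPos a e q)) := by
  have hq2 : 0 < q.2 := hq.2
  have h0 : -mink q (lift 0) = q.2 := by simp [mink, lift]
  have h1 := hq.1
  rw [mink, real_inner_self_eq_norm_sq] at h1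
  have h2 : 1 ≤ q.2 := by nlinarith [sq_nonneg ‖q.1‖]
  have h := hyp_factor ha he hq
  rw [hookePot, hdist, h0, Real.tanh_arcosh h2, div_pow, Real.sq_sqrt (by nlinarith)]
  congr 1
  field_simp
  linear_combination h

theorem lift_chartPos {q : Mink d} (hq : q ∈ Hyp d) : lift (q.2⁻¹ • q.1) = q := by
  obtain ⟨h1, h2⟩ := hq
  rw [mink, real_inner_self_eq_norm_sq] at h1
  have h3 : √(1 - ‖q.2⁻¹ • q.1‖ ^ 2) = q.2⁻¹ := by
    rw [norm_smul, mul_pow, norm_inv, Real.norm_eq_abs, inv_pow, sq_abs,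
      show ‖q.1‖ ^ 2 = q.2 ^ 2 - 1 by linarith, show 1 - (q.2 ^ 2)⁻¹ * (q.2 ^ 2 - 1) = q.2⁻¹ ^ 2 by
        field_simp; ring]
    exact Real.sqrt_sq (by positivity)
  rw [lift, h3, inv_inv, smul_smul, mul_inv_cancel₀ h2.ne', one_smul]

theorem ofNPos_nPos (ha : a ^ 2 < 1) (he : ‖e‖ = 1) {q : Mink d} (hq : q ∈ Hyp d) :
    ofNPos a e (nPos a e q) = q := by
  rw [ofNPos, shrink_nPos ha he, lift_chartPos hq]

theorem lift_mem_hyp {x : Eu d} (hx : ‖x‖ ^ 2 < 1) : lift x ∈ Hyp d := by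
  have h : 0 < √(1 - ‖x‖ ^ 2) := Real.sqrt_pos.2 (by linarith)
  have h2 : √(1 - ‖x‖ ^ 2) ^ 2 = 1 - ‖x‖ ^ 2 := Real.sq_sqrt (by linarith)
  refine ⟨?_, inv_pos.2 h⟩
  rw [mink, lift, real_inner_smul_left, real_inner_smul_right, real_inner_self_eq_norm_sq]
  field_simp
  linear_combination h2

theorem chartPos_lift {x : Eu d} (hx : ‖x‖ ^ 2 < 1) : (lift x).2⁻¹ • (lift x).1 = x := by
  have h : √(1 - ‖x‖ ^ 2) ≠ 0 := (Real.sqrt_pos.2 (by linarith)).ne'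
  simp [lift, smul_smul, h]

theorem nPos_ofNPos (ha : a ^ 2 < 1) (he : ‖e‖ = 1) {y : Eu d}
    (hy : 0 < chartFactor (halfDist a) e y) : nPos a e (ofNPos a e y) = y := by
  have hb : √(1 - a ^ 2) ≠ 0 := (Real.sqrt_pos.2 (by linarith)).ne'
  have h := norm_shrink_sq ha he y
  have : 0 < (1 - a ^ 2) * chartFactor (halfDist a) e y := mul_pos (by linarith) hy
  rw [nPos, ofNPos, chartPos_lift (by linarith), axisScale_axisScale he, inv_mul_cancel₀ hb,
    axisScale_one, sub_add_cancel]

theorem ofNPos_zero (ha : a ^ 2 < 1) (he : ‖e‖ = 1) : ofNPos a e 0 = lift (a • e) := by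
  have hb : √(1 - a ^ 2) ≠ 0 := (Real.sqrt_pos.2 (by linarith)).ne'
  rw [ofNPos, zero_sub, map_neg, map_smul, axisScale_self he, halfDist, smul_smul, neg_mul,
    div_mul_cancel₀ _ hb, neg_smul, neg_neg]

theorem ofNPos_second (ha : a ^ 2 < 1) (he : ‖e‖ = 1) :
    ofNPos a e ((2 * halfDist a) • e) = lift (-a • e) := by
  have hb : √(1 - a ^ 2) ≠ 0 := (Real.sqrt_pos.2 (by linarith)).ne'
  rw [ofNPos, show (2 * halfDist a) • e - halfDist a • e = halfDist a • e by module, map_smul,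
    axisScale_self he, halfDist, smul_smul, neg_mul, div_mul_cancel₀ _ hb]

end Chart

/-! ### The Poisson bracket in the normalized chart. -/

section Bracket
variable {d : ℕ}

/-- The bracket is the derivative of `F` along Hamilton's vector field of `G`. As `fderiv` is linear
in the direction in any case, no differentiability of `F` enters. -/
theorem canonicalBracket_eq {F G : Eu d × Eu d → ℝ} {c : Eu d × Eu d} {gs gp : Eu d}
    (hG : ∀ v v', fderiv ℝ G c (v, v') = inner ℝ gs v + inner ℝ gp v') :
    canonicalBracket F G c = fderiv ℝ F c (gp, -gs) := by
  have hsum : ∀ g : Eu d, ∑ i, g i • EuclideanSpace.single i (1 : ℝ) = g := fun g => by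
    simpa using (EuclideanSpace.basisFun (Fin d) ℝ).sum_repr g
  have h1 : ((gp, -gs) : Eu d × Eu d) = ∑ i, (gp i • (EuclideanSpace.single i (1 : ℝ), (0 : Eu d))
      - gs i • ((0 : Eu d), EuclideanSpace.single i (1 : ℝ))) := by
    have h2 : ∀ i, (gp i • (EuclideanSpace.single i (1 : ℝ), (0 : Eu d))
      - gs i • ((0 : Eu d), EuclideanSpace.single i (1 : ℝ))) =
        (gp i • EuclideanSpace.single i (1 : ℝ), -(gs i • EuclideanSpace.single i (1 : ℝ))) :=
      fun i => by ext1 <;> simp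
    simp only [h2]
    apply Prod.ext
    · rw [Prod.fst_sum]
      exact (hsum gp).symm
    · rw [Prod.snd_sum, Finset.sum_neg_distrib]
      exact congrArg Neg.neg (hsum gs).symm
  rw [h1, map_sum, canonicalBracket]
  refine Finset.sum_congr rfl fun i _ => ?_
  rw [hG, hG, map_sub, map_smul, map_smul]
  simp [EuclideanSpace.inner_single_right]
  ring

/-- The normalized chart in terms of the canonical coordinates. -/
def chartMap (a : ℝ) (e : Eu d) (c : Eu d × Eu d) : Eu d × Eu d :=
  (nPos a e (ofCanonical c).1, nVel a e (ofCanonical c))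

variable {a : ℝ} {e : Eu d}

theorem chartMap_eq (a : ℝ) (e : Eu d) (c : Eu d × Eu d) : chartMap a e c =
    (axisScale (√(1 - a ^ 2))⁻¹ e ((√(1 + ‖c.1‖ ^ 2))⁻¹ • c.1) + halfDist a • e,
      axisScale (√(1 - a ^ 2))⁻¹ e (√(1 + ‖c.1‖ ^ 2) • c.2)) := by
  rw [chartMap, nPos, nVel, chartVel, ofCanonical]
  ext1
  · rfl
  · refine congrArg (axisScale (√(1 - a ^ 2))⁻¹ e) ?_
    dsimp only
    module

theorem contDiff_chartMap (a : ℝ) (e : Eu d) : ContDiff ℝ 1 (chartMap a e) := by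
  have h1 : ContDiff ℝ 1 (fun c : Eu d × Eu d => √(1 + ‖c.1‖ ^ 2)) :=
    (contDiff_const.add (contDiff_fst.norm_sq ℝ)).sqrt fun c => by positivity
  have h2 : ∀ c : Eu d × Eu d, √(1 + ‖c.1‖ ^ 2) ≠ 0 := fun c => by positivity
  rw [show chartMap a e = _ from funext (chartMap_eq a e)]
  exact (((axisScale _ e).contDiff.comp ((h1.inv h2).smul contDiff_fst)).add contDiff_const).prodMk
    ((axisScale _ e).contDiff.comp (h1.smul contDiff_snd))

theorem fderiv_chartMap (a : ℝ) (e : Eu d) (c : Eu d × Eu d) (v v' : Eu d) :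
    fderiv ℝ (chartMap a e) c (v, v') =
      (axisScale (√(1 - a ^ 2))⁻¹ e ((√(1 + ‖c.1‖ ^ 2))⁻¹ • v
          - (inner ℝ c.1 v / √(1 + ‖c.1‖ ^ 2) ^ 3) • c.1),
        axisScale (√(1 - a ^ 2))⁻¹ e ((inner ℝ c.1 v / √(1 + ‖c.1‖ ^ 2)) • c.2
          + √(1 + ‖c.1‖ ^ 2) • v')) := by
  have hd := ((contDiff_chartMap a e).contDiffAt (x := c)).differentiableAt (by norm_num)
  rw [← hd.lineDeriv_eq_fderiv]
  refine HasDerivAt.deriv ?_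
  have hs : HasDerivAt (fun ε : ℝ => (c + ε • (v, v')).1) v 0 := hasDerivAt_line c.1 v
  have hp : HasDerivAt (fun ε : ℝ => (c + ε • (v, v')).2) v' 0 := hasDerivAt_line c.2 v'
  have hq := (hs.norm_sq.const_add 1).sqrt (by positivity)
  have hx := (hq.fun_inv (by positivity)).fun_smul hs
  have hw := hq.fun_smul hp
  have h := (((axisScale (√(1 - a ^ 2))⁻¹ e).hasFDerivAt.comp_hasDerivAt (0 : ℝ) hx).add_const
    (halfDist a • e)).prodMk ((axisScale (√(1 - a ^ 2))⁻¹ e).hasFDerivAt.comp_hasDerivAt (0 : ℝ) hw)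
  simp only [chartMap_eq]
  refine h.congr_deriv ?_
  have hr : √(1 + ‖c.1‖ ^ 2) ≠ 0 := by positivity
  simp only [zero_smul, add_zero]
  ext1 <;> dsimp only <;> congr 1 <;> match_scalars <;> field_simp

theorem differentiableAt_chartD (μ h : ℝ) (e : Eu d) {z : Eu d × Eu d} (hy : z.1 ≠ 0) :
    DifferentiableAt ℝ (fun z : Eu d × Eu d => chartD μ h e z.1 z.2) z := by
  have h1 : DifferentiableAt ℝ (fun z : Eu d × Eu d => ‖z.1‖) z := differentiableAt_fst.norm ℝ hy
  have hr := norm_ne_zero_iff.2 hy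
  have h2 : DifferentiableAt ℝ (fun z : Eu d × Eu d => ‖z.2‖ ^ 2) z :=
    differentiableAt_snd.norm_sq ℝ
  have h3 : DifferentiableAt ℝ (fun z : Eu d × Eu d => inner ℝ z.1 z.2) z :=
    differentiableAt_fst.inner ℝ differentiableAt_snd
  have h4 : DifferentiableAt ℝ (fun z : Eu d × Eu d => inner ℝ z.1 e) z :=
    differentiableAt_fst.inner ℝ (differentiableAt_const e)
  have h5 : DifferentiableAt ℝ (fun z : Eu d × Eu d => inner ℝ z.2 e) z :=
    differentiableAt_snd.inner ℝ (differentiableAt_const e)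
  unfold chartD
  simp only [div_eq_mul_inv]
  exact (((h1.fun_pow 2).fun_mul h2).fun_sub (h3.fun_pow 2)).fun_sub
    ((((h2.fun_mul h4).fun_sub (h3.fun_mul h5)).fun_sub
      ((h4.const_mul μ).fun_mul (h1.fun_inv hr))).const_mul (2 * h))

theorem fderiv_chartD (μ h : ℝ) (e : Eu d) {z : Eu d × Eu d} (hy : z.1 ≠ 0) (v v' : Eu d) :
    fderiv ℝ (fun z : Eu d × Eu d => chartD μ h e z.1 z.2) z (v, v') =
      inner ℝ (gradPos μ h e z.1 z.2) v + inner ℝ (gradVel h e z.1 z.2) v' := by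
  have hr := norm_ne_zero_iff.2 hy
  apply fderiv_eq_of_hasDerivAt_line (differentiableAt_chartD μ h e hy)
  have dy : HasDerivAt (fun ε : ℝ => (z + ε • (v, v')).1) v 0 := hasDerivAt_line z.1 v
  have dw : HasDerivAt (fun ε : ℝ => (z + ε • (v, v')).2) v' 0 := hasDerivAt_line z.2 v'
  have dr := hasDerivAt_norm_comp dy (by simpa using hy)
  have dye := dy.inner ℝ (hasDerivAt_const (0 : ℝ) e)
  have dwe := dw.inner ℝ (hasDerivAt_const (0 : ℝ) e)
  have dyw := dy.inner ℝ dw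
  have h := (((dy.norm_sq.fun_mul dw.norm_sq).fun_sub (dyw.fun_pow 2)).fun_sub
    ((((dw.norm_sq.fun_mul dye).fun_sub (dyw.fun_mul dwe)).fun_sub
      ((dye.const_mul μ).fun_div dr (by simpa using hr))).const_mul (2 * h)))
  refine h.congr_deriv ?_
  simp only [gradPos, gradVel, inner_add_left, real_inner_smul_left, zero_smul, add_zero,
    inner_zero_right, zero_add, real_inner_comm v e, real_inner_comm v' e, real_inner_comm v z.2,
    Nat.cast_ofNat]
  field_simp
  ring

theorem axisScale_axisScale_inv (ha : a ^ 2 < 1) (he : ‖e‖ = 1) (v : Eu d) :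
    axisScale (√(1 - a ^ 2))⁻¹ e (axisScale (√(1 - a ^ 2))⁻¹ e v) =
      v + (halfDist a ^ 2 * inner ℝ v e) • e := by
  have hb : (0 : ℝ) < 1 - a ^ 2 := by linarith
  rw [axisScale_axisScale he, axisScale_apply, ← mul_inv, Real.mul_self_sqrt hb.le, halfDist, neg_sq,
    div_pow, Real.sq_sqrt hb.le]
  congr 3
  field_simp
  ring

/-- The Poisson bracket with `chartD`, in the normalized chart. -/
theorem canonicalBracket_chartD (ha : a ^ 2 < 1) (he : ‖e‖ = 1) (μ : ℝ) {F : Eu d × Eu d → ℝ}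
    {c : Eu d × Eu d} (hy : (chartMap a e c).1 ≠ 0) (hF : DifferentiableAt ℝ F (chartMap a e c)) :
    canonicalBracket (F ∘ chartMap a e)
        (fun c => chartD μ (halfDist a) e (chartMap a e c).1 (chartMap a e c).2) c =
      fderiv ℝ F (chartMap a e c)
        (fieldPos (halfDist a) e (chartMap a e c).1 (chartMap a e c).2,
          fieldVel μ (halfDist a) e (chartMap a e c).1 (chartMap a e c).2) := by
  have hd := ((contDiff_chartMap a e).contDiffAt (x := c)).differentiableAt (by norm_num)
  set y := (chartMap a e c).1 with hyd
  set w := (chartMap a e c).2 with hwd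
  set r := √(1 + ‖c.1‖ ^ 2) with hrd
  have hr : r ≠ 0 := by positivity
  set B := axisScale (√(1 - a ^ 2))⁻¹ e with hB
  set gy := gradPos μ (halfDist a) e y w with hgy
  set gw := gradVel (halfDist a) e y w with hgw
  have hY : y - halfDist a • e = r⁻¹ • B c.1 := by
    rw [hyd, chartMap_eq, add_sub_cancel_right, map_smul]
  have hW : w = r • B c.2 := by rw [hwd, chartMap_eq]; exact map_smul _ _ _
  have hBB : ∀ v v', inner ℝ (B v) v' = inner ℝ v (B v') := inner_axisScale_left _ e
  -- With `y - h e = B x`, where `x` is the chart position, the matrix taking the velocity gradient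
  -- to the position field is `B (1 - x ⊗ x) B = B² - (y - h e) ⊗ (y - h e)`. The identity `B² = 1 +
  -- h² e ⊗ e` explains the form of `fieldPos` and `fieldVel`.
  have hB2 : ∀ v, B (B v) = v + (halfDist a ^ 2 * inner ℝ v e) • e := axisScale_axisScale_inv ha he
  rw [canonicalBracket_eq (gs := r⁻¹ • B gy + (inner ℝ gw (B c.2) / r
    - inner ℝ c.1 (B gy) / r ^ 3) • c.1) (gp := r • B gw), fderiv_comp c hF hd]
  · rw [ContinuousLinearMap.comp_apply, fderiv_chartMap]
    congr 2
    · rw [fieldPos, hY, ← hB2, ← hgw, real_inner_smul_left, hBB]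
      rw [← hB, ← hrd]
      simp only [map_sub, map_smul, real_inner_smul_right]
      match_scalars <;> field_simp
    · have hg : -gy - (halfDist a ^ 2 * inner ℝ gy e) • e = -B (B gy) := by rw [hB2]; module
      rw [fieldVel, hY, ← hgw, ← hgy, hg, hW, real_inner_smul_left,
        real_inner_smul_left, hBB, hBB, real_inner_smul_right]
      rw [← hB, ← hrd]
      simp only [map_add, map_neg, map_smul, real_inner_smul_right]
      match_scalars <;> field_simp
      ring
  · intro v v'
    have h1 := fderiv_comp c (differentiableAt_chartD μ (halfDist a) e (z := chartMap a e c) hy) hd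
    change fderiv ℝ ((fun z : Eu d × Eu d => chartD μ (halfDist a) e z.1 z.2) ∘ chartMap a e) c
      (v, v') = _
    rw [h1, ContinuousLinearMap.comp_apply, fderiv_chartMap, fderiv_chartD μ (halfDist a) e hy,
      ← hyd, ← hwd, ← hgy, ← hgw, ← hB, ← hrd, ← hBB, ← hBB]
    have hgc : inner ℝ gy (B c.1) = inner ℝ c.1 (B gy) := by rw [← hBB, real_inner_comm]
    simp only [inner_add_left, inner_add_right, inner_sub_right, real_inner_smul_left,
      real_inner_smul_right, hBB, map_add, map_sub, map_smul, hgc]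
    field_simp
    ring

end Bracket

/-! ### `D` and the Kepler energy in the normalized chart. -/

section Energy
variable {d : ℕ} {a : ℝ} {e : Eu d}

/-- `D` uses the direction `-e` and a positive half distance, `chartD` the direction `e` and the
negative `halfDist a`; the two signs cancel. -/
theorem D_eq_chartD (ha : a ^ 2 < 1) (he : ‖e‖ = 1) (m : ℝ) (z : Mink d × Mink d) :
    D m a e z = chartD (m / √(1 - a ^ 2)) (halfDist a) e (nPos a e z.1) (nVel a e z) := by
  have hb : √(1 - a ^ 2) ≠ 0 := (Real.sqrt_pos.2 (by linarith)).ne'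
  have hx : axisScale (√(1 - a ^ 2))⁻¹ e (chartPos z - a • e) = nPos a e z.1 := by
    rw [nPos, chartPos, map_sub, map_smul (axisScale (√(1 - a ^ 2))⁻¹ e) a, axisScale_self he,
      halfDist]
    module
  have hw : axisScale (√(1 - a ^ 2))⁻¹ e (chartVel z) = nVel a e z := rfl
  have hn : axisScale (√(1 - a ^ 2))⁻¹ e (-√(1 - a ^ 2) • e) = -e := by
    rw [map_smul, axisScale_self he, smul_smul, neg_mul, mul_inv_cancel₀ hb, neg_one_smul]
  rw [D, angMomSq, lrl]
  generalize chartPos z - a • e = x at hx ⊢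
  simp only [affInner_eq ha he, hn, map_sub, map_smul, hw, hx]
  generalize nPos a e z.1 = y
  generalize nVel a e z = w
  simp only [real_inner_self_eq_norm_sq, Real.sqrt_sq (norm_nonneg _), inner_neg_right,
    inner_sub_left, real_inner_smul_left, chartD, halfDist]
  ring

/-- The energy of the hyperbolic Kepler problem in the normalized chart. -/
def chartEnergy (μ h : ℝ) (e : Eu d) (z : Eu d × Eu d) : ℝ :=
  (-sqFreq μ z.1 z.2 - chartD μ h e z.1 z.2
    - h ^ 2 * (‖perp e z.1‖ ^ 2 * ‖perp e z.2‖ ^ 2 - inner ℝ (perp e z.1) (perp e z.2) ^ 2))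
    / (2 * (1 + h ^ 2))

theorem inner_perp (he : ‖e‖ = 1) (y w : Eu d) :
    inner ℝ (perp e y) (perp e w) = inner ℝ y w - inner ℝ y e * inner ℝ w e := by
  simp only [perp, inner_sub_left, inner_sub_right, real_inner_smul_left, real_inner_smul_right,
    real_inner_self_eq_norm_sq, he, real_inner_comm w e]
  ring

/-- This identity explains why the hyperbolic energy commutes with `D`: it is a combination of the
Euclidean energy `-sqFreq / 2`, of `D` itself, and of the squared momentum orthogonal to the axis.
The constants come from `1 - a² = 1 / (1 + h²)`. -/
theorem keplerEnergy_eq_chartEnergy (ha : a ^ 2 < 1) (he : ‖e‖ = 1) (m : ℝ) (c : Eu d × Eu d)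
    (hy : (chartMap a e c).1 ≠ 0) :
    keplerEnergy m (lift (a • e)) (ofCanonical c) =
      chartEnergy (m / √(1 - a ^ 2)) (halfDist a) e (chartMap a e c) := by
  have hmem := ofCanonical_mem c
  have hpot := keplerPot_first ha he m hmem.1
  have hfac := hyp_factor ha he hmem.1
  have hx := shrink_nPos ha he (ofCanonical c).1
  have hw := shrink_nVel ha he (ofCanonical c)
  have hh := halfDist_sq ha
  have hb2 : √(1 - a ^ 2) ^ 2 = 1 - a ^ 2 := Real.sq_sqrt (by linarith)
  have hb : √(1 - a ^ 2) ≠ 0 := (Real.sqrt_pos.2 (by linarith)).ne'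
  set r := √(1 + ‖c.1‖ ^ 2) with hr
  have hr0 : r ≠ 0 := by positivity
  have hr2 : r ^ 2 = 1 + ‖c.1‖ ^ 2 := Real.sq_sqrt (by positivity)
  have hq2 : (ofCanonical c).1.2 = r := rfl
  have hq1 : (ofCanonical c).1.1 = c.1 := rfl
  have hv : chartVel (ofCanonical c) = r • c.2 := by
    rw [chartVel, ofCanonical]; dsimp only; module
  rw [hq2, hq1] at hx
  rw [hv] at hw
  rw [hq2] at hfac
  have hkin : mink (ofCanonical c).2 (ofCanonical c).2 = ‖c.2‖ ^ 2 + inner ℝ c.1 c.2 ^ 2 := by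
    simp only [mink, ofCanonical, ← hr, inner_add_left, inner_add_right, real_inner_smul_left,
      real_inner_smul_right, real_inner_self_eq_norm_sq, real_inner_comm c.1 c.2, norm_smul, mul_pow,
      Real.norm_eq_abs, sq_abs]
    linear_combination -(inner ℝ c.1 c.2 : ℝ) ^ 2 * hr2
  rw [keplerEnergy, hpot, hkin]
  change _ = chartEnergy _ _ e (nPos a e (ofCanonical c).1, nVel a e (ofCanonical c))
  change nPos a e (ofCanonical c).1 ≠ 0 at hy
  generalize nPos a e (ofCanonical c).1 = y at *
  generalize nVel a e (ofCanonical c) = w at *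
  have hn := norm_ne_zero_iff.2 hy
  have hp : ‖c.2‖ ^ 2 = ((1 - a ^ 2) * chartFactor (halfDist a) e y) *
      (‖w‖ ^ 2 - a ^ 2 * inner ℝ w e ^ 2) := by
    have h1 := norm_axisScale_sq he (√(1 - a ^ 2)) w
    rw [hw, hb2, norm_smul, mul_pow, Real.norm_eq_abs, sq_abs] at h1
    linear_combination -‖c.2‖ ^ 2 * hfac + ((1 - a ^ 2) * chartFactor (halfDist a) e y) * h1
  have hsp : inner ℝ c.1 c.2 = inner ℝ y w - halfDist a * inner ℝ w e
      - a ^ 2 * (inner ℝ y e - halfDist a) * inner ℝ w e := by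
    have h1 := inner_axisScale he (√(1 - a ^ 2)) (y - halfDist a • e) w
    rw [hw, hx, hb2, real_inner_smul_left, real_inner_smul_right, inv_mul_cancel_left₀ hr0,
      inner_sub_left, inner_sub_left, real_inner_smul_left, real_inner_smul_left,
      real_inner_self_eq_norm_sq, he, real_inner_comm w e] at h1
    rw [h1]
    ring
  have hh0 : 1 + halfDist a ^ 2 ≠ 0 := by positivity
  have ha2 : 1 - a ^ 2 = (1 + halfDist a ^ 2)⁻¹ := by
    field_simp
    linear_combination hh
  have ha3 : a ^ 2 = halfDist a ^ 2 / (1 + halfDist a ^ 2) := by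
    field_simp
    linear_combination -hh
  have hm : m * √(1 - a ^ 2) = m / √(1 - a ^ 2) * (1 + halfDist a ^ 2)⁻¹ := by
    rw [← ha2]
    field_simp
    rw [hb2]
  rw [hp, hsp, hm, ha2, ha3, chartEnergy, sqFreq, chartD, chartFactor,
    ← real_inner_self_eq_norm_sq (perp e y), ← real_inner_self_eq_norm_sq (perp e w),
    inner_perp he, inner_perp he, inner_perp he, real_inner_self_eq_norm_sq,
    real_inner_self_eq_norm_sq]
  generalize m / √(1 - a ^ 2) = μ
  field_simp
  ring

theorem chartEnergy_variation (he : ‖e‖ = 1) (μ h : ℝ) {z : Eu d × Eu d} (hy : z.1 ≠ 0) :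
    DifferentiableAt ℝ (chartEnergy μ h e) z ∧
      fderiv ℝ (chartEnergy μ h e) z (fieldPos h e z.1 z.2, fieldVel μ h e z.1 z.2) = 0 := by
  have hperp : ∀ v : Eu d, perp e v = axisScale 0 e v := fun v => by
    rw [axisScale_apply, perp]; module
  have d1 : DifferentiableAt ℝ (fun z : Eu d × Eu d => sqFreq μ z.1 z.2) z :=
    (contDiffAt_sqFreq μ hy).differentiableAt (by norm_num)
  have d2 := differentiableAt_chartD μ h e hy
  have p1 : DifferentiableAt ℝ (fun z : Eu d × Eu d => perp e z.1) z := by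
    simp only [hperp]; fun_prop
  have p2 : DifferentiableAt ℝ (fun z : Eu d × Eu d => perp e z.2) z := by
    simp only [hperp]; fun_prop
  have d3 := ((p1.norm_sq ℝ).fun_mul (p2.norm_sq ℝ)).fun_sub ((p1.inner ℝ p2).fun_pow 2)
  have hd : DifferentiableAt ℝ (chartEnergy μ h e) z := by
    unfold chartEnergy
    simp only [div_eq_mul_inv]
    exact ((d1.fun_neg.fun_sub d2).fun_sub (d3.const_mul (h ^ 2))).mul_const _
  refine ⟨hd, fderiv_eq_of_hasDerivAt_line hd ?_⟩
  set δ := (fieldPos h e z.1 z.2, fieldVel μ h e z.1 z.2) with hδ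
  have dy : HasDerivAt (fun ε : ℝ => (z + ε • δ).1) δ.1 0 := hasDerivAt_line z.1 δ.1
  have dw : HasDerivAt (fun ε : ℝ => (z + ε • δ).2) δ.2 0 := hasDerivAt_line z.2 δ.2
  have e1 := hasDerivAt_sqFreq μ dy dw (by simpa using hy)
  have e2 := hasDerivAt_comp_line d2 δ
  have q1 : HasDerivAt (fun ε : ℝ => perp e (z + ε • δ).1) (perp e δ.1) 0 := by
    simp only [hperp]
    exact (axisScale 0 e).hasFDerivAt.comp_hasDerivAt (0 : ℝ) dy
  have q2 : HasDerivAt (fun ε : ℝ => perp e (z + ε • δ).2) (perp e δ.2) 0 := by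
    simp only [hperp]
    exact (axisScale 0 e).hasFDerivAt.comp_hasDerivAt (0 : ℝ) dw
  have e3 := (q1.norm_sq.fun_mul q2.norm_sq).fun_sub ((q1.inner ℝ q2).fun_pow 2)
  refine (((e1.fun_neg.fun_sub e2).fun_sub (e3.const_mul (h ^ 2))).div_const
    (2 * (1 + h ^ 2))).congr_deriv ?_
  -- Antisymmetry of the bracket: `D` is constant along its own Hamiltonian field.
  have f2 : fderiv ℝ (fun z : Eu d × Eu d => chartD μ h e z.1 z.2) z δ = 0 := by
    rw [hδ, fderiv_chartD μ h e hy, fieldPos, fieldVel]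
    simp only [inner_add_right, inner_sub_right, inner_neg_right, real_inner_smul_right]
    generalize gradPos μ h e z.1 z.2 = gy
    generalize gradVel h e z.1 z.2 = gw
    rw [real_inner_comm gy gw]
    rw [inner_sub_left, inner_sub_left, real_inner_smul_left, real_inner_smul_left]
    simp only [real_inner_comm e, real_inner_comm z.1 gw, real_inner_comm z.1 gy]
    ring
  rw [f2]
  simp only [zero_smul, add_zero]
  have f1 := sqFreq_variation he hy μ h z.2
  have f3 := angMomPerp_variation he hy μ h z.2
  simp only [hδ, f1]
  field_simp
  simp only [Nat.cast_ofNat]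
  linear_combination (-2 * h ^ 2) * f3

end Energy

/-! ### From closed motions to ellipses. -/

section Motion
variable {E : Type*} [NormedAddCommGroup E] [InnerProductSpace ℝ E]

/-- `y` and `w` solve the Kepler problem of mass `μ` with respect to a time in which the velocity
is multiplied by `N`. -/
structure IsChartMotion (μ : ℝ) (N : ℝ → ℝ) (y w : ℝ → E) : Prop where
  ne_zero : ∀ t, y t ≠ 0
  factor_pos : ∀ t, 0 < N t
  factor_continuous : Continuous N
  hasDerivAt_pos : ∀ t, HasDerivAt y (N t • w t) t
  hasDerivAt_vel : ∀ t, HasDerivAt w (-(N t * μ / ‖y t‖ ^ 3) • y t) t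

variable {μ : ℝ} {N : ℝ → ℝ} {y w : ℝ → E}

theorem eq_of_hasDerivAt_zero {F : Type*} [NormedAddCommGroup F] [NormedSpace ℝ F] {f : ℝ → F}
    (h : ∀ t, HasDerivAt f 0 t) (s t : ℝ) : f s = f t :=
  is_const_of_deriv_eq_zero (fun t => (h t).differentiableAt) (fun t => (h t).deriv) s t

namespace IsChartMotion

theorem sqFreq_eq (hm : IsChartMotion μ N y w) (t : ℝ) :
    sqFreq μ (y t) (w t) = sqFreq μ (y 0) (w 0) := by
  refine eq_of_hasDerivAt_zero (f := fun t => sqFreq μ (y t) (w t)) (fun t => ?_) t 0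
  refine (hasDerivAt_sqFreq μ (hm.hasDerivAt_pos t) (hm.hasDerivAt_vel t)
    (hm.ne_zero t)).congr_deriv ?_
  rw [real_inner_smul_right, real_inner_smul_right, real_inner_comm (w t) (y t)]
  ring

/-- A closed motion is elliptic: if `sqFreq ≤ 0`, then `⟨y, w⟩` has derivative `N (μ / ‖y‖ - sqFreq)
> 0`, which is incompatible with a return to the initial state. -/
theorem sqFreq_pos (hm : IsChartMotion μ N y w) (hμ : 0 < μ) {T : ℝ} (hT : 0 < T)
    (hy : y T = y 0) (hw : w T = w 0) : 0 < sqFreq μ (y 0) (w 0) := by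
  by_contra! hs
  have hd : ∀ t, HasDerivAt (fun t => (inner ℝ (y t) (w t) : ℝ))
      (N t * (μ / ‖y t‖ - sqFreq μ (y 0) (w 0))) t := fun t => by
    have hr := norm_ne_zero_iff.2 (hm.ne_zero t)
    refine ((hm.hasDerivAt_pos t).inner ℝ (hm.hasDerivAt_vel t)).congr_deriv ?_
    rw [real_inner_smul_right, real_inner_smul_left, real_inner_self_eq_norm_sq,
      real_inner_self_eq_norm_sq, ← hm.sqFreq_eq t, sqFreq]
    field_simp
    ring
  have hmono : StrictMono (fun t => (inner ℝ (y t) (w t) : ℝ)) := by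
    refine strictMono_of_deriv_pos fun t => ?_
    rw [(hd t).deriv]
    have h1 : 0 < ‖y t‖ := norm_pos_iff.2 (hm.ne_zero t)
    have h2 := div_pos hμ h1
    exact mul_pos (hm.factor_pos t) (by linarith)
  have := hmono hT
  simp only [hy, hw, lt_self_iff_false] at this

/-- Conservation of the Laplace vector and of `sqFreq`. -/
theorem ctr_eq (hm : IsChartMotion μ N y w) (hs : 0 < sqFreq μ (y 0) (w 0)) (t : ℝ) :
    conicCtr (y t) (anomVel μ (y t, w t)) = conicCtr (y 0) (anomVel μ (y 0, w 0)) := by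
  have hs' : ∀ t, 0 < sqFreq μ (y t) (w t) := fun t => by rwa [hm.sqFreq_eq]
  rw [conicCtr_anomVel (z := (y t, w t)) (hm.ne_zero t) (hs' t),
    conicCtr_anomVel (z := (y 0, w 0)) (hm.ne_zero 0) hs,
    show sqFreq μ (y t, w t).1 (y t, w t).2 = _ from hm.sqFreq_eq t]
  refine congrArg _ (eq_of_hasDerivAt_zero
    (f := fun t => (‖w t‖ ^ 2 - μ / ‖y t‖) • y t - (inner ℝ (y t) (w t) : ℝ) • w t)
    (fun t => ?_) t 0)
  have hr := norm_ne_zero_iff.2 (hm.ne_zero t)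
  have dy := hm.hasDerivAt_pos t
  have dw := hm.hasDerivAt_vel t
  have dr := hasDerivAt_norm_comp dy (hm.ne_zero t)
  refine (((dw.norm_sq.fun_sub ((hasDerivAt_const t μ).fun_div dr hr)).fun_smul dy).fun_sub
    ((dy.inner ℝ dw).fun_smul dw)).congr_deriv ?_
  simp only [real_inner_smul_right, real_inner_smul_left, real_inner_comm (y t) (w t),
    real_inner_self_eq_norm_sq]
  rw [← sub_eq_zero]
  match_scalars <;> field_simp <;> ring

/-- The eccentric anomaly as a function of time. -/
def anomaly (μ : ℝ) (N : ℝ → ℝ) (y w : ℝ → E) (t : ℝ) : ℝ :=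
  ∫ s in (0 : ℝ)..t, √(sqFreq μ (y 0) (w 0)) * N s / ‖y s‖

theorem hasDerivAt_anomaly (hm : IsChartMotion μ N y w) (t : ℝ) :
    HasDerivAt (anomaly μ N y w) (√(sqFreq μ (y 0) (w 0)) * N t / ‖y t‖) t := by
  have hy : Continuous y := continuous_iff_continuousAt.2 fun t => (hm.hasDerivAt_pos t).continuousAt
  have hc : Continuous fun s => √(sqFreq μ (y 0) (w 0)) * N s / ‖y s‖ :=
    (continuous_const.mul hm.factor_continuous).div hy.norm
      fun s => norm_ne_zero_iff.2 (hm.ne_zero s)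
  exact (hc.integral_hasStrictDerivAt 0 t).hasDerivAt

/-- In the eccentric anomaly the Kepler motion is a harmonic oscillation about the center of the
ellipse. -/
theorem hasDerivAt_anomVel (hm : IsChartMotion μ N y w) (hs : 0 < sqFreq μ (y 0) (w 0)) (t : ℝ) :
    HasDerivAt (fun t => anomVel μ (y t, w t))
      ((√(sqFreq μ (y 0) (w 0)) * N t / ‖y t‖) •
        (conicCtr (y 0) (anomVel μ (y 0, w 0)) - y t)) t := by
  have hs' : 0 < sqFreq μ (y t) (w t) := by rwa [hm.sqFreq_eq]
  have hω := (Real.sqrt_pos.2 hs).ne'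
  have hr := norm_ne_zero_iff.2 (hm.ne_zero t)
  have dr := hasDerivAt_norm_comp (hm.hasDerivAt_pos t) (hm.ne_zero t)
  have h1 : (fun t => anomVel μ (y t, w t)) =
      fun t => (‖y t‖ / √(sqFreq μ (y 0) (w 0))) • w t :=
    funext fun t => by rw [anomVel]; dsimp only; rw [hm.sqFreq_eq t]
  rw [h1, ← hm.ctr_eq hs t, conicCtr_anomVel (z := (y t, w t)) (hm.ne_zero t) hs']
  dsimp only
  refine ((dr.div_const _).fun_smul (hm.hasDerivAt_vel t)).congr_deriv ?_
  have hW : ‖w t‖ ^ 2 = 2 * μ / ‖y t‖ - √(sqFreq μ (y 0) (w 0)) ^ 2 := by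
    rw [Real.sq_sqrt hs.le, ← hm.sqFreq_eq t, sqFreq]; ring
  rw [hm.sqFreq_eq t, hW, real_inner_smul_right]
  rw [← Real.sq_sqrt hs.le, Real.sqrt_sq (Real.sqrt_nonneg _)]
  match_scalars <;> field_simp
  ring

theorem rotate_eq (hm : IsChartMotion μ N y w) (hs : 0 < sqFreq μ (y 0) (w 0)) (t : ℝ) :
    y t = orbit μ (y 0, w 0) (anomaly μ N y w t) ∧
      anomVel μ (y t, w t) = orbitVel μ (y 0, w 0) (anomaly μ N y w t) := by
  have hω := (Real.sqrt_pos.2 hs).ne'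
  set k := conicCtr (y 0) (anomVel μ (y 0, w 0)) with hk
  set u := anomaly μ N y w with hu
  have u0 : u 0 = 0 := by simp [hu, anomaly]
  have hy' : ∀ t, HasDerivAt (fun t => y t - k)
      ((√(sqFreq μ (y 0) (w 0)) * N t / ‖y t‖) • anomVel μ (y t, w t)) t := fun t => by
    have hr := norm_ne_zero_iff.2 (hm.ne_zero t)
    refine ((hm.hasDerivAt_pos t).sub_const k).congr_deriv ?_
    rw [anomVel]
    dsimp only
    rw [hm.sqFreq_eq t, smul_smul]
    congr 1
    field_simp
  -- Rotating the pair `(y - k, η)` back by the angle `u` gives constants of motion, so the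
  -- oscillator is solved without a uniqueness theorem for differential equations.
  have hP := eq_of_hasDerivAt_zero
    (f := fun t => Real.cos (u t) • (y t - k) - Real.sin (u t) • anomVel μ (y t, w t))
    (fun t => by
      refine (((hm.hasDerivAt_anomaly t).cos.fun_smul (hy' t)).fun_sub
        ((hm.hasDerivAt_anomaly t).sin.fun_smul (hm.hasDerivAt_anomVel hs t))).congr_deriv ?_
      module) t 0
  have hQ := eq_of_hasDerivAt_zero
    (f := fun t => Real.sin (u t) • (y t - k) + Real.cos (u t) • anomVel μ (y t, w t))
    (fun t => by
      refine (((hm.hasDerivAt_anomaly t).sin.fun_smul (hy' t)).fun_add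
        ((hm.hasDerivAt_anomaly t).cos.fun_smul (hm.hasDerivAt_anomVel hs t))).congr_deriv ?_
      module) t 0
  simp only [u0, Real.cos_zero, Real.sin_zero, one_smul, zero_smul, sub_zero, zero_add] at hP hQ
  have hcs := Real.sin_sq_add_cos_sq (u t)
  constructor
  · have h1 : y t - k = Real.cos (u t) • (y 0 - k) + Real.sin (u t) • anomVel μ (y 0, w 0) := by
      rw [← hP, ← hQ]
      have : y t - k = (Real.sin (u t) ^ 2 + Real.cos (u t) ^ 2) • (y t - k) := by
        rw [hcs, one_smul]
      nth_rw 1 [this]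
      module
    rw [orbit, conic, ← hk]
    dsimp only
    rw [sub_eq_iff_eq_add] at h1
    rw [h1]
    module
  · rw [orbitVel, conicVel, ← hk]
    dsimp only
    rw [← hQ, show k - y 0 = -(y 0 - k) by abel, ← hP]
    have : anomVel μ (y t, w t) = (Real.sin (u t) ^ 2 + Real.cos (u t) ^ 2) •
        anomVel μ (y t, w t) := by rw [hcs, one_smul]
    nth_rw 1 [this]
    module

/-- `T` is any period, not necessarily the least one, so the ellipse may be traversed `n` times. -/
theorem exists_anomaly_period (hm : IsChartMotion μ N y w) (hμ : 0 < μ) {T : ℝ} (hT : 0 < T)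
    (hy : y T = y 0) (hw : w T = w 0) :
    ∃ n : ℕ, 0 < n ∧ anomaly μ N y w T = n * (2 * Real.pi) := by
  have hs := hm.sqFreq_pos hμ hT hy hw
  have hω := Real.sqrt_pos.2 hs
  have hr := norm_ne_zero_iff.2 (hm.ne_zero 0)
  obtain ⟨h1, h2⟩ := hm.rotate_eq hs T
  set U := anomaly μ N y w T with hU
  have hmono : StrictMono (anomaly μ N y w) := strictMono_of_deriv_pos fun t => by
    rw [(hm.hasDerivAt_anomaly t).deriv]
    exact div_pos (mul_pos hω (hm.factor_pos t)) (norm_pos_iff.2 (hm.ne_zero t))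
  have hpos : 0 < U := by
    have := hmono hT
    rwa [show anomaly μ N y w 0 = 0 by simp [anomaly]] at this
  set k := conicCtr (y 0) (anomVel μ (y 0, w 0)) with hk
  set η := anomVel μ (y 0, w 0) with hη
  rw [hy, orbit, conic] at h1
  rw [hy, hw, orbitVel, conicVel] at h2
  simp only [← hη, ← hk] at h1 h2
  have hcs := Real.sin_sq_add_cos_sq U
  -- A rotation by `U` fixes the pair `(y - k, η)`. If it is nontrivial, both vectors vanish; but `η
  -- = 0` forces `k = y / 2`, and with `k = y` this gives `y = 0`. The combinations `e1`, `e2`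
  -- invert the rotation minus the identity, whose determinant is `2 (1 - cos U)`.
  have hcos : Real.cos U = 1 := by
    by_contra hne
    have hne' : (1 - Real.cos U) ≠ 0 := sub_ne_zero.2 (Ne.symm hne)
    have hsum : Real.sin U ^ 2 + (1 - Real.cos U) ^ 2 = 2 * (1 - Real.cos U) := by
      linear_combination hcs
    have e1 : Real.sin U • (y 0 - (Real.cos U • y 0 + Real.sin U • η + (1 - Real.cos U) • k))
        + (1 - Real.cos U) • (Real.cos U • η + Real.sin U • (k - y 0) - η) =
        -(Real.sin U ^ 2 + (1 - Real.cos U) ^ 2) • η := by module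
    have e2 : (1 - Real.cos U) • (y 0 - (Real.cos U • y 0 + Real.sin U • η
          + (1 - Real.cos U) • k))
        - Real.sin U • (Real.cos U • η + Real.sin U • (k - y 0) - η) =
        (Real.sin U ^ 2 + (1 - Real.cos U) ^ 2) • (y 0 - k) := by module
    rw [← h1, ← h2, sub_self, sub_self, smul_zero, smul_zero, hsum] at e1 e2
    have hη0 : η = 0 := by simpa [hne'] using e1.symm
    have hk0 : y 0 - k = 0 := by simpa [hne'] using e2.symm
    have hk2 : k = (1 / 2 : ℝ) • y 0 := by
      rw [hk, hη0, conicCtr, conicAxis, norm_zero, inner_zero_right]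
      match_scalars
      field_simp
      ring
    rw [hk2] at hk0
    have : y 0 = (2 : ℝ) • (y 0 - (1 / 2 : ℝ) • y 0) := by module
    rw [hk0, smul_zero] at this
    exact hm.ne_zero 0 this
  obtain ⟨n, hn⟩ := (Real.cos_eq_one_iff U).1 hcos
  have hn0 : 0 < n := by
    by_contra! h
    have : (n : ℝ) ≤ 0 := by exact_mod_cast h
    nlinarith [Real.two_pi_pos]
  lift n to ℕ using hn0.le
  exact ⟨n, by exact_mod_cast hn0, by exact_mod_cast hn.symm⟩

/-- Every point of the orbit is attained within a period of the motion. -/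
theorem exists_time (hm : IsChartMotion μ N y w) (hμ : 0 < μ) {T : ℝ} (hT : 0 < T)
    (hy : y T = y 0) (hw : w T = w 0) (v : ℝ) : ∃ t, orbit μ (y 0, w 0) v = y t := by
  have hs := hm.sqFreq_pos hμ hT hy hw
  obtain ⟨n, hn, hU⟩ := hm.exists_anomaly_period hμ hT hy hw
  obtain ⟨v', hv', hvv⟩ := (conic_periodic (y 0) (anomVel μ (y 0, w 0))).exists_mem_Ico₀
    Real.two_pi_pos v
  have h0 : anomaly μ N y w 0 = 0 := by simp [anomaly]
  have hle : 2 * Real.pi ≤ anomaly μ N y w T := by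
    rw [hU]
    have : (1 : ℝ) ≤ n := by exact_mod_cast hn
    nlinarith [Real.two_pi_pos]
  obtain ⟨t, -, ht⟩ := intermediate_value_Icc hT.le
    (fun t _ => (hm.hasDerivAt_anomaly t).continuousAt.continuousWithinAt)
    (show v' ∈ Set.Icc (anomaly μ N y w 0) (anomaly μ N y w T) from
      ⟨by rw [h0]; exact hv'.1, hv'.2.le.trans hle⟩)
  refine ⟨t, ?_⟩
  rw [(hm.rotate_eq hs t).1, ht]
  exact hvv

/-- Substitution of the anomaly for the time. The factor `K = n / ω` is the same for every `V`, so
it cancels in the mean. -/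
theorem integral_eq (hm : IsChartMotion μ N y w) (hμ : 0 < μ) {T : ℝ} (hT : 0 < T)
    (hy : y T = y 0) (hw : w T = w 0) {P : E → ℝ} (hN : ∀ t, N t = P (y t))
    (hP : Continuous fun u => P (orbit μ (y 0, w 0) u)) :
    ∃ K : ℝ, K ≠ 0 ∧ ∀ V : E → ℝ, (Continuous fun u => V (orbit μ (y 0, w 0) u)) →
      ∫ t in (0 : ℝ)..T, V (y t) =
        K * orbitIntegral μ (fun y => ‖y‖ / P y * V y) (y 0, w 0) := by
  have hs := hm.sqFreq_pos hμ hT hy hw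
  have hω := (Real.sqrt_pos.2 hs).ne'
  obtain ⟨n, hn, hU⟩ := hm.exists_anomaly_period hμ hT hy hw
  have hn0 : (n : ℝ) ≠ 0 := by exact_mod_cast hn.ne'
  refine ⟨n * (√(sqFreq μ (y 0) (w 0)))⁻¹, by positivity, fun V hV => ?_⟩
  set Y := orbit μ (y 0, w 0) with hY
  have hYc : Continuous Y := continuous_conic _ _
  have hP0 : ∀ u, P (Y u) ≠ 0 := fun u => by
    obtain ⟨t, ht⟩ := hm.exists_time hμ hT hy hw u
    rw [show Y u = y t from ht, ← hN]
    exact (hm.factor_pos t).ne'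
  set g : ℝ → ℝ := fun u => ‖Y u‖ / P (Y u) * V (Y u) with hg
  have hgc : Continuous g := (hYc.norm.div hP hP0).mul hV
  have hyc : Continuous y := continuous_iff_continuousAt.2 fun t => (hm.hasDerivAt_pos t).continuousAt
  have hper : Function.Periodic g (2 * Real.pi) := fun u => by
    have : Y (u + 2 * Real.pi) = Y u := conic_periodic _ _ u
    simp only [hg, this]
  have h1 := intervalIntegral.integral_comp_mul_deriv (a := 0) (b := T)
    (f := anomaly μ N y w) (g := fun u => (√(sqFreq μ (y 0) (w 0)))⁻¹ * g u)
    (fun t _ => hm.hasDerivAt_anomaly t)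
    (((continuous_const.mul hm.factor_continuous).div hyc.norm
      fun s => norm_ne_zero_iff.2 (hm.ne_zero s)).continuousOn) (continuous_const.mul hgc)
  have h0 : anomaly μ N y w 0 = 0 := by simp [anomaly]
  have h2 : ∀ t, V (y t) = ((fun u => (√(sqFreq μ (y 0) (w 0)))⁻¹ * g u) ∘ anomaly μ N y w) t *
      (√(sqFreq μ (y 0) (w 0)) * N t / ‖y t‖) := fun t => by
    have hr := norm_ne_zero_iff.2 (hm.ne_zero t)
    have hNt := (hm.factor_pos t).ne'
    simp only [Function.comp, hg, ← (hm.rotate_eq hs t).1, hY, ← hN]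
    field_simp
  rw [intervalIntegral.integral_congr (fun t _ => h2 t), h1, h0, hU,
    intervalIntegral.integral_const_mul]
  have h3 := hper.intervalIntegral_add_zsmul_eq n 0 fun t₁ t₂ => hgc.intervalIntegrable t₁ t₂
  simp only [zero_add, zsmul_eq_mul, Int.cast_natCast] at h3
  rw [h3, orbitIntegral]
  ring

end IsChartMotion
end Motion

/-! ### From ellipses to closed motions. -/

section Existence
variable {E : Type*} [NormedAddCommGroup E] [InnerProductSpace ℝ E]

/-- A positive periodic function is the derivative of the inverse of a periodic time change. -/
theorem exists_inverse_primitive {g : ℝ → ℝ} {p : ℝ} (hp : 0 < p) (hg : Continuous g)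
    (hpos : ∀ u, 0 < g u) (hper : Function.Periodic g p) :
    ∃ (u : ℝ → ℝ) (T : ℝ), 0 < T ∧ u 0 = 0 ∧ (∀ t, HasDerivAt u (g (u t))⁻¹ t) ∧
      ∀ t, u (t + T) = u t + p := by
  have hint : ∀ t₁ t₂, IntervalIntegrable g MeasureTheory.volume t₁ t₂ := fun t₁ t₂ =>
    hg.intervalIntegrable t₁ t₂
  set τ : ℝ → ℝ := fun u => ∫ s in (0 : ℝ)..u, g s with hτ
  have dτ : ∀ u, HasDerivAt τ (g u) u := fun u => (hg.integral_hasStrictDerivAt 0 u).hasDerivAt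
  have hmono : StrictMono τ := strictMono_of_deriv_pos fun u => by
    rw [(dτ u).deriv]; exact hpos u
  have hT : 0 < τ p := by
    have := hmono hp
    simpa [hτ] using this
  have hcont : Continuous τ := continuous_iff_continuousAt.2 fun u => (dτ u).continuousAt
  have hsurj : Function.Surjective τ := hcont.surjective
    (hper.tendsto_atTop_intervalIntegral_of_pos hT hp)
    (hper.tendsto_atBot_intervalIntegral_of_pos hT hp)
  set φ := StrictMono.orderIsoOfSurjective τ hmono hsurj with hφ
  have h1 : ∀ t, τ (φ.symm t) = t := fun t => φ.apply_symm_apply t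
  have hadd : ∀ u, τ (u + p) = τ u + τ p := fun u => by
    simp only [hτ]
    rw [← intervalIntegral.integral_add_adjacent_intervals (hint 0 u) (hint u (u + p)),
      hper.intervalIntegral_add_eq u 0, zero_add]
  refine ⟨φ.symm, τ p, hT, ?_, fun t => ?_, fun t => ?_⟩
  · apply hmono.injective
    rw [h1]
    simp [hτ]
  · exact HasDerivAt.of_local_left_inverse φ.symm.continuous.continuousAt (dτ _) (hpos _).ne'
      (Filter.Eventually.of_forall h1)
  · apply hmono.injective
    rw [h1, hadd, h1]

/-- The ellipse is traversed with `dt / du = R / (ω P)`, the inverse of the relation that defines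
the anomaly; `conic_newton` then becomes Newton's equation. -/
theorem exists_isChartMotion {μ : ℝ} {z : E × E} (hs : 0 < sqFreq μ z.1 z.2)
    (hc : ∀ u, orbit μ z u ≠ 0) {P : E → ℝ} (hP : Continuous fun u => P (orbit μ z u))
    (hP0 : ∀ u, 0 < P (orbit μ z u)) :
    ∃ (y w : ℝ → E) (T : ℝ), 0 < T ∧ IsChartMotion μ (fun t => P (y t)) y w ∧ y 0 = z.1 ∧
      w 0 = z.2 ∧ Function.Periodic y T := by
  have hy : z.1 ≠ 0 := by simpa [orbit, conic_zero] using hc 0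
  have hr := norm_ne_zero_iff.2 hy
  have hω := Real.sqrt_pos.2 hs
  set ω := √(sqFreq μ z.1 z.2) with hωd
  set Y := orbit μ z with hY
  set R := conicRad z.1 (anomVel μ z) with hRd
  have hYc : Continuous Y := continuous_conic _ _
  have hR : ∀ u, ‖Y u‖ = R u := norm_conic hy hc
  have hR0 : ∀ u, 0 < R u := conicRad_pos hy hc
  have hYper : Function.Periodic Y (2 * Real.pi) := conic_periodic _ _
  obtain ⟨u, T, hT, u0, du, hu⟩ := exists_inverse_primitive Real.two_pi_pos
    (g := fun u => R u / (ω * P (Y u)))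
    ((continuous_conicRad _ _).div (continuous_const.mul hP) fun u =>
      (mul_pos hω (hP0 u)).ne') (fun u => div_pos (hR0 u) (mul_pos hω (hP0 u)))
    (fun u => by simp only [hYper u, conicRad_periodic z.1 (anomVel μ z) u, hRd])
  have hyd : ∀ t, HasDerivAt (fun t => Y (u t)) ((R (u t) / (ω * P (Y (u t))))⁻¹ •
      orbitVel μ z (u t)) t := fun t => (hasDerivAt_conic _ _ (u t)).scomp t (du t)
  have hVd : ∀ t, HasDerivAt (fun t => orbitVel μ z (u t)) ((R (u t) / (ω * P (Y (u t))))⁻¹ •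
      (conicCtr z.1 (anomVel μ z) - Y (u t))) t := fun t =>
    (hasDerivAt_conicVel _ _ (u t)).scomp t (du t)
  have hRd' : ∀ t, HasDerivAt (fun t => R (u t)) (conicRadVel z.1 (anomVel μ z) (u t) *
      (R (u t) / (ω * P (Y (u t))))⁻¹) t := fun t =>
    (hasDerivAt_conicRad _ _ (u t)).comp t (du t)
  have huc : Continuous u := continuous_iff_continuousAt.2 fun t => (du t).continuousAt
  refine ⟨fun t => Y (u t), fun t => (ω / R (u t)) • orbitVel μ z (u t), T, hT,
    ⟨fun t => hc _, fun t => hP0 _, hP.comp huc, fun t => ?_, fun t => ?_⟩, ?_, ?_, fun t => ?_⟩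
  · refine (hyd t).congr_deriv ?_
    have := (hR0 (u t)).ne'
    have := (hP0 (u t)).ne'
    rw [smul_smul]
    congr 1
    field_simp
  · have h1 := (hR0 (u t)).ne'
    have h2 := (hP0 (u t)).ne'
    refine (((hasDerivAt_const t ω).fun_div (hRd' t) h1).fun_smul (hVd t)).congr_deriv ?_
    have hn := conic_newton hy (anomVel μ z) (u t)
    rw [conicAxis_anomVel hy hs, ← Real.sq_sqrt hs.le, ← hωd] at hn
    change R (u t) • (conicCtr z.1 (anomVel μ z) - Y (u t)) -
      conicRadVel z.1 (anomVel μ z) (u t) • orbitVel μ z (u t) = -(μ / ω ^ 2) • Y (u t) at hn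
    have h3 : -(P (Y (u t)) * μ / ‖Y (u t)‖ ^ 3) • Y (u t) =
        (P (Y (u t)) * ω ^ 2 / R (u t) ^ 3) • (-(μ / ω ^ 2) • Y (u t)) := by
      rw [hR, smul_smul]
      congr 1
      field_simp
    rw [h3, ← hn]
    match_scalars <;> field_simp
    ring
  · simp only [u0]
    exact conic_zero
  · simp only [u0]
    rw [← hR, show Y 0 = z.1 from conic_zero, show orbitVel μ z 0 = anomVel μ z from conicVel_zero,
      anomVel, smul_smul, ← hωd, div_mul_div_cancel₀ hr, div_self hω.ne', one_smul]
  · simp only [hu]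
    exact hYper _

end Existence

/-! ### The projective correspondence between hyperbolic and Euclidean motions. -/

section Bridge
variable {d : ℕ} {a : ℝ} {e : Eu d}

/-- The conformal factor `1 - |x|²` in the normalized chart. -/
def confFactor (a : ℝ) (e y : Eu d) : ℝ := (1 - a ^ 2) * chartFactor (halfDist a) e y

theorem mink_lift_fderiv (m : ℝ) (Z : Mink d) {q : Mink d} (hq : 1 < -mink q Z) (W : Mink d) :
    fderiv ℝ (keplerPot m Z) q W = -(m * mink W Z / √((-mink q Z) ^ 2 - 1) ^ 3) := by
  have hlin : ∀ ε : ℝ, -mink (q + ε • W) Z = -mink q Z + ε * -mink W Z := fun ε => by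
    simp only [mink, Prod.fst_add, Prod.snd_add, Prod.smul_fst, Prod.smul_snd, inner_add_left,
      real_inner_smul_left, smul_eq_mul]
    ring
  have hcont : ContDiff ℝ 1 (fun q : Mink d => -mink q Z) := by
    have h1 : ContDiff ℝ 1 (fun q : Mink d => inner ℝ q.1 Z.1) := contDiff_fst.inner ℝ contDiff_const
    exact (h1.sub (contDiff_snd.mul contDiff_const)).neg
  -- The derivative is taken in the ambient space, where the algebraic form of `coth (arcosh X)`
  -- holds as long as `X ≥ 1`; strict inequality at `q` makes it valid nearby.
  have hev : keplerPot m Z =ᶠ[nhds q]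
      fun q => -(m * (-mink q Z * (√((-mink q Z) ^ 2 - 1))⁻¹)) := by
    filter_upwards [hcont.continuous.continuousAt.eventually_const_lt hq] with x hx
    rw [keplerPot, hdist, coth_arcosh hx.le, div_eq_mul_inv]
  have hpos : 0 < (-mink q Z) ^ 2 - 1 := by nlinarith
  have hs := (Real.sqrt_pos.2 hpos).ne'
  have hdiff : DifferentiableAt ℝ
      (fun q : Mink d => -(m * (-mink q Z * (√((-mink q Z) ^ 2 - 1))⁻¹))) q := by
    have h1 := hcont.contDiffAt (x := q)
    exact (((contDiffAt_const.mul (h1.mul ((((h1.pow 2).sub contDiffAt_const).sqrt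
      hpos.ne').inv hs))).neg).differentiableAt (by norm_num))
  rw [hev.fderiv_eq]
  apply fderiv_eq_of_hasDerivAt_line hdiff
  have dX : HasDerivAt (fun ε : ℝ => -mink (q + ε • W) Z) (-mink W Z) 0 := by
    simp only [hlin]
    simpa using ((hasDerivAt_id (0 : ℝ)).mul_const (-mink W Z)).const_add (-mink q Z)
  have h0 : -mink (q + (0 : ℝ) • W) Z = -mink q Z := by simp
  have h2 := ((dX.fun_pow 2).sub_const 1).sqrt (by rw [h0]; exact hpos.ne')
  refine (((dX.fun_mul (h2.fun_inv (by rw [h0]; exact hs))).const_mul m).fun_neg).congr_deriv ?_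
  rw [h0]
  generalize hX : -mink q Z = X at *
  have hsq : √(X ^ 2 - 1) ^ 2 = X ^ 2 - 1 := Real.sq_sqrt hpos.le
  generalize √(X ^ 2 - 1) = S at *
  norm_num
  field_simp
  linear_combination (-(m * mink W Z)) * hsq

theorem keplerPot_fderiv_tangent (ha : a ^ 2 < 1) (he : ‖e‖ = 1) (m : ℝ) {q : Mink d}
    (hq : q ∈ Hyp d) (hy : nPos a e q ≠ 0) {W : Mink d} (hW : mink q W = 0) :
    fderiv ℝ (keplerPot m (lift (a • e))) q W = (m / √(1 - a ^ 2)) *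
      inner ℝ (axisScale (√(1 - a ^ 2)) e (nPos a e q)) W.1 / (q.2 * ‖nPos a e q‖) ^ 3 := by
  have hq2 : 0 < q.2 := hq.2
  have hb : √(1 - a ^ 2) ≠ 0 := (Real.sqrt_pos.2 (by linarith)).ne'
  have hr : 0 < ‖nPos a e q‖ := norm_pos_iff.2 hy
  have hsq := neg_mink_sq_first ha he hq
  have hX : 1 < -mink q (lift (a • e)) := by
    have h1 := neg_mink_lift_pos he ha hq
    have h2 : 0 < (q.2 * ‖nPos a e q‖) ^ 2 := by positivity
    nlinarith
  rw [mink_lift_fderiv m _ hX, hsq, Real.sqrt_sq (by positivity)]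
  have hWt : W.2 = q.2⁻¹ * inner ℝ q.1 W.1 := by
    rw [mink] at hW
    field_simp
    linarith
  have hn : ‖a • e‖ ^ 2 = a ^ 2 := by rw [norm_smul, he, mul_one, Real.norm_eq_abs, sq_abs]
  have hx : axisScale (√(1 - a ^ 2)) e (nPos a e q) = q.2⁻¹ • q.1 - a • e := by
    rw [← shrink_nPos ha he q, map_sub, map_smul _ (halfDist a), axisScale_self he, halfDist,
      smul_smul, neg_mul, div_mul_cancel₀ _ hb]
    module
  rw [hx, inner_sub_left, real_inner_smul_left, real_inner_smul_left]
  simp only [mink, lift, hn, hWt, real_inner_smul_right, real_inner_comm e W.1]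
  field_simp
  ring

/-- Newton's equation in the chart. -/
theorem newton_iff (ha : a ^ 2 < 1) (he : ‖e‖ = 1) (m : ℝ) {q : Mink d}
    (hq : q ∈ Hyp d) (hy : nPos a e q ≠ 0) (A : Mink d) :
    (∀ W : Mink d, mink q W = 0 → mink A W = -fderiv ℝ (keplerPot m (lift (a • e))) q W) ↔
      q.2 • A.1 - A.2 • q.1 = axisScale (√(1 - a ^ 2)) e
        (-(confFactor a e (nPos a e q) * (m / √(1 - a ^ 2)) / ‖nPos a e q‖ ^ 3) • nPos a e q) := by
  have hq2 : q.2 ≠ 0 := hq.2.ne'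
  have hr := norm_ne_zero_iff.2 hy
  have hfac : q.2 ^ 2 * confFactor a e (nPos a e q) = 1 := hyp_factor ha he hq
  have hc : confFactor a e (nPos a e q) = (q.2 ^ 2)⁻¹ :=
    eq_inv_of_mul_eq_one_right hfac
  -- A tangent vector is determined by its spatial part, which is arbitrary. Testing against tangent
  -- vectors thus amounts to an equation in `ℝ^d` for `q_t A_s - A_t q_s`, the time derivative of
  -- the chart velocity.
  have hA : ∀ W : Mink d, mink q W = 0 →
      q.2 * mink A W = inner ℝ (q.2 • A.1 - A.2 • q.1) W.1 := fun W hW => by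
    rw [mink] at hW ⊢
    rw [inner_sub_left, real_inner_smul_left, real_inner_smul_left]
    linear_combination A.2 * hW
  have hB : ∀ W : Mink d, mink q W = 0 →
      q.2 * -fderiv ℝ (keplerPot m (lift (a • e))) q W = inner ℝ (axisScale (√(1 - a ^ 2)) e
        (-(confFactor a e (nPos a e q) * (m / √(1 - a ^ 2)) / ‖nPos a e q‖ ^ 3) • nPos a e q))
          W.1 := fun W hW => by
    rw [keplerPot_fderiv_tangent ha he m hq hy hW, map_smul, real_inner_smul_left, hc]
    field_simp
  constructor
  · intro h
    refine ext_inner_right ℝ fun v => ?_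
    have hW : mink q ((v, q.2⁻¹ * inner ℝ q.1 v) : Mink d) = 0 := by
      rw [mink]; field_simp; ring
    rw [← hA _ hW, h _ hW, hB _ hW]
  · intro h W hW
    apply mul_left_cancel₀ hq2
    rw [hA W hW, hB W hW, h]

theorem hasDerivAt_nPos (a : ℝ) (e : Eu d) {q : ℝ → Mink d} {v : Mink d} {t : ℝ}
    (hq : HasDerivAt q v t) (h0 : (q t).2 ≠ 0) :
    HasDerivAt (fun t => nPos a e (q t)) (((q t).2 ^ 2)⁻¹ • nVel a e (q t, v)) t := by
  have h1 : HasDerivAt (fun t => (q t).1) v.1 t := hq.fst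
  have h2 : HasDerivAt (fun t => (q t).2) v.2 t := hq.snd
  have h3 := (h2.fun_inv h0).fun_smul h1
  refine (((axisScale (√(1 - a ^ 2))⁻¹ e).hasFDerivAt.comp_hasDerivAt t h3).add_const
    (halfDist a • e)).congr_deriv ?_
  rw [nVel, ← map_smul, chartVel]
  refine congrArg _ ?_
  dsimp only
  match_scalars <;> field_simp

theorem hasDerivAt_chartVel {q v : ℝ → Mink d} {A : Mink d} {t : ℝ}
    (hq : HasDerivAt q (v t) t) (hv : HasDerivAt v A t) :
    HasDerivAt (fun t => chartVel (q t, v t)) ((q t).2 • A.1 - A.2 • (q t).1) t := by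
  have q1 : HasDerivAt (fun t => (q t).1) (v t).1 t := hq.fst
  have q2 : HasDerivAt (fun t => (q t).2) (v t).2 t := hq.snd
  have v1 : HasDerivAt (fun t => (v t).1) A.1 t := hv.fst
  have v2 : HasDerivAt (fun t => (v t).2) A.2 t := hv.snd
  refine ((q2.fun_smul v1).fun_sub (v2.fun_smul q1)).congr_deriv ?_
  module

theorem IsKeplerMotion.isChartMotion (ha : a ^ 2 < 1) (he : ‖e‖ = 1) {m : ℝ} {q v : ℝ → Mink d}
    (h : IsKeplerMotion m (lift (a • e)) q v) :
    IsChartMotion (m / √(1 - a ^ 2)) (fun t => confFactor a e (nPos a e (q t)))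
      (fun t => nPos a e (q t)) (fun t => nVel a e (q t, v t)) := by
  have hb : √(1 - a ^ 2) ≠ 0 := (Real.sqrt_pos.2 (by linarith)).ne'
  have hne : ∀ t, nPos a e (q t) ≠ 0 := fun t h0 => h.ne_center t <| by
    rw [← ofNPos_nPos ha he (h.mem_hyp t), h0, ofNPos_zero ha he]
  have hd := fun t => hasDerivAt_nPos a e (h.hasDerivAt_pos t) (h.mem_hyp t).2.ne'
  have hfac : ∀ t, ((q t).2 ^ 2)⁻¹ = confFactor a e (nPos a e (q t)) := fun t => by
    exact (eq_inv_of_mul_eq_one_right (hyp_factor ha he (h.mem_hyp t))).symm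
  refine ⟨hne, fun t => ?_, ?_, fun t => by simpa only [hfac] using hd t, fun t => ?_⟩
  · exact mul_pos (by linarith) (chartFactor_nPos_pos ha he (h.mem_hyp t))
  · have hc : Continuous fun t => nPos a e (q t) :=
      continuous_iff_continuousAt.2 fun t => (hd t).continuousAt
    have h1 : Continuous (chartFactor (halfDist a) e) :=
      continuous_iff_continuousAt.2 fun y => (contDiffAt_chartFactor _ _ y).continuousAt
    exact continuous_const.mul (h1.comp hc)
  · obtain ⟨A, hA, hN⟩ := h.newton t
    have h1 := (newton_iff ha he m (h.mem_hyp t) (hne t) A).1 hN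
    refine ((axisScale (√(1 - a ^ 2))⁻¹ e).hasFDerivAt.comp_hasDerivAt t
      (hasDerivAt_chartVel (h.hasDerivAt_pos t) hA)).congr_deriv ?_
    rw [h1, axisScale_axisScale he, inv_mul_cancel₀ hb, axisScale_one]

/-- The velocity in `ℝ^{d,1}` in terms of position and velocity in the chart. -/
def ofChartVel (x w : Eu d) : Mink d :=
  ((inner ℝ x w / √(1 - ‖x‖ ^ 2)) • x + √(1 - ‖x‖ ^ 2) • w, inner ℝ x w / √(1 - ‖x‖ ^ 2))

theorem chartVel_ofChartVel {x : Eu d} (hx : ‖x‖ ^ 2 < 1) (w : Eu d) :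
    chartVel (lift x, ofChartVel x w) = w := by
  have h : √(1 - ‖x‖ ^ 2) ≠ 0 := (Real.sqrt_pos.2 (by linarith)).ne'
  rw [chartVel, lift, ofChartVel]
  match_scalars <;> field_simp
  ring

theorem ofChartVel_chartVel {z : Mink d × Mink d} (hz : z ∈ THyp d) :
    ofChartVel (z.1.2⁻¹ • z.1.1) (chartVel z) = z.2 := by
  obtain ⟨⟨h1, h2⟩, h3⟩ := hz
  have h2' := h2.ne'
  rw [mink, real_inner_self_eq_norm_sq] at h1
  rw [mink] at h3
  have hs : √(1 - ‖z.1.2⁻¹ • z.1.1‖ ^ 2) = z.1.2⁻¹ := by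
    rw [norm_smul, mul_pow, norm_inv, Real.norm_eq_abs, inv_pow, sq_abs,
      show ‖z.1.1‖ ^ 2 = z.1.2 ^ 2 - 1 by linarith,
      show 1 - (z.1.2 ^ 2)⁻¹ * (z.1.2 ^ 2 - 1) = z.1.2⁻¹ ^ 2 by field_simp; ring]
    exact Real.sqrt_sq (by positivity)
  have hi : inner ℝ (z.1.2⁻¹ • z.1.1) (chartVel z) / z.1.2⁻¹ = z.2.2 := by
    rw [chartVel, real_inner_smul_left, inner_sub_right, real_inner_smul_right,
      real_inner_smul_right, real_inner_self_eq_norm_sq, show ‖z.1.1‖ ^ 2 = z.1.2 ^ 2 - 1 by linarith,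
      show inner ℝ z.1.1 z.2.1 = z.1.2 * z.2.2 by linarith]
    field_simp
    ring
  rw [ofChartVel, hs, hi, chartVel]
  ext1
  · dsimp only
    match_scalars <;> field_simp
    ring
  · rfl

theorem hasDerivAt_lift {x : ℝ → Eu d} {w : Eu d} {t : ℝ} (hx : ‖x t‖ ^ 2 < 1)
    (h : HasDerivAt x ((1 - ‖x t‖ ^ 2) • w) t) :
    HasDerivAt (fun t => lift (x t)) (ofChartVel (x t) w) t := by
  have hpos : 0 < 1 - ‖x t‖ ^ 2 := by linarith
  have hs : √(1 - ‖x t‖ ^ 2) ≠ 0 := (Real.sqrt_pos.2 hpos).ne'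
  have hsq : √(1 - ‖x t‖ ^ 2) ^ 2 = 1 - ‖x t‖ ^ 2 := Real.sq_sqrt hpos.le
  have h1 := ((h.norm_sq.const_sub 1).sqrt hpos.ne').fun_inv hs
  refine ((h1.fun_smul h).prodMk h1).congr_deriv ?_
  rw [ofChartVel, real_inner_smul_right, ← hsq]
  rw [Real.sqrt_sq (Real.sqrt_nonneg _)]
  ext1
  · dsimp only
    match_scalars <;> field_simp
  · dsimp only
    field_simp

/-- `orbitMean` takes its default value `0` where no closed orbit exists, so differentiating it
requires closed orbits through all nearby points of `Tℍ^d`. -/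
theorem exists_isClosedOrbit (ha : a ^ 2 < 1) (he : ‖e‖ = 1) (m : ℝ) {z : Mink d × Mink d}
    (hz : z ∈ THyp d) (hs : 0 < sqFreq (m / √(1 - a ^ 2)) (nPos a e z.1) (nVel a e z))
    (hc : ∀ u, orbit (m / √(1 - a ^ 2)) (nPos a e z.1, nVel a e z) u ≠ 0)
    (hP : ∀ u, 0 < chartFactor (halfDist a) e
      (orbit (m / √(1 - a ^ 2)) (nPos a e z.1, nVel a e z) u)) :
    ∃ q v T, IsClosedOrbit m (lift (a • e)) z q v T := by
  have hb1 : (0 : ℝ) < 1 - a ^ 2 := by linarith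
  have hb : √(1 - a ^ 2) ≠ 0 := (Real.sqrt_pos.2 hb1).ne'
  have hcf : Continuous (confFactor a e) := continuous_const.mul
    (continuous_iff_continuousAt.2 fun y => (contDiffAt_chartFactor _ _ y).continuousAt)
  obtain ⟨y, w, T, hT, hm, y0, w0, hper⟩ := exists_isChartMotion (P := confFactor a e) hs hc
    (hcf.comp (continuous_conic _ _)) (fun u => mul_pos hb1 (hP u))
  set B := axisScale (√(1 - a ^ 2)) e with hB
  set x : ℝ → Eu d := fun t => B (y t - halfDist a • e) with hx
  have hfac : ∀ t, 1 - ‖x t‖ ^ 2 = confFactor a e (y t) := fun t => norm_shrink_sq ha he (y t)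
  have hx1 : ∀ t, ‖x t‖ ^ 2 < 1 := fun t => by
    have := hm.factor_pos t
    rw [← hfac] at this
    linarith
  have hcp : ∀ t, 0 < chartFactor (halfDist a) e (y t) := fun t =>
    pos_of_mul_pos_right (hm.factor_pos t) hb1.le
  have dx : ∀ t, HasDerivAt x ((1 - ‖x t‖ ^ 2) • B (w t)) t := fun t => by
    refine (B.hasFDerivAt.comp_hasDerivAt t ((hm.hasDerivAt_pos t).sub_const _)).congr_deriv ?_
    rw [hfac, map_smul]
  have hq : ∀ t, lift (x t) = ofNPos a e (y t) := fun t => rfl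
  have hnp : ∀ t, nPos a e (lift (x t)) = y t := fun t => nPos_ofNPos ha he (hcp t)
  have dw : ∀ t, HasDerivAt (fun t => B (w t))
      (B (-(confFactor a e (y t) * (m / √(1 - a ^ 2)) / ‖y t‖ ^ 3) • y t)) t := fun t =>
    B.hasFDerivAt.comp_hasDerivAt t (hm.hasDerivAt_vel t)
  have dq : ∀ t, HasDerivAt (fun t => lift (x t)) (ofChartVel (x t) (B (w t))) t := fun t =>
    hasDerivAt_lift (hx1 t) (dx t)
  refine ⟨fun t => lift (x t), fun t => ofChartVel (x t) (B (w t)), T,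
    ⟨fun t => lift_mem_hyp (hx1 t), fun t h0 => ?_, dq, fun t => ?_⟩, ?_, hT, fun t => ?_⟩
  · apply hm.ne_zero t
    rw [← hnp t]
    change lift (x t) = _ at h0
    rw [h0, ← ofNPos_zero ha he, nPos_ofNPos ha he (by simp [chartFactor])]
  · have hpos : 0 < 1 - ‖x t‖ ^ 2 := by linarith [hx1 t]
    have hs0 : √(1 - ‖x t‖ ^ 2) ≠ 0 := (Real.sqrt_pos.2 hpos).ne'
    have d1 := ((dx t).norm_sq.const_sub 1).sqrt hpos.ne'
    have d2 := (((dx t).inner ℝ (dw t)).fun_mul (d1.fun_inv hs0))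
    -- The acceleration need not be computed: it exists, and Newton's equation follows from
    -- uniqueness of the derivative of the chart velocity, which is known to be `B (w t)`.
    have hdv : DifferentiableAt ℝ (fun t => ofChartVel (x t) (B (w t))) t := by
      simp only [ofChartVel, div_eq_mul_inv]
      exact (((d2.fun_smul (dx t)).fun_add (d1.fun_smul (dw t))).prodMk d2).differentiableAt
    have dv := hdv.hasDerivAt
    refine ⟨_, dv, ?_⟩
    rw [newton_iff ha he m (lift_mem_hyp (hx1 t)) (by rw [hnp]; exact hm.ne_zero t), hnp]
    have h1 := hasDerivAt_chartVel (q := fun t => lift (x t)) (dq t) dv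
    simp only [chartVel_ofChartVel (hx1 _)] at h1
    exact h1.unique (dw t)
  · have hx0 : x 0 = z.1.2⁻¹ • z.1.1 := by
      rw [hx]; dsimp only; rw [y0]; exact shrink_nPos ha he z.1
    have hw0 : B (w 0) = chartVel z := by rw [w0]; exact shrink_nVel ha he z
    change (lift (x 0), ofChartVel (x 0) (B (w 0))) = z
    rw [hx0, hw0, ofChartVel_chartVel hz, lift_chartPos hz.1]
  · simp only [hx, hper t]

end Bridge

/-! ### Openness of the averaging region in terms of initial data. -/

section Admissible
variable {E : Type*} [NormedAddCommGroup E] [InnerProductSpace ℝ E]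

theorem IsShiftPair.add {h : ℝ} {e y : E} {Ψ₁ S₁ Ψ₂ S₂ : E → ℝ} (h₁ : IsShiftPair h e Ψ₁ S₁ y)
    (h₂ : IsShiftPair h e Ψ₂ S₂ y) :
    IsShiftPair h e (fun y => Ψ₁ y + Ψ₂ y) (fun y => S₁ y + S₂ y) y := by
  have one : (1 : WithTop ℕ∞) ≠ 0 := by norm_num
  refine ⟨h₁.contDiffAt_left.add h₂.contDiffAt_left, h₁.contDiffAt_right.add h₂.contDiffAt_right,
    fun v => ?_⟩
  rw [fderiv_fun_add (h₁.contDiffAt_left.differentiableAt one)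
      (h₂.contDiffAt_left.differentiableAt one),
    fderiv_fun_add (h₁.contDiffAt_right.differentiableAt one)
      (h₂.contDiffAt_right.differentiableAt one),
    add_apply, add_apply, h₁.fderiv_eq, h₂.fderiv_eq]

theorem IsShiftPair.const_mul {h : ℝ} {e y : E} {Ψ S : E → ℝ} (hΨ : IsShiftPair h e Ψ S y) (c : ℝ) :
    IsShiftPair h e (fun y => c * Ψ y) (fun y => c * S y) y := by
  have one : (1 : WithTop ℕ∞) ≠ 0 := by norm_num
  refine ⟨contDiffAt_const.mul hΨ.contDiffAt_left, contDiffAt_const.mul hΨ.contDiffAt_right,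
    fun v => ?_⟩
  rw [fderiv_const_mul (hΨ.contDiffAt_left.differentiableAt one),
    fderiv_const_mul (hΨ.contDiffAt_right.differentiableAt one),
    smul_apply, smul_apply, hΨ.fderiv_eq]

/-- The initial values of the elliptic Kepler orbits that avoid both centers and stay in the
chart of hyperbolic space. -/
structure IsAdmissible (μ h : ℝ) (e : E) (z : E × E) : Prop where
  sqFreq_pos : 0 < sqFreq μ z.1 z.2
  orbit_ne_zero : ∀ u, orbit μ z u ≠ 0
  factor_pos : ∀ u, 0 < chartFactor h e (orbit μ z u)
  orbit_ne_second : ∀ u, orbit μ z u ≠ (2 * h) • e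

variable {μ h : ℝ} {e : E} {z : E × E}

theorem IsAdmissible.fst_ne_zero (hz : IsAdmissible μ h e z) : z.1 ≠ 0 := by
  simpa [orbit, conic_zero] using hz.orbit_ne_zero 0

theorem continuous_chartFactor (h : ℝ) (e : E) : Continuous (chartFactor h e) :=
  continuous_iff_continuousAt.2 fun y => (contDiffAt_chartFactor h e y).continuousAt

theorem continuous_orbit (μ : ℝ) (z : E × E) : Continuous (orbit μ z) := continuous_conic _ _

/-- The conditions are open at each anomaly; compactness of `[0, 2π]` makes them uniform, and
periodicity extends them to all `u`. -/
theorem IsAdmissible.eventually (hz : IsAdmissible μ h e z) :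
    ∀ᶠ z' in nhds z, IsAdmissible μ h e z' := by
  have hs : ∀ᶠ z' : E × E in nhds z, 0 < sqFreq μ z'.1 z'.2 :=
    (contDiffAt_sqFreq μ hz.fst_ne_zero).continuousAt.eventually_const_lt hz.sqFreq_pos
  have ho : ∀ᶠ z' : E × E in nhds z, ∀ u ∈ Set.Icc (0 : ℝ) (2 * Real.pi), orbit μ z' u ≠ 0 ∧
      0 < chartFactor h e (orbit μ z' u) ∧ orbit μ z' u ≠ (2 * h) • e := by
    refine isCompact_Icc.eventually_forall_of_forall_eventually fun u _ => ?_
    have hc := (contDiffAt_orbit μ hz.fst_ne_zero hz.sqFreq_pos u).continuousAt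
    exact (hc.eventually_ne (hz.orbit_ne_zero u)).and
      ((((continuous_chartFactor h e).continuousAt.comp hc).eventually_const_lt
        (hz.factor_pos u)).and (hc.eventually_ne (hz.orbit_ne_second u)))
  filter_upwards [hs, ho] with z' hs' ho'
  have hall : ∀ u, orbit μ z' u ≠ 0 ∧ 0 < chartFactor h e (orbit μ z' u) ∧
      orbit μ z' u ≠ (2 * h) • e := fun u => by
    obtain ⟨u', hu', huu⟩ := (conic_periodic z'.1 (anomVel μ z')).exists_mem_Ico₀
      Real.two_pi_pos u
    rw [show orbit μ z' u = orbit μ z' u' from huu]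
    exact ho' u' ⟨hu'.1, hu'.2.le⟩
  exact ⟨hs', fun u => (hall u).1, fun u => (hall u).2.1, fun u => (hall u).2.2⟩

/-- The linear combinations of the basic integrands whose orbit integrals are invariant. -/
def basicIntegrand (h : ℝ) (e : E) (α β γ : ℝ) (y : E) : ℝ :=
  α * (‖y‖ / chartFactor h e y * secondPot h e y) + β * (‖y‖ / chartFactor h e y) + γ * ‖y‖

theorem orbitIntegral_basicIntegrand_variation (he : ‖e‖ = 1) (hz : IsAdmissible μ h e z)
    (α β γ : ℝ) :
    DifferentiableAt ℝ (orbitIntegral μ (basicIntegrand h e α β γ)) z ∧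
      fderiv ℝ (orbitIntegral μ (basicIntegrand h e α β γ)) z
        (fieldPos h e z.1 z.2, fieldVel μ h e z.1 z.2) = 0 :=
  orbitIntegral_variation he μ h hz.sqFreq_pos hz.orbit_ne_zero fun u =>
    (((isShiftPair_secondPot he h (hz.orbit_ne_zero u) (hz.factor_pos u).ne'
      (hz.orbit_ne_second u)).const_mul α).add ((isShiftPair_weight he h (hz.orbit_ne_zero u)
        (hz.factor_pos u).ne').const_mul β)).add
          ((isShiftPair_norm h (hz.orbit_ne_zero u)).const_mul γ)

theorem orbitIntegral_weight_pos (hz : IsAdmissible μ h e z) {β : ℝ} (hβ : 0 < β) :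
    0 < orbitIntegral μ (basicIntegrand h e 0 β 0) z := by
  have hpos : ∀ u, 0 < basicIntegrand h e 0 β 0 (orbit μ z u) := fun u => by
    have h1 := norm_pos_iff.2 (hz.orbit_ne_zero u)
    have h2 := hz.factor_pos u
    simp only [basicIntegrand, zero_mul, zero_add, add_zero]
    positivity
  have hc : Continuous fun u => basicIntegrand h e 0 β 0 (orbit μ z u) := by
    simp only [basicIntegrand, zero_mul, zero_add, add_zero]
    exact continuous_const.mul ((continuous_orbit μ z).norm.div
      ((continuous_chartFactor h e).comp (continuous_orbit μ z)) fun u => (hz.factor_pos u).ne')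
  exact intervalIntegral.intervalIntegral_pos_of_pos (hc.intervalIntegrable _ _) hpos
    Real.two_pi_pos

end Admissible

/-! ### The averaged energy and the bracket. -/

section Averaging
variable {d : ℕ} {a : ℝ} {e : Eu d}

/-- In the normalized chart, a combination of the potentials of the second Kepler center and of
the Hooke center. -/
def chartPert (a : ℝ) (e : Eu d) (α β : ℝ) (y : Eu d) : ℝ :=
  α * secondPot (halfDist a) e y + β * (1 - confFactor a e y)

/-- Multiplying the Hooke term `1 - P` by `‖y‖ / P` gives `‖y‖ / P - ‖y‖`, whence the coefficient
`-β` of the bare norm. -/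
theorem weight_mul_chartPert (ha : a ^ 2 < 1) (α β : ℝ) {y : Eu d}
    (hy : 0 < chartFactor (halfDist a) e y) :
    ‖y‖ / confFactor a e y * chartPert a e α β y =
      basicIntegrand (halfDist a) e (α / (1 - a ^ 2)) (β / (1 - a ^ 2)) (-β) y := by
  have h1 : 1 - a ^ 2 ≠ 0 := by linarith
  have hy' := hy.ne'
  rw [chartPert, basicIntegrand, confFactor]
  field_simp
  ring

theorem weight_mul_one (ha : a ^ 2 < 1) {y : Eu d}
    (hy : 0 < chartFactor (halfDist a) e y) :
    ‖y‖ / confFactor a e y * 1 = basicIntegrand (halfDist a) e 0 (1 / (1 - a ^ 2)) 0 y := by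
  have h1 : 1 - a ^ 2 ≠ 0 := by linarith
  have hy' := hy.ne'
  rw [basicIntegrand, confFactor]
  field_simp
  ring

theorem IsClosedOrbit.vel_periodic {m T : ℝ} {Z : Mink d} {z : Mink d × Mink d}
    {q v : ℝ → Mink d} (h : IsClosedOrbit m Z z q v T) : v T = v 0 := by
  have h1 : HasDerivAt q (v T) (0 + T) := by rw [zero_add]; exact h.motion.hasDerivAt_pos T
  have h2 := h1.comp_add_const
  rw [show (fun t => q (t + T)) = q from funext h.periodic] at h2
  exact h2.unique (h.motion.hasDerivAt_pos 0)

/-- The mean over a closed orbit, computed in the chart with the eccentric anomaly. -/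
theorem IsClosedOrbit.mean_eq (ha : a ^ 2 < 1) (he : ‖e‖ = 1) {m T : ℝ} (hm : 0 < m)
    {z : Mink d × Mink d} {q v : ℝ → Mink d} (h : IsClosedOrbit m (lift (a • e)) z q v T)
    (hz : IsAdmissible (m / √(1 - a ^ 2)) (halfDist a) e (nPos a e z.1, nVel a e z))
    {V : Mink d → ℝ} {α β : ℝ} (hV : ∀ q ∈ Hyp d, V q = chartPert a e α β (nPos a e q)) :
    T⁻¹ * ∫ t in (0 : ℝ)..T, V (q t) =
      orbitIntegral (m / √(1 - a ^ 2)) (basicIntegrand (halfDist a) e (α / (1 - a ^ 2))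
          (β / (1 - a ^ 2)) (-β)) (nPos a e z.1, nVel a e z) /
        orbitIntegral (m / √(1 - a ^ 2)) (basicIntegrand (halfDist a) e 0 (1 / (1 - a ^ 2)) 0)
          (nPos a e z.1, nVel a e z) := by
  have hμ : 0 < m / √(1 - a ^ 2) := div_pos hm (Real.sqrt_pos.2 (by linarith))
  have hcm := h.motion.isChartMotion ha he
  have hq : q T = q 0 := by simpa using h.periodic 0
  have hstart : (nPos a e (q 0), nVel a e (q 0, v 0)) = (nPos a e z.1, nVel a e z) := by
    rw [← h.start]
  set c := (nPos a e z.1, nVel a e z) with hc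
  have hcf : Continuous (confFactor a e) := continuous_const.mul (continuous_chartFactor _ _)
  obtain ⟨K, hK, hint⟩ := hcm.integral_eq hμ h.period_pos (by rw [hq])
    (by rw [hq, h.vel_periodic]) (P := confFactor a e) (fun t => rfl)
    (hcf.comp (continuous_orbit _ _))
  rw [hstart] at hint
  have hcp : Continuous fun u => chartPert a e α β (orbit (m / √(1 - a ^ 2)) c u) := by
    have h1 : Continuous fun u => secondPot (halfDist a) e (orbit (m / √(1 - a ^ 2)) c u) :=
      continuous_iff_continuousAt.2 fun u =>
        (contDiffAt_secondPot _ (hz.orbit_ne_second u)).continuousAt.comp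
          (continuous_orbit _ _).continuousAt
    exact (continuous_const.mul h1).add (continuous_const.mul
      (continuous_const.sub (hcf.comp (continuous_orbit _ _))))
  have hT := hint (fun _ => 1) continuous_const
  have hN := hint (chartPert a e α β) hcp
  rw [intervalIntegral.integral_const, sub_zero, smul_eq_mul, mul_one] at hT
  have e1 : orbitIntegral (m / √(1 - a ^ 2)) (fun y => ‖y‖ / confFactor a e y * 1) c =
      orbitIntegral (m / √(1 - a ^ 2))
        (basicIntegrand (halfDist a) e 0 (1 / (1 - a ^ 2)) 0) c :=
    intervalIntegral.integral_congr fun u _ => weight_mul_one ha (hz.factor_pos u)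
  have e2 : orbitIntegral (m / √(1 - a ^ 2))
        (fun y => ‖y‖ / confFactor a e y * chartPert a e α β y) c =
      orbitIntegral (m / √(1 - a ^ 2)) (basicIntegrand (halfDist a) e (α / (1 - a ^ 2))
          (β / (1 - a ^ 2)) (-β)) c :=
    intervalIntegral.integral_congr fun u _ => weight_mul_chartPert ha α β (hz.factor_pos u)
  rw [e1] at hT
  rw [e2] at hN
  simp only [hV _ (h.motion.mem_hyp _)]
  rw [hN, hT, ← div_eq_inv_mul, mul_div_mul_left _ _ hK]

/-- `mean_eq` gives the same value for every closed orbit and every period, so the choice made in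
`orbitMean` is immaterial. -/
theorem orbitMean_eq (ha : a ^ 2 < 1) (he : ‖e‖ = 1) {m : ℝ} (hm : 0 < m)
    {z : Mink d × Mink d} (hzT : z ∈ THyp d)
    (hz : IsAdmissible (m / √(1 - a ^ 2)) (halfDist a) e (nPos a e z.1, nVel a e z))
    {V : Mink d → ℝ} {α β : ℝ} (hV : ∀ q ∈ Hyp d, V q = chartPert a e α β (nPos a e q)) :
    orbitMean m (lift (a • e)) V z =
      orbitIntegral (m / √(1 - a ^ 2)) (basicIntegrand (halfDist a) e (α / (1 - a ^ 2))
          (β / (1 - a ^ 2)) (-β)) (nPos a e z.1, nVel a e z) /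
        orbitIntegral (m / √(1 - a ^ 2)) (basicIntegrand (halfDist a) e 0 (1 / (1 - a ^ 2)) 0)
          (nPos a e z.1, nVel a e z) := by
  obtain ⟨q, v, T, h⟩ := exists_isClosedOrbit ha he m hzT hz.sqFreq_pos hz.orbit_ne_zero
    hz.factor_pos
  have hex : ∃ o : (ℝ → Mink d) × (ℝ → Mink d) × ℝ,
      IsClosedOrbit m (lift (a • e)) z o.1 o.2.1 o.2.2 := ⟨(q, v, T), h⟩
  rw [orbitMean, dif_pos hex]
  exact hex.choose_spec.mean_eq ha he hm hz hV

/-- Every point of the ellipse is a position of the actual motion (`exists_time`), so what holds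
along the motion holds for all anomalies. -/
theorem isAdmissible_of_mem_region (ha : a ^ 2 < 1) (he : ‖e‖ = 1) {m : ℝ} (hm : 0 < m)
    {z : Mink d × Mink d} (hz : z ∈ region m (lift (a • e)) (lift (-a • e))) :
    IsAdmissible (m / √(1 - a ^ 2)) (halfDist a) e (nPos a e z.1, nVel a e z) := by
  obtain ⟨-, q, v, T, h, hne⟩ := hz
  have hμ : 0 < m / √(1 - a ^ 2) := div_pos hm (Real.sqrt_pos.2 (by linarith))
  have hcm := h.motion.isChartMotion ha he
  have hq : q T = q 0 := by simpa using h.periodic 0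
  have hstart : (nPos a e (q 0), nVel a e (q 0, v 0)) = (nPos a e z.1, nVel a e z) := by
    rw [← h.start]
  have hs := hcm.sqFreq_pos hμ h.period_pos (by rw [hq]) (by rw [hq, h.vel_periodic])
  have ho := hcm.exists_time hμ h.period_pos (by rw [hq]) (by rw [hq, h.vel_periodic])
  rw [← hstart]
  refine ⟨hs, fun u => ?_, fun u => ?_, fun u => ?_⟩ <;> obtain ⟨t, ht⟩ := ho u <;> rw [ht]
  · exact hcm.ne_zero t
  · exact chartFactor_nPos_pos ha he (h.motion.mem_hyp t)
  · intro h2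
    apply hne t
    rw [← ofNPos_nPos ha he (h.motion.mem_hyp t), h2, ofNPos_second ha he]

theorem poisson_averagedEnergy_D (ha : a ^ 2 < 1) (he : ‖e‖ = 1) {m : ℝ} (hm : 0 < m)
    {z : Mink d × Mink d} (hz : z ∈ region m (lift (a • e)) (lift (-a • e)))
    {V : Mink d → ℝ} {α β : ℝ} (hV : ∀ q ∈ Hyp d, V q = chartPert a e α β (nPos a e q)) :
    DiffAtTHyp (averagedEnergy m (lift (a • e)) V) z ∧
      poisson (averagedEnergy m (lift (a • e)) V) (D m a e) z = 0 := by
  set μ := m / √(1 - a ^ 2) with hμ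
  set c := toCanonical z with hc
  have hcz : ofCanonical c = z := ofCanonical_toCanonical hz.1
  have hadm : IsAdmissible μ (halfDist a) e (chartMap a e c) := by
    rw [chartMap, hcz]
    exact isAdmissible_of_mem_region ha he hm hz
  have hcont := contDiff_chartMap a e
  set N := orbitIntegral μ (basicIntegrand (halfDist a) e (α / (1 - a ^ 2))
    (β / (1 - a ^ 2)) (-β)) with hN
  set W := orbitIntegral μ (basicIntegrand (halfDist a) e 0 (1 / (1 - a ^ 2)) 0) with hW
  set F : Eu d × Eu d → ℝ := fun z => chartEnergy μ (halfDist a) e z + N z / W z with hF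
  -- Equality near `c` suffices for derivatives. Admissibility, being open, supplies it at the
  -- nearby points.
  have hev : averagedEnergy m (lift (a • e)) V ∘ ofCanonical =ᶠ[nhds c] F ∘ chartMap a e := by
    filter_upwards [hcont.continuous.continuousAt.eventually hadm.eventually] with c' hc'
    exact congrArg₂ _ (keplerEnergy_eq_chartEnergy ha he m c' hc'.fst_ne_zero)
      (orbitMean_eq ha he hm (ofCanonical_mem c') hc' hV)
  obtain ⟨dE, vE⟩ := chartEnergy_variation he μ (halfDist a) hadm.fst_ne_zero
  obtain ⟨dN, vN⟩ := orbitIntegral_basicIntegrand_variation he hadm (α / (1 - a ^ 2))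
    (β / (1 - a ^ 2)) (-β)
  obtain ⟨dW, vW⟩ := orbitIntegral_basicIntegrand_variation he hadm 0 (1 / (1 - a ^ 2)) 0
  have hW0 : W (chartMap a e c) ≠ 0 :=
    (orbitIntegral_weight_pos hadm (one_div_pos.2 (by linarith))).ne'
  have dQ : DifferentiableAt ℝ (fun z => N z / W z) (chartMap a e c) := by
    simp only [div_eq_mul_inv (N _)]
    exact dN.fun_mul (dW.fun_inv hW0)
  have dF : DifferentiableAt ℝ F (chartMap a e c) := dE.fun_add dQ
  refine ⟨?_, ?_⟩
  · exact (dF.comp c (hcont.contDiffAt.differentiableAt (by norm_num))).congr_of_eventuallyEq hev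
  · have hD : D m a e ∘ ofCanonical = fun c =>
        chartD μ (halfDist a) e (chartMap a e c).1 (chartMap a e c).2 :=
      funext fun c => D_eq_chartD ha he m (ofCanonical c)
    rw [poisson, hD]
    have := canonicalBracket_chartD ha he μ hadm.fst_ne_zero dF
    rw [canonicalBracket] at this ⊢
    rw [← hc, hev.fderiv_eq, this, hF, fderiv_fun_add dE dQ, add_apply, vE,
      fderiv_div_apply dN dW hW0, vN, vW]
    ring

theorem diffAtTHyp_D (ha : a ^ 2 < 1) (he : ‖e‖ = 1) {m : ℝ} (hm : 0 < m)
    {z : Mink d × Mink d} (hz : z ∈ region m (lift (a • e)) (lift (-a • e))) :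
    DiffAtTHyp (D m a e) z := by
  have hadm := (isAdmissible_of_mem_region ha he hm hz).fst_ne_zero
  have hD : D m a e ∘ ofCanonical = (fun z : Eu d × Eu d =>
      chartD (m / √(1 - a ^ 2)) (halfDist a) e z.1 z.2) ∘ chartMap a e :=
    funext fun c => D_eq_chartD ha he m (ofCanonical c)
  rw [DiffAtTHyp, hD]
  refine DifferentiableAt.comp _ (differentiableAt_chartD _ _ _ ?_)
    ((contDiff_chartMap a e).contDiffAt.differentiableAt (by norm_num))
  rw [chartMap, ofCanonical_toCanonical hz.1]
  exact hadm

end Averaging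

end HypKepler

end

theorem mainTheorem6 (d : ℕ) (e : HypKepler.Eu d) (he : ‖e‖ = 1)
    (a : ℝ) (ha : 0 < a) (ha1 : a < 1) (m₁ : ℝ) (hm₁ : 0 < m₁) (m₂ f : ℝ)
    (z : HypKepler.Mink d × HypKepler.Mink d)
    (hz : z ∈ HypKepler.region m₁ (HypKepler.lift (a • e)) (HypKepler.lift (-a • e))) :
    HypKepler.DiffAtTHyp (HypKepler.D m₁ a e) z ∧
    (HypKepler.DiffAtTHyp (HypKepler.averagedEnergy m₁ (HypKepler.lift (a • e))
        (HypKepler.twoCenterPert m₂ a e)) z ∧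
      HypKepler.poisson (HypKepler.averagedEnergy m₁ (HypKepler.lift (a • e))
        (HypKepler.twoCenterPert m₂ a e)) (HypKepler.D m₁ a e) z = 0) ∧
    (HypKepler.DiffAtTHyp (HypKepler.averagedEnergy m₁ (HypKepler.lift (a • e))
        (HypKepler.lagrangePert m₂ f a e)) z ∧
      HypKepler.poisson (HypKepler.averagedEnergy m₁ (HypKepler.lift (a • e))
        (HypKepler.lagrangePert m₂ f a e)) (HypKepler.D m₁ a e) z = 0) := by
  have ha2 : a ^ 2 < 1 := by nlinarith
  -- The coefficient `α` is the factor in `keplerPot_second`; the Hooke factor enters as `β`.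
  refine ⟨HypKepler.diffAtTHyp_D ha2 he hm₁ hz,
    HypKepler.poisson_averagedEnergy_D (α := -(m₂ * √(1 - a ^ 2))) (β := 0) ha2 he hm₁ hz
      fun q hq => ?_,
    HypKepler.poisson_averagedEnergy_D (α := -(m₂ * √(1 - a ^ 2))) (β := f) ha2 he hm₁ hz
      fun q hq => ?_⟩
  · rw [HypKepler.twoCenterPert, HypKepler.keplerPot_second ha2 he m₂ hq, HypKepler.chartPert]
    ring
  · rw [HypKepler.lagrangePert, HypKepler.keplerPot_second ha2 he m₂ hq,
      HypKepler.hookePot_mid ha2 he f hq, HypKepler.chartPert, HypKepler.confFactor]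
    ring
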